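/- Let $T>0$ and let $\mathbb T^3=(\mathbb R/\mathbb Z)^3$. For $1\le q,p\le\infty$ write $L^q_t(L^p_x)=L^q([0,T];L^p(\mathbb T^3))$ for the space of (classes of) measurable real functions on $[0,T]\times\mathbb T^3$ with $\big\|\,t\mapsto\|f(t,\cdot)\|_{L^p(\mathbb T^3)}\big\|_{L^q(0,T)}<\infty$, and similarly $L^q_t(W^{1,p}_x)$ and $L^q_t(H^{\sigma}_x)$, $\sigma\in\mathbb Z$; a prime denotes the conjugate exponent. Weak-$\star$ convergence in $L^q_t(L^p_x)$ means that the sequence and its limit lie in this space and that convergence holds against every element of $L^{q'}_t(L^{p'}_x)$; weak-$\star$ convergence in $L^q_t(W^{1,p}_x)$ means that the functions and their weak spatial derivatives converge weakly-$\star$ in $L^q_t(L^p_x)$ to the limit and its weak spatial derivatives. Let $q\in[1,\infty)$, $p\in[1,3)$, $1\le s<p^\star:=\frac{3p}{3-p}$, $r\in(q,\infty]$ and $m\in\mathbb Z$. Let $(a_\varepsilon)_{\varepsilon>0}$ and $(b_\varepsilon)_{\varepsilon>0}$ be families such that, as $\varepsilon\to0^+$, \begin{align*} a_\varepsilon&\rightharpoonup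 a\quad\text{weakly-}\star\text{ in }L^q_t(W^{1,p}_x)\text{ and weakly-}\star\text{ in }L^r_t(L^p_x),\\ b_\varepsilon&\rightharpoonup b\quad\text{weakly-}\star\text{ in }L^{q'}_t(L^{s'}_x), \end{align*} and such that the distributional time derivatives $(\partial_t b_\varepsilon)_{\varepsilon>0}$ on $(0,T)\times\mathbb T^3$ are bounded in $L^1_t(H^{-m}_x)$. Then all $a_\varepsilon b_\varepsilon$ and $ab$ belong to $L^1([0,T]\times\mathbb T^3)$ and, up to a subsequence, $a_\varepsilon b_\varepsilon\rightharpoonup ab$ in the sense of measures: every sequence $\varepsilon_n\to0^+$ has a subsequence $(\varepsilon_{n_k})_k$ such that for all $\theta\in C^0([0,T]\times\mathbb T^3)$, $$\int_0^T\!\!\int_{\mathbb T^3}a_{\varepsilon_{n_k}}b_{\varepsilon_{n_k}}\,\theta\,dx\,dt\;\longrightarrow\;\int_0^T\!\!\int_{\mathbb T^3}a\,b\,\theta\,dx\,dt\qquad(k\to\infty).$$ -/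

import Mathlib

open Set Filter Topology MeasureTheory
open scoped ENNReal NNReal ContDiff

noncomputable section

namespace WeakProduct

/-- The torus `𝕋³ = (ℝ/ℤ)³`. -/
abbrev T3 : Type := UnitAddTorus (Fin 3)

/-- The Lebesgue measure of `𝕋³` (total mass one). -/
def torusMeasure : Measure T3 :=
  Measure.pi fun _ : Fin 3 => (AddCircle.haarAddCircle : Measure UnitAddCircle)

/-- The Lebesgue measure of the time interval `[0, T]`. -/
def timeMeasure (T : ℝ) : Measure ℝ := volume.restrict (Icc 0 T)

/-- The Lebesgue measure of `[0, T] × 𝕋³`. -/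
def stMeasure (T : ℝ) : Measure (ℝ × T3) := (timeMeasure T).prod torusMeasure

/-! ### The spaces `L^q_t(L^p_x)` -/

/-- The norm of `L^q([0, T]; L^p(𝕋³))`, with values in `[0, ∞]`. -/
def mixedNorm (T : ℝ) (q p : ℝ≥0∞) (f : ℝ × T3 → ℝ) : ℝ≥0∞ :=
  eLpNorm (fun t : ℝ => eLpNorm (fun x : T3 => f (t, x)) p torusMeasure) q (timeMeasure T)

/-- `f ∈ L^q([0, T]; L^p(𝕋³))`. -/
def MemMixed (T : ℝ) (q p : ℝ≥0∞) (f : ℝ × T3 → ℝ) : Prop :=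
  AEStronglyMeasurable f (stMeasure T) ∧ mixedNorm T q p f < (⊤ : ℝ≥0∞)

/-- Weak-* convergence of `(u_ε)` to `u` in `L^q_t(L^p_x)` as `ε → 0⁺`: convergence of the
duality brackets with all elements of `L^{q'}_t(L^{p'}_x)`. -/
def TendstoWeakStarMixed (T : ℝ) (q p : ℝ≥0∞) (u : ℝ → ℝ × T3 → ℝ) (u₀ : ℝ × T3 → ℝ) : Prop :=
  (∀ ε : ℝ, 0 < ε → MemMixed T q p (u ε)) ∧ MemMixed T q p u₀ ∧
    ∀ ψ : ℝ × T3 → ℝ, MemMixed T q.conjExponent p.conjExponent ψ →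
      Tendsto (fun ε : ℝ => ∫ z, u ε z * ψ z ∂(stMeasure T)) (𝓝[>] 0)
        (𝓝 (∫ z, u₀ z * ψ z ∂(stMeasure T)))

/-! ### The spaces `L^q_t(W^{1,p}_x)` -/

/-- `φ ∈ C^∞(𝕋³)`: the periodic lift of `φ` to `ℝ³` is smooth. -/
def SmoothTorus (φ : T3 → ℝ) : Prop :=
  ContDiff ℝ ∞ fun y : Fin 3 → ℝ => φ fun i => (y i : UnitAddCircle)

/-- The partial derivative `∂φ/∂x_i` on the torus. -/
def torusPartial (i : Fin 3) (φ : T3 → ℝ) (x : T3) : ℝ :=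
  deriv (fun h : ℝ => φ (x + Pi.single i (h : UnitAddCircle))) 0

/-- `g` is the weak spatial gradient of `a` on `[0, T] × 𝕋³`: for almost every `t ∈ [0, T]` and
each `i`, the function `g i (t, ·)` is the weak derivative `∂_i a(t, ·)` on `𝕋³`. -/
def IsWeakGrad (T : ℝ) (a : ℝ × T3 → ℝ) (g : Fin 3 → ℝ × T3 → ℝ) : Prop :=
  ∀ᵐ t ∂(timeMeasure T), ∀ i : Fin 3, ∀ φ : T3 → ℝ, SmoothTorus φ →
    ∫ x, a (t, x) * torusPartial i φ x ∂torusMeasure = -∫ x, g i (t, x) * φ x ∂torusMeasure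

/-- Weak-* convergence of `(u_ε)` to `u` in `L^q_t(W^{1,p}_x)` as `ε → 0⁺`: the functions `u_ε`,
`u` and their weak spatial gradients belong to `L^q_t(L^p_x)`, and both `u_ε → u` and
`∂_i u_ε → ∂_i u` weakly-* there. -/
def TendstoWeakStarSobolev (T : ℝ) (q p : ℝ≥0∞) (u : ℝ → ℝ × T3 → ℝ) (u₀ : ℝ × T3 → ℝ) : Prop :=
  TendstoWeakStarMixed T q p u u₀ ∧
    ∃ (G : ℝ → Fin 3 → ℝ × T3 → ℝ) (g : Fin 3 → ℝ × T3 → ℝ),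
      (∀ ε : ℝ, 0 < ε → IsWeakGrad T (u ε) (G ε)) ∧ IsWeakGrad T u₀ g ∧
        ∀ i : Fin 3, TendstoWeakStarMixed T q p (fun ε => G ε i) (g i)

/-! ### The spaces `L^1_t(H^{-m}_x)` and the time derivative -/

/-- The norm of `H^σ(𝕋³)`, `σ ∈ ℤ`, with values in `[0, ∞]`. A distribution on `𝕋³` is given by
its family `c` of Fourier coefficients, and it is in `H^σ(𝕋³)` if and only if
`∑_k (1 + |k|²)^σ |c_k|² < ∞`. For `m ∈ ℕ` the space `H^{-m}(𝕋³)` is the dual of `H^m(𝕋³)`. -/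
def sobolevNorm (σ : ℤ) (c : (Fin 3 → ℤ) → ℂ) : ℝ≥0∞ :=
  (∑' k : Fin 3 → ℤ,
    ENNReal.ofReal ((1 + ∑ i, (k i : ℝ) ^ 2) ^ σ) * ‖c k‖ₑ ^ 2) ^ (1 / 2 : ℝ)

/-- The duality bracket between the distribution on `𝕋³` with Fourier coefficients `c` and the
smooth function `φ`. -/
def torusPairing (c : (Fin 3 → ℤ) → ℂ) (φ : T3 → ℝ) : ℂ :=
  ∑' k : Fin 3 → ℤ, c k * UnitAddTorus.mFourierCoeff (fun x : T3 => (φ x : ℂ)) (-k)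

/-- `Φ ∈ C_c^∞((0, T) × 𝕋³)`. -/
def IsTestFunction (T : ℝ) (Φ : ℝ × T3 → ℝ) : Prop :=
  ContDiff ℝ ∞ (fun z : ℝ × (Fin 3 → ℝ) => Φ (z.1, fun i => (z.2 i : UnitAddCircle))) ∧
    HasCompactSupport Φ ∧ tsupport Φ ⊆ Ioo 0 T ×ˢ univ

/-- `∂_t b = w` in the sense of distributions on `(0, T) × 𝕋³`, where `w` is a time-dependent
distribution on `𝕋³` given by its Fourier coefficients. -/
def IsWeakTimeDeriv (T : ℝ) (b : ℝ × T3 → ℝ) (w : ℝ → (Fin 3 → ℤ) → ℂ) : Prop :=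
  ∀ Φ : ℝ × T3 → ℝ, IsTestFunction T Φ →
    ((∫ z, b z * deriv (fun τ : ℝ => Φ (τ, z.2)) z.1 ∂(stMeasure T) : ℝ) : ℂ) =
      -∫ t, torusPairing (w t) (fun x => Φ (t, x)) ∂(timeMeasure T)

/-- `(∂_t b_ε)_{ε > 0}` is bounded in `L^1([0, T]; H^{-m}(𝕋³))`. -/
def TimeDerivBounded (T : ℝ) (m : ℤ) (b : ℝ → ℝ × T3 → ℝ) : Prop :=
  ∃ C : ℝ≥0, ∀ ε : ℝ, 0 < ε → ∃ w : ℝ → (Fin 3 → ℤ) → ℂ,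
    (∀ k, AEStronglyMeasurable (fun t => w t k) (timeMeasure T)) ∧
      ∫⁻ t, sobolevNorm (-m) (w t) ∂(timeMeasure T) ≤ C ∧ IsWeakTimeDeriv T (b ε) w

end WeakProduct

end

/-! The gradient bound on `a` gives compactness in space and the bound on `∂_t b` gives compactness
in time; the proof combines them by regularizing in space only.

Raise `s` to some `s'` with `s ≤ s'`, `p ≤ s'` and `1 < s' < p⋆`. Let `K_N` be the approximate
identity `torusKernel N`. Replacing `a_ε` by its spatial convolution `K_N * a_ε` costs an error in
`L^q_t(L^{s'}_x)` that is at most a rate, tending to zero with `N`, times the norm of the gradient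
(`mixedNorm_sub_spaceConv_le`). Since `b_ε` is bounded in the dual space, this error is harmless
uniformly in `ε`. The same holds for `a`, and `∫ a b_ε θ → ∫ a b θ` is weak convergence of `b_ε`
against the fixed function `a θ`. So it remains to show, for fixed `N`, that `∫ (K_N * (a_ε - a))
b_ε θ → 0`.

With `v = a_ε - a` this integral is `∫ v(t,y) b_ε(t,x) F(t,y,x)` with `F` continuous. By
Stone–Weierstrass (`closure_span_separated`) and uniform bounds, `F` may be taken as `σ(t,y)
e_k(x)`, and the integral becomes `∫ γ(t) β(t) dt`: here `γ` is a moment of `v`, bounded in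
`L^r(0,T)` with `r > 1` and weakly null, and `β` is a Fourier mode of `b_ε`, bounded in
`W^{1,1}(0,T)`. Writing `β` as a constant plus a primitive moves the integration onto `γ`, whose
tails `∫_s^T γ` are equicontinuous and tend to zero pointwise, hence uniformly
(`tendsto_integral_mul_zero`). Only single modes of `∂_t b_ε` are used, so the order `m` plays no
role.

The approximation rate is explicit. `K_n` is a normalized product of `cos^{2n}(π x_j)`, and `K_{n+1}
- K_n` is the divergence of a field of size `O(1)` in `L^∞` and `O(n^{-3/2})` in `L¹`. Hence
`(K_{n+1} - K_n) * f` is a convolution with `∇f`, and Young's inequality bounds it from `L^p` to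
`L^{s'}` by `n^{-(3/2)(1 - 1/p + 1/s')}` up to a constant. This is summable exactly when `s' < p⋆`
(`eLpNorm_sub_conv_le`).

Boundedness of the weakly-⋆ convergent sequences comes from the uniform boundedness principle
(`exists_mixedNorm_bound`), applied on `ℓ¹` with almost norming functions. -/

noncomputable section

namespace WeakProduct

/-! ### Lebesgue norms of `[0, ∞]`-valued functions -/

section Generic

variable {α β : Type*} [MeasurableSpace α] [MeasurableSpace β] {τ : Measure α} {μ : Measure β}

/-- Monotonicity of the Lebesgue norm for `[0, ∞]`-valued functions. -/
lemma eLpNorm_mono_ennreal {p : ℝ≥0∞} {f g : α → ℝ≥0∞} (h : ∀ᵐ x ∂τ, f x ≤ g x) :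
    eLpNorm f p τ ≤ eLpNorm g p τ :=
  eLpNorm_mono_enorm_ae (by simpa using h)

/-- Hölder's inequality for `[0, ∞]`-valued functions and all conjugate exponents. -/
lemma lintegral_mul_le_eLpNorm_mul {p q : ℝ≥0∞} [hpq : p.HolderConjugate q] {f g : α → ℝ≥0∞}
    (hf : AEMeasurable f τ) (hg : AEMeasurable g τ) :
    ∫⁻ x, f x * g x ∂τ ≤ eLpNorm f p τ * eLpNorm g q τ := by
  -- The endpoint pair `(1, ∞)` is treated by hand and used on either side by symmetry; the
  -- remaining exponents lie strictly between `1` and `∞`.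
  have key : ∀ (q : ℝ≥0∞) [(1 : ℝ≥0∞).HolderConjugate q] (f g : α → ℝ≥0∞),
      AEMeasurable f τ → ∫⁻ x, f x * g x ∂τ ≤ eLpNorm f 1 τ * eLpNorm g q τ := by
    intro q hq f g hf
    have hq' : q = ⊤ := by
      have := hq.inv_add_inv_eq_one
      rw [inv_one] at this
      have h2 : (1 : ℝ≥0∞) + q⁻¹ = 1 + 0 := by rw [this, add_zero]
      rw [ENNReal.add_right_inj ENNReal.one_ne_top] at h2
      simpa using h2
    subst hq'
    rw [eLpNorm_one_eq_lintegral_enorm, eLpNorm_exponent_top, eLpNormEssSup]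
    simp only [enorm_eq_self]
    rw [← lintegral_mul_const'' _ hf]
    refine lintegral_mono_ae ?_
    filter_upwards [ENNReal.ae_le_essSup (μ := τ) g] with x hx
    gcongr
  rcases eq_or_ne p 1 with rfl | hp1
  · exact key q f g hf
  rcases eq_or_ne q 1 with rfl | hq1
  · have := hpq.symm
    simpa only [mul_comm] using key p g f hg
  have hp : 1 ≤ p := ENNReal.HolderConjugate.one_le p q
  have hq : 1 ≤ q := by
    have := hpq.symm
    exact ENNReal.HolderConjugate.one_le q p
  have hptop : p ≠ ⊤ := by
    rintro rfl
    have := hpq.inv_add_inv_eq_one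
    simp at this; exact hq1 this
  have hqtop : q ≠ ⊤ := by
    rintro rfl
    have := hpq.inv_add_inv_eq_one
    simp at this; exact hp1 this
  have h1 : 1 < p.toReal := by
    rw [← ENNReal.toReal_one, ENNReal.toReal_lt_toReal ENNReal.one_ne_top hptop]
    exact lt_of_le_of_ne hp hp1.symm
  have := ENNReal.lintegral_mul_le_Lp_mul_Lq τ (ENNReal.HolderConjugate.toReal (q := q) h1) hf hg
  rw [eLpNorm_eq_lintegral_rpow_enorm_toReal (by positivity) hptop,
    eLpNorm_eq_lintegral_rpow_enorm_toReal (by positivity) hqtop]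
  simpa using this

/-- Minkowski's inequality for countably many `[0, ∞]`-valued functions. -/
lemma eLpNorm_tsum_le_tsum {p : ℝ≥0∞} (hp : 1 ≤ p) {f : ℕ → α → ℝ≥0∞}
    (hf : ∀ j, AEMeasurable (f j) τ) :
    eLpNorm (fun x => ∑' j, f j x) p τ ≤ ∑' j, eLpNorm (f j) p τ := by
  have hfin : ∀ n : ℕ, eLpNorm (fun x => ∑ j ∈ Finset.range n, f j x) p τ
      ≤ ∑' j, eLpNorm (f j) p τ := by
    intro n
    have := eLpNorm_sum_le (p := p) (μ := τ) (f := f) (s := Finset.range n)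
      (fun i _ => (hf i).aestronglyMeasurable) hp
    refine le_trans (le_of_eq ?_) (this.trans (ENNReal.sum_le_tsum _))
    congr 1; ext x; simp
  rcases eq_or_ne p ⊤ with rfl | hptop
  · rw [eLpNorm_exponent_top, eLpNormEssSup]
    refine essSup_le_of_ae_le _ ?_
    have : ∀ᵐ x ∂τ, ∀ j, f j x ≤ eLpNorm (f j) ⊤ τ := by
      rw [ae_all_iff]
      intro j
      rw [eLpNorm_exponent_top, eLpNormEssSup]
      simpa using ENNReal.ae_le_essSup (μ := τ) (f j)
    filter_upwards [this] with x hx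
    rw [enorm_eq_self]
    exact ENNReal.tsum_le_tsum hx
  · have hp0 : p ≠ 0 := by positivity
    have hpr : 0 < p.toReal := ENNReal.toReal_pos hp0 hptop
    rw [eLpNorm_eq_lintegral_rpow_enorm_toReal hp0 hptop]
    simp only [enorm_eq_self]
    -- Monotone convergence transfers the bound from partial sums to the series.
    have hmono : ∀ x, Monotone fun n => (∑ j ∈ Finset.range n, f j x) ^ p.toReal := by
      intro x m n hmn
      refine ENNReal.rpow_le_rpow ?_ hpr.le
      exact Finset.sum_le_sum_of_subset (Finset.range_mono hmn)
    have h1 : ∀ x, (∑' j, f j x) ^ p.toReal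
        = ⨆ n, (∑ j ∈ Finset.range n, f j x) ^ p.toReal := by
      intro x
      refine tendsto_nhds_unique ?_ (tendsto_atTop_iSup (hmono x))
      exact (ENNReal.continuous_rpow_const.tendsto _).comp ENNReal.summable.hasSum.tendsto_sum_nat
    simp only [h1]
    rw [lintegral_iSup' (fun n => (Finset.aemeasurable_fun_sum _ fun j _ => hf j).pow_const _)
      (ae_of_all _ hmono), one_div, ENNReal.rpow_inv_le_iff hpr]
    refine iSup_le fun n => ?_
    have h2 := hfin n
    rw [eLpNorm_eq_lintegral_rpow_enorm_toReal hp0 hptop, one_div,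
      ENNReal.rpow_inv_le_iff hpr] at h2
    simpa using h2

/-- The Lebesgue norms of the sections of a measurable function are measurable. -/
lemma measurable_eLpNorm_section [SFinite μ] (p : ℝ≥0∞) {F : α × β → ℝ≥0∞} (hF : Measurable F) :
    Measurable fun t => eLpNorm (fun x => F (t, x)) p μ := by
  rcases eq_or_ne p 0 with rfl | hp0
  · simp
  rcases eq_or_ne p ⊤ with rfl | hptop
  · simp only [eLpNorm_exponent_top, eLpNormEssSup, enorm_eq_self]
    refine measurable_of_Iic fun c => ?_
    -- The essential supremum of a slice is at most `c` exactly when the slice of `{c < F}` is null,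
    -- and the measure of a slice depends measurably on `t`.
    have : (fun t => essSup (fun x => F (t, x)) μ) ⁻¹' Iic c
        = {t | μ (Prod.mk t ⁻¹' {z | c < F z}) = 0} := by
      ext t
      simp only [mem_preimage, mem_Iic, mem_ofPred_eq]
      constructor
      · intro h
        have h2 := ENNReal.ae_le_essSup (μ := μ) (fun x => F (t, x))
        rw [ae_iff] at h2
        refine measure_mono_null (fun x hx => ?_) h2
        simp only [mem_preimage, mem_ofPred_eq, not_le] at hx ⊢
        exact lt_of_le_of_lt h hx
      · intro h
        refine essSup_le_of_ae_le _ ?_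
        rw [EventuallyLE, ae_iff]
        simpa using h
    rw [this]
    exact measurable_measure_prodMk_left (measurableSet_lt measurable_const hF)
      (measurableSet_singleton 0)
  · simp only [eLpNorm_eq_lintegral_rpow_enorm_toReal hp0 hptop, enorm_eq_self]
    exact ((hF.pow_const _).lintegral_prod_right').pow_const _

/-- The iterated norm `‖ ‖F(t, x)‖_{L^p_x} ‖_{L^q_t}` of a `[0, ∞]`-valued function. -/
def iterNorm (τ : Measure α) (μ : Measure β) (q p : ℝ≥0∞) (F : α × β → ℝ≥0∞) : ℝ≥0∞ :=
  eLpNorm (fun t => eLpNorm (fun x => F (t, x)) p μ) q τ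

lemma iterNorm_mono [SFinite μ] {q p : ℝ≥0∞} {F G : α × β → ℝ≥0∞}
    (h : ∀ᵐ z ∂(τ.prod μ), F z ≤ G z) : iterNorm τ μ q p F ≤ iterNorm τ μ q p G := by
  refine eLpNorm_mono_ennreal ?_
  filter_upwards [Measure.ae_ae_of_ae_prod h] with t ht
  exact eLpNorm_mono_ennreal ht

lemma iterNorm_congr [SFinite μ] {q p : ℝ≥0∞} {F G : α × β → ℝ≥0∞}
    (h : ∀ᵐ z ∂(τ.prod μ), F z = G z) : iterNorm τ μ q p F = iterNorm τ μ q p G :=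
  le_antisymm (iterNorm_mono (h.mono fun _ hz => hz.le)) (iterNorm_mono (h.mono fun _ hz => hz.ge))

lemma aemeasurable_section [SFinite μ] {F : α × β → ℝ≥0∞} (hF : AEMeasurable F (τ.prod μ)) :
    ∀ᵐ t ∂τ, AEMeasurable (fun x => F (t, x)) μ := by
  filter_upwards [Measure.ae_ae_of_ae_prod hF.ae_eq_mk] with t ht
  exact ⟨_, hF.measurable_mk.comp measurable_prodMk_left, ht⟩

/-- The Lebesgue norms of the sections of an a.e. measurable function are a.e. measurable. -/
lemma aemeasurable_eLpNorm_section [SFinite μ] (p : ℝ≥0∞) {F : α × β → ℝ≥0∞}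
    (hF : AEMeasurable F (τ.prod μ)) : AEMeasurable (fun t => eLpNorm (fun x => F (t, x)) p μ) τ := by
  refine ⟨_, measurable_eLpNorm_section (μ := μ) p hF.measurable_mk, ?_⟩
  filter_upwards [Measure.ae_ae_of_ae_prod hF.ae_eq_mk] with t ht
  exact eLpNorm_congr_ae ht

/-- Hölder's inequality for iterated norms. -/
lemma lintegral_mul_le_iterNorm_mul [SFinite τ] [SFinite μ] {q q' p p' : ℝ≥0∞}
    [q.HolderConjugate q'] [p.HolderConjugate p'] {F G : α × β → ℝ≥0∞}
    (hF : AEMeasurable F (τ.prod μ)) (hG : AEMeasurable G (τ.prod μ)) :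
    ∫⁻ z, F z * G z ∂(τ.prod μ) ≤ iterNorm τ μ q p F * iterNorm τ μ q' p' G := by
  rw [lintegral_prod (fun z => F z * G z) (hF.mul hG)]
  refine le_trans ?_ (lintegral_mul_le_eLpNorm_mul (aemeasurable_eLpNorm_section p hF)
    (aemeasurable_eLpNorm_section p' hG))
  refine lintegral_mono_ae ?_
  filter_upwards [aemeasurable_section hF, aemeasurable_section hG] with t hFt hGt
  exact lintegral_mul_le_eLpNorm_mul hFt hGt

lemma iterNorm_tsum_le [SFinite μ] {q p : ℝ≥0∞} (hq : 1 ≤ q) (hp : 1 ≤ p)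
    {F : ℕ → α × β → ℝ≥0∞} (hF : ∀ j, AEMeasurable (F j) (τ.prod μ)) :
    iterNorm τ μ q p (fun z => ∑' j, F j z) ≤ ∑' j, iterNorm τ μ q p (F j) := by
  refine le_trans ?_ (eLpNorm_tsum_le_tsum hq fun j => aemeasurable_eLpNorm_section p (hF j))
  refine eLpNorm_mono_ennreal ?_
  have : ∀ᵐ t ∂τ, ∀ j, AEMeasurable (fun x => F j (t, x)) μ :=
    ae_all_iff.2 fun j => aemeasurable_section (hF j)
  filter_upwards [this] with t ht
  exact eLpNorm_tsum_le_tsum hp ht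

lemma iterNorm_add_le [SFinite μ] {q p : ℝ≥0∞} (hq : 1 ≤ q) (hp : 1 ≤ p)
    {F G : α × β → ℝ≥0∞} (hF : AEMeasurable F (τ.prod μ)) (hG : AEMeasurable G (τ.prod μ)) :
    iterNorm τ μ q p (fun z => F z + G z) ≤ iterNorm τ μ q p F + iterNorm τ μ q p G := by
  refine le_trans ?_ (eLpNorm_add_le (aemeasurable_eLpNorm_section p hF).aestronglyMeasurable
    (aemeasurable_eLpNorm_section p hG).aestronglyMeasurable hq)
  refine eLpNorm_mono_ennreal ?_
  filter_upwards [aemeasurable_section hF, aemeasurable_section hG] with t hFt hGt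
  exact eLpNorm_add_le hFt.aestronglyMeasurable hGt.aestronglyMeasurable hp

/-- The constant may be `∞`; this occurs when the normalizing factor of a dual function inverts a
vanishing norm. -/
lemma eLpNorm_mul_const_ennreal {p : ℝ≥0∞} {f : α → ℝ≥0∞} (hf : AEMeasurable f τ) (c : ℝ≥0∞) :
    eLpNorm (fun x => f x * c) p τ = eLpNorm f p τ * c := by
  rcases eq_or_ne p 0 with rfl | hp0
  · simp
  rcases eq_or_ne p ⊤ with rfl | hptop
  · simp only [eLpNorm_exponent_top, eLpNormEssSup, enorm_eq_self]
    simp only [mul_comm _ c]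
    exact ENNReal.essSup_const_mul
  · have hpr : 0 < p.toReal := ENNReal.toReal_pos hp0 hptop
    simp only [eLpNorm_eq_lintegral_rpow_enorm_toReal hp0 hptop, enorm_eq_self,
      ENNReal.mul_rpow_of_nonneg _ _ hpr.le]
    rw [lintegral_mul_const'' _ (hf.pow_const _), ENNReal.mul_rpow_of_nonneg _ _ (by positivity),
      ← ENNReal.rpow_mul, mul_one_div_cancel hpr.ne', ENNReal.rpow_one]

/-- The function `|f|^{p-1} / ‖f‖_p^{p-1}` has norm at most one in `L^{p'}`. -/
lemma eLpNorm_dual_le_one {p p' : ℝ≥0∞} [hpp : p.HolderConjugate p'] (hptop : p ≠ ⊤)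
    {f : α → ℝ≥0∞} (hf : AEMeasurable f τ) :
    eLpNorm (fun x => f x ^ (p.toReal - 1) * (eLpNorm f p τ ^ (p.toReal - 1))⁻¹) p' τ ≤ 1 := by
  have hp : 1 ≤ p := ENNReal.HolderConjugate.one_le p p'
  have hp0 : p ≠ 0 := by positivity
  have hpr : 0 < p.toReal := ENNReal.toReal_pos hp0 hptop
  rw [eLpNorm_mul_const_ennreal (hf.pow_const _), ← div_eq_mul_inv]
  refine ENNReal.div_le_of_le_mul ?_
  rw [one_mul]
  rcases eq_or_ne p 1 with rfl | hp1
  · simp only [ENNReal.toReal_one, sub_self, ENNReal.rpow_zero]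
    have hq' : p' = ⊤ := by
      have := hpp.inv_add_inv_eq_one
      rw [inv_one] at this
      have h2 : (1 : ℝ≥0∞) + p'⁻¹ = 1 + 0 := by rw [this, add_zero]
      rw [ENNReal.add_right_inj ENNReal.one_ne_top] at h2
      simpa using h2
    subst hq'
    rw [eLpNorm_exponent_top, eLpNormEssSup]
    exact essSup_le_of_ae_le _ (ae_of_all _ fun x => by simp)
  have h1 : 1 < p.toReal := by
    rw [← ENNReal.toReal_one, ENNReal.toReal_lt_toReal ENNReal.one_ne_top hptop]
    exact lt_of_le_of_ne hp hp1.symm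
  have hr := ENNReal.HolderConjugate.toReal (q := p') h1
  have hp'top : p' ≠ ⊤ := by
    rintro rfl
    have := hpp.inv_add_inv_eq_one
    simp at this; exact hp1 this
  have hp'0 : p' ≠ 0 := by
    have := hpp.symm
    have : 1 ≤ p' := ENNReal.HolderConjugate.one_le p' p
    positivity
  rw [eLpNorm_eq_lintegral_rpow_enorm_toReal hp0 hptop,
    eLpNorm_eq_lintegral_rpow_enorm_toReal hp'0 hp'top]
  simp only [enorm_eq_self, ← ENNReal.rpow_mul]
  -- Since `(p - 1) p' = p`, the `L^{p'}` norm of `f^{p-1}` is `‖f‖_p^{p/p'}`, and `p / p' = p - 1`.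
  rw [hr.sub_one_mul_conj]
  have : 1 / p'.toReal = 1 / p.toReal * (p.toReal - 1) := by
    have h3 := hr.inv_add_inv_eq_one
    have h4 : 1 / p.toReal * (p.toReal - 1) = 1 - p.toReal⁻¹ := by field_simp
    rw [h4, one_div]; linarith
  rw [this]

/-- The integrand is `f^p / ‖f‖_p^{p-1}`, so for finite `p` the dual function attains the norm
without loss. If the norm vanishes, then `f = 0` almost everywhere and the infinite factor is
multiplied by zero. -/
lemma lintegral_mul_dual {p : ℝ≥0∞} (hp : 1 ≤ p) (hptop : p ≠ ⊤)
    {f : α → ℝ≥0∞} (hf : AEMeasurable f τ) (hfin : eLpNorm f p τ ≠ ⊤) :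
    ∫⁻ x, f x * (f x ^ (p.toReal - 1) * (eLpNorm f p τ ^ (p.toReal - 1))⁻¹) ∂τ
      = eLpNorm f p τ := by
  have hp0 : p ≠ 0 := by positivity
  have hpr : 0 < p.toReal := ENNReal.toReal_pos hp0 hptop
  have hpr1 : 1 ≤ p.toReal := by
    rw [← ENNReal.toReal_one]; exact ENNReal.toReal_mono hptop hp
  rcases eq_or_ne (eLpNorm f p τ) 0 with h0 | h0
  · rw [h0, lintegral_eq_zero_iff' (by fun_prop)]
    rw [eLpNorm_eq_zero_iff hf.aestronglyMeasurable hp0] at h0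
    filter_upwards [h0] with x hx
    simp [hx]
  have e1 : ∀ x, f x * (f x ^ (p.toReal - 1) * (eLpNorm f p τ ^ (p.toReal - 1))⁻¹)
      = f x ^ p.toReal * (eLpNorm f p τ ^ (p.toReal - 1))⁻¹ := by
    intro x
    rw [← mul_assoc]
    congr 1
    nth_rw 1 [← ENNReal.rpow_one (f x)]
    rw [← ENNReal.rpow_add_of_nonneg _ _ zero_le_one (by linarith)]
    congr 1; ring
  simp only [e1]
  rw [lintegral_mul_const'' _ (hf.pow_const _)]
  have e2 : ∫⁻ x, f x ^ p.toReal ∂τ = eLpNorm f p τ ^ p.toReal := by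
    rw [eLpNorm_eq_lintegral_rpow_enorm_toReal hp0 hptop, ← ENNReal.rpow_mul]
    simp [hpr.ne']
  rw [e2, ← ENNReal.rpow_neg, ← ENNReal.rpow_add _ _ h0 hfin]
  simp

lemma lintegral_ne_top_of_eLpNorm [IsFiniteMeasure τ] {q : ℝ≥0∞} (hq : 1 ≤ q)
    {f : α → ℝ≥0∞} (hf : AEMeasurable f τ) (hfin : eLpNorm f q τ ≠ ⊤) : ∫⁻ x, f x ∂τ ≠ ⊤ := by
  have h : MemLp f q τ := ⟨hf.aestronglyMeasurable, hfin.lt_top⟩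
  have h1 := (h.mono_exponent hq).2
  rw [eLpNorm_one_eq_lintegral_enorm] at h1
  simpa using h1.ne

/-- For a finite measure, Lebesgue norms are almost attained by duality. -/
lemma exists_almost_norming [IsFiniteMeasure τ] {q q' : ℝ≥0∞} [hqq : q.HolderConjugate q']
    {f : α → ℝ≥0∞} (hf : Measurable f) (hfin : eLpNorm f q τ ≠ ⊤) :
    ∃ h : α → ℝ≥0∞, Measurable h ∧ eLpNorm h q' τ ≤ 1 ∧
      eLpNorm f q τ ≤ 2 * ∫⁻ x, f x * h x ∂τ := by
  have hq : 1 ≤ q := ENNReal.HolderConjugate.one_le q q'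
  rcases eq_or_ne q ⊤ with rfl | hqtop
  -- For `q = ∞` the norm need not be attained. The normalized indicator of `{f > N/2}`, a set of
  -- positive measure, recovers half of it; this is the origin of the factor `2`.
  · have hq' : q' = 1 := by
      have := hqq.inv_add_inv_eq_one
      simpa using this
    subst hq'
    set N := eLpNorm f ⊤ τ with hN
    rcases eq_or_ne N 0 with h0 | h0
    · exact ⟨0, measurable_const, by simp, by simp [h0]⟩
    have hA : MeasurableSet {x | N / 2 < f x} := measurableSet_lt measurable_const hf
    have hlt : N / 2 < N := ENNReal.half_lt_self h0 hfin
    have hApos : τ {x | N / 2 < f x} ≠ 0 := by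
      intro h
      refine hlt.not_ge ?_
      rw [hN, eLpNorm_exponent_top, eLpNormEssSup] at *
      refine essSup_le_of_ae_le _ ?_
      rw [EventuallyLE, ae_iff]
      simpa using h
    refine ⟨{x | N / 2 < f x}.indicator fun _ => (τ {x | N / 2 < f x})⁻¹,
      measurable_const.indicator hA, ?_, ?_⟩
    · rw [eLpNorm_one_eq_lintegral_enorm]
      simp only [enorm_eq_self]
      rw [lintegral_indicator_const hA, ENNReal.inv_mul_cancel hApos (measure_ne_top _ _)]
    · have h1 : ∫⁻ x, {x | N / 2 < f x}.indicator (fun _ => N / 2 * (τ {x | N / 2 < f x})⁻¹) x ∂τ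
          ≤ ∫⁻ x, f x * {x | N / 2 < f x}.indicator (fun _ => (τ {x | N / 2 < f x})⁻¹) x ∂τ := by
        refine lintegral_mono fun x => ?_
        by_cases hx : x ∈ {x | N / 2 < f x}
        · simp only [indicator_of_mem hx]
          gcongr
          exact (show N / 2 < f x from hx).le
        · simp [indicator_of_notMem hx]
      rw [lintegral_indicator_const hA, mul_assoc,
        ENNReal.inv_mul_cancel hApos (measure_ne_top _ _), mul_one] at h1
      calc N = 2 * (N / 2) := (ENNReal.mul_div_cancel two_ne_zero ENNReal.ofNat_ne_top).symm
        _ ≤ _ := by gcongr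
  · refine ⟨fun x => f x ^ (q.toReal - 1) * (eLpNorm f q τ ^ (q.toReal - 1))⁻¹, by fun_prop,
      eLpNorm_dual_le_one hqtop hf.aemeasurable, ?_⟩
    rw [lintegral_mul_dual hq hqtop hf.aemeasurable hfin, two_mul]
    exact le_self_add

/-- For finite measures and a finite inner exponent, iterated norms are almost attained by
duality. -/
lemma exists_almost_norming_iterNorm [IsFiniteMeasure τ] [IsFiniteMeasure μ] {q q' p p' : ℝ≥0∞}
    [q.HolderConjugate q'] [hpp : p.HolderConjugate p'] (hptop : p ≠ ⊤)
    {F : α × β → ℝ≥0∞} (hF : Measurable F) (hfin : iterNorm τ μ q p F ≠ ⊤) :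
    ∃ K : α × β → ℝ≥0∞, Measurable K ∧ iterNorm τ μ q' p' K ≤ 1 ∧
      iterNorm τ μ q p F ≤ 2 * ∫⁻ z, F z * K z ∂(τ.prod μ) := by
  have hp : 1 ≤ p := ENNReal.HolderConjugate.one_le p p'
  have hn := measurable_eLpNorm_section (μ := μ) p hF
  obtain ⟨h, hh, hh1, hh2⟩ := exists_almost_norming (q' := q') hn hfin
  have hFt : ∀ t, Measurable fun x => F (t, x) := fun t => hF.comp measurable_prodMk_left
  -- The dual function of each slice, times an almost norming function `h` of the slice norms. The
  -- inner factor is exact because `p` is finite, so the loss is only that of `h`.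
  refine ⟨fun z => F z ^ (p.toReal - 1) *
    (eLpNorm (fun x => F (z.1, x)) p μ ^ (p.toReal - 1))⁻¹ * h z.1, ?_, ?_, ?_⟩
  · exact ((hF.pow_const _).mul ((hn.comp measurable_fst).pow_const _).inv).mul
      (hh.comp measurable_fst)
  · refine le_trans (eLpNorm_mono_ennreal (ae_of_all _ fun t => ?_)) hh1
    dsimp only
    have hFt' := hFt t
    rw [eLpNorm_mul_const_ennreal (by fun_prop)]
    calc _ ≤ 1 * h t := by gcongr; exact eLpNorm_dual_le_one hptop (hFt t).aemeasurable
      _ = h t := one_mul _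
  · refine hh2.trans ?_
    gcongr
    have hm : Measurable fun z : α × β => F z * (F z ^ (p.toReal - 1) *
        (eLpNorm (fun x => F (z.1, x)) p μ ^ (p.toReal - 1))⁻¹ * h z.1) :=
      hF.mul (((hF.pow_const _).mul ((hn.comp measurable_fst).pow_const _).inv).mul
        (hh.comp measurable_fst))
    rw [lintegral_prod _ hm.aemeasurable]
    -- Exact norming of a slice needs its norm to be finite, which holds for almost every time
    -- because the slice norms are integrable.
    have hfint : ∀ᵐ t ∂τ, eLpNorm (fun x => F (t, x)) p μ ≠ ⊤ := by
      have hq : 1 ≤ q := ENNReal.HolderConjugate.one_le q q'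
      exact (ae_lt_top hn (lintegral_ne_top_of_eLpNorm hq hn.aemeasurable hfin)).mono
        fun t ht => ht.ne
    refine lintegral_mono_ae ?_
    filter_upwards [hfint] with t ht
    have hFt' := hFt t
    have e : ∀ x, F (t, x) * (F (t, x) ^ (p.toReal - 1) *
        (eLpNorm (fun x => F (t, x)) p μ ^ (p.toReal - 1))⁻¹ * h t) = F (t, x) *
        (F (t, x) ^ (p.toReal - 1) * (eLpNorm (fun x => F (t, x)) p μ ^ (p.toReal - 1))⁻¹) * h t :=
      fun x => (mul_assoc _ _ _).symm
    simp only [e]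
    rw [lintegral_mul_const _ (by fun_prop), lintegral_mul_dual hp hptop (hFt t).aemeasurable ht]

end Generic

end WeakProduct

end

noncomputable section

namespace WeakProduct

/-! ### Mixed norms: basic properties -/

instance : IsProbabilityMeasure torusMeasure := by
  unfold torusMeasure; infer_instance

instance (T : ℝ) : IsFiniteMeasure (timeMeasure T) := by
  unfold timeMeasure; infer_instance

lemma mixedNorm_eq_iterNorm (T : ℝ) (q p : ℝ≥0∞) (f : ℝ × T3 → ℝ) :
    mixedNorm T q p f = iterNorm (timeMeasure T) torusMeasure q p fun z => ‖f z‖ₑ := by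
  simp only [mixedNorm, iterNorm]
  simp only [eLpNorm_enorm]

variable {T : ℝ} {q p q' p' : ℝ≥0∞}

lemma mixedNorm_mono {f g : ℝ × T3 → ℝ} (h : ∀ᵐ z ∂stMeasure T, ‖f z‖ₑ ≤ ‖g z‖ₑ) :
    mixedNorm T q p f ≤ mixedNorm T q p g := by
  simp only [mixedNorm_eq_iterNorm]
  exact iterNorm_mono h

lemma lintegral_enorm_mul_le [q.HolderConjugate q'] [p.HolderConjugate p'] {f g : ℝ × T3 → ℝ}
    (hf : AEStronglyMeasurable f (stMeasure T)) (hg : AEStronglyMeasurable g (stMeasure T)) :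
    ∫⁻ z, ‖f z * g z‖ₑ ∂stMeasure T ≤ mixedNorm T q p f * mixedNorm T q' p' g := by
  simp only [mixedNorm_eq_iterNorm, enorm_mul]
  exact lintegral_mul_le_iterNorm_mul hf.enorm hg.enorm

lemma MemMixed.integrable_mul [q.HolderConjugate q'] [p.HolderConjugate p'] {f g : ℝ × T3 → ℝ}
    (hf : MemMixed T q p f) (hg : MemMixed T q' p' g) :
    Integrable (fun z => f z * g z) (stMeasure T) :=
  ⟨hf.1.mul hg.1, (lintegral_enorm_mul_le hf.1 hg.1).trans_lt (ENNReal.mul_lt_top hf.2 hg.2)⟩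

lemma mixedNorm_sub_le (hq : 1 ≤ q) (hp : 1 ≤ p) {f g : ℝ × T3 → ℝ}
    (hf : AEStronglyMeasurable f (stMeasure T)) (hg : AEStronglyMeasurable g (stMeasure T)) :
    mixedNorm T q p (fun z => f z - g z) ≤ mixedNorm T q p f + mixedNorm T q p g := by
  simp only [mixedNorm_eq_iterNorm]
  exact (iterNorm_mono (ae_of_all _ fun z => enorm_sub_le)).trans
    (iterNorm_add_le hq hp hf.enorm hg.enorm)

lemma MemMixed.sub (hq : 1 ≤ q) (hp : 1 ≤ p) {f g : ℝ × T3 → ℝ}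
    (hf : MemMixed T q p f) (hg : MemMixed T q p g) : MemMixed T q p (fun z => f z - g z) :=
  ⟨hf.1.sub hg.1, (mixedNorm_sub_le hq hp hf.1 hg.1).trans_lt (ENNReal.add_lt_top.2 ⟨hf.2, hg.2⟩)⟩

/-- Bounded measurable functions belong to all mixed spaces. -/
lemma memMixed_of_bounded {f : ℝ × T3 → ℝ} (hf : AEStronglyMeasurable f (stMeasure T)) (M : ℝ)
    (hM : ∀ᵐ z ∂stMeasure T, ‖f z‖ ≤ M) : MemMixed T q p f := by
  refine ⟨hf, ?_⟩
  have h1 : mixedNorm T q p f ≤ mixedNorm T q p fun _ => M := by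
    refine mixedNorm_mono ?_
    filter_upwards [hM] with z hz
    exact enorm_le_iff_norm_le.2 (hz.trans (le_abs_self M))
  refine h1.trans_lt ?_
  have h2 : eLpNorm (fun _ : T3 => M) p torusMeasure < ⊤ := (memLp_const M).2
  have h3 : mixedNorm T q p (fun _ => M)
      ≤ eLpNorm (fun _ : ℝ => (eLpNorm (fun _ : T3 => M) p torusMeasure).toReal) q
        (timeMeasure T) := by
    refine eLpNorm_mono_enorm_ae (ae_of_all _ fun t => ?_)
    rw [enorm_eq_self, Real.enorm_eq_ofReal ENNReal.toReal_nonneg, ENNReal.ofReal_toReal h2.ne]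
  exact h3.trans_lt (memLp_const _).2

lemma mixedNorm_mono_exponent {s : ℝ≥0∞} (hps : p ≤ s) {f : ℝ × T3 → ℝ}
    (hf : AEStronglyMeasurable f (stMeasure T)) : mixedNorm T q p f ≤ mixedNorm T q s f := by
  refine eLpNorm_mono_ennreal ?_
  filter_upwards [hf.prodMk_left] with t ht
  exact eLpNorm_le_eLpNorm_of_exponent_le hps ht

lemma MemMixed.mono_exponent {s : ℝ≥0∞} (hps : p ≤ s) {f : ℝ × T3 → ℝ}
    (hf : MemMixed T q s f) : MemMixed T q p f :=
  ⟨hf.1, (mixedNorm_mono_exponent hps hf.1).trans_lt hf.2⟩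

lemma MemMixed.ae_memLp (hq : 1 ≤ q) {f : ℝ × T3 → ℝ} (hf : MemMixed T q p f) :
    ∀ᵐ t ∂timeMeasure T, MemLp (fun x => f (t, x)) p torusMeasure := by
  have hm : AEMeasurable (fun t => eLpNorm (fun x => f (t, x)) p torusMeasure)
      (timeMeasure T) := by
    have := aemeasurable_eLpNorm_section (τ := timeMeasure T) (μ := torusMeasure) p hf.1.enorm
    simpa only [eLpNorm_enorm] using this
  filter_upwards [hf.1.prodMk_left,
    ae_lt_top' hm (lintegral_ne_top_of_eLpNorm hq hm hf.2.ne)] with t h1 h2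
  exact ⟨h1, h2⟩

/-! ### Pointwise bounded sequences of functionals are bounded in norm -/

/-- Multiplying an almost norming `[0, ∞]`-valued function by the sign of `u` makes the pairing
nonnegative, so the real integral is the Lebesgue integral of the product of absolute values. -/
lemma exists_norming_function [q.HolderConjugate q'] [p.HolderConjugate p'] (hptop : p ≠ ⊤)
    {u : ℝ × T3 → ℝ} (hu : MemMixed T q p u) :
    ∃ ψ : ℝ × T3 → ℝ, AEStronglyMeasurable ψ (stMeasure T) ∧ mixedNorm T q' p' ψ ≤ 1 ∧
      mixedNorm T q p u ≤ 2 * ENNReal.ofReal (∫ z, u z * ψ z ∂stMeasure T) := by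
  set v := hu.1.mk u with hv
  have hvm : Measurable v := hu.1.stronglyMeasurable_mk.measurable
  have huv : u =ᵐ[stMeasure T] v := hu.1.ae_eq_mk
  have hN : mixedNorm T q p u = iterNorm (timeMeasure T) torusMeasure q p fun z => ‖v z‖ₑ := by
    rw [mixedNorm_eq_iterNorm]
    exact iterNorm_congr (huv.mono fun z hz => by simp only [hz])
  obtain ⟨K, hK, hK1, hK2⟩ := exists_almost_norming_iterNorm (τ := timeMeasure T)
    (μ := torusMeasure) (q := q) (q' := q') (p := p) (p' := p') hptop hvm.enorm
    (by rw [← hN]; exact hu.2.ne)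
  -- Hölder against the constant `1` shows that `K` is integrable, so passing to real values changes
  -- it only on a null set.
  have hKfin : ∀ᵐ z ∂stMeasure T, K z < ⊤ := by
    have h1 : ∫⁻ z, 1 * K z ∂stMeasure T ≤
        iterNorm (timeMeasure T) torusMeasure q p (fun _ => 1) *
        iterNorm (timeMeasure T) torusMeasure q' p' K :=
      lintegral_mul_le_iterNorm_mul aemeasurable_const hK.aemeasurable
    have h2 : MemMixed T q p fun _ => 1 :=
      memMixed_of_bounded aestronglyMeasurable_const 1 (ae_of_all _ fun _ => by simp)
    have h3 := h2.2
    rw [mixedNorm_eq_iterNorm] at h3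
    simp only [enorm_one] at h3
    simp only [one_mul] at h1
    exact ae_lt_top hK (h1.trans_lt (ENNReal.mul_lt_top h3 (hK1.trans_lt ENNReal.one_lt_top))).ne
  have hψm : Measurable fun z => (SignType.sign (v z) : ℝ) * (K z).toReal := by
    have : Measurable fun x : ℝ => (SignType.sign x : ℝ) := by
      have h : (fun x : ℝ => (SignType.sign x : ℝ)) =
          fun x => if 0 < x then 1 else if x < 0 then -1 else 0 := by
        ext x
        rw [sign_apply]
        split_ifs <;> simp
      rw [h]
      exact Measurable.ite measurableSet_Ioi measurable_const
        (Measurable.ite measurableSet_Iio measurable_const measurable_const)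
    exact (this.comp hvm).mul hK.ennreal_toReal
  have hψle : ∀ z, ‖(SignType.sign (v z) : ℝ) * (K z).toReal‖ₑ ≤ K z := by
    intro z
    rw [enorm_mul]
    calc _ ≤ 1 * K z := by
          gcongr
          · rw [← ofReal_norm, ← ENNReal.ofReal_one]
            refine ENNReal.ofReal_le_ofReal ?_
            rcases lt_trichotomy (v z) 0 with h | h | h <;> simp [h]
          · rw [Real.enorm_eq_ofReal ENNReal.toReal_nonneg]; exact ENNReal.ofReal_toReal_le
      _ = K z := one_mul _
  have hψ1 : mixedNorm T q' p' (fun z => (SignType.sign (v z) : ℝ) * (K z).toReal) ≤ 1 := by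
    rw [mixedNorm_eq_iterNorm]
    exact (iterNorm_mono (ae_of_all _ hψle)).trans hK1
  have hψmem : MemMixed T q' p' (fun z => (SignType.sign (v z) : ℝ) * (K z).toReal) :=
    ⟨hψm.aestronglyMeasurable, hψ1.trans_lt ENNReal.one_lt_top⟩
  refine ⟨_, hψm.aestronglyMeasurable, hψ1, ?_⟩
  rw [hN]
  refine hK2.trans (le_of_eq ?_)
  congr 1
  have hpos : ∀ z, v z * ((SignType.sign (v z) : ℝ) * (K z).toReal) = |v z| * (K z).toReal := by
    intro z
    rw [← mul_assoc, self_mul_sign]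
  rw [ofReal_integral_eq_lintegral_ofReal (hu.integrable_mul hψmem)]
  · refine lintegral_congr_ae ?_
    filter_upwards [huv, hKfin] with z hz hKz
    rw [hz, hpos, ENNReal.ofReal_mul (abs_nonneg _), ENNReal.ofReal_toReal hKz.ne,
      Real.enorm_eq_ofReal_abs]
  · filter_upwards [huv] with z hz
    rw [hz, hpos]
    simp only [Pi.zero_apply]
    positivity

/-- A series of functions in a mixed space with summable coefficients. -/
lemma memMixed_tsum (hq : 1 ≤ q) (hp : 1 ≤ p) {ψ : ℕ → ℝ × T3 → ℝ}
    (hψ : ∀ j, AEStronglyMeasurable (ψ j) (stMeasure T)) (hψ1 : ∀ j, mixedNorm T q p (ψ j) ≤ 1)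
    {c : ℕ → ℝ} (hc : Summable fun j => ‖c j‖) : MemMixed T q p fun z => ∑' j, c j * ψ j z := by
  have := ENNReal.HolderConjugate.conjExponent hq
  have := ENNReal.HolderConjugate.conjExponent hp
  have hsum : iterNorm (timeMeasure T) torusMeasure q p (fun z => ∑' j, ‖c j * ψ j z‖ₑ) < ⊤ := by
    refine (iterNorm_tsum_le hq hp fun j => ((hψ j).const_mul _).enorm).trans_lt ?_
    have h1 : ∀ j, iterNorm (timeMeasure T) torusMeasure q p (fun z => ‖c j * ψ j z‖ₑ) ≤ ‖c j‖ₑ := by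
      intro j
      refine le_trans (eLpNorm_mono_ennreal (g := fun t =>
        eLpNorm (fun x => ‖ψ j (t, x)‖ₑ) p torusMeasure * ‖c j‖ₑ) (ae_of_all _ fun t => ?_)) ?_
      · simp only [eLpNorm_enorm]
        rw [mul_comm]
        exact eLpNorm_const_smul_le (f := fun x => ψ j (t, x)) (c := c j)
      · rw [eLpNorm_mul_const_ennreal (aemeasurable_eLpNorm_section p (hψ j).enorm)]
        calc _ ≤ 1 * ‖c j‖ₑ := by
              gcongr
              have := hψ1 j
              rwa [mixedNorm_eq_iterNorm] at this
          _ = _ := one_mul _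
    refine (ENNReal.tsum_le_tsum h1).trans_lt ?_
    have := hc.tsum_ofReal_lt_top
    simpa only [ofReal_norm] using this
  have hfin : ∀ᵐ z ∂stMeasure T, ∑' j, ‖c j * ψ j z‖ₑ < ⊤ := by
    have hm : AEMeasurable (fun z => ∑' j, ‖c j * ψ j z‖ₑ) (stMeasure T) :=
      AEMeasurable.tsum fun j => ((hψ j).const_mul _).enorm
    refine ae_lt_top' hm ?_
    have h2 : MemMixed T q.conjExponent p.conjExponent fun _ => 1 :=
      memMixed_of_bounded aestronglyMeasurable_const 1 (ae_of_all _ fun _ => by simp)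
    have h3 := h2.2
    rw [mixedNorm_eq_iterNorm] at h3
    have h1 := lintegral_mul_le_iterNorm_mul (τ := timeMeasure T) (μ := torusMeasure)
      (q := q) (p := p) (q' := q.conjExponent) (p' := p.conjExponent) hm
      (G := fun _ => ‖(1 : ℝ)‖ₑ) aemeasurable_const
    simp only [enorm_one, mul_one] at h1 h3
    exact (h1.trans_lt (ENNReal.mul_lt_top hsum h3)).ne
  refine ⟨?_, ?_⟩
  · refine aestronglyMeasurable_of_tendsto_ae atTop
      (f := fun n z => ∑ j ∈ Finset.range n, c j * ψ j z) (fun n => ?_) ?_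
    · exact Finset.aestronglyMeasurable_fun_sum _ fun j _ => (hψ j).const_mul _
    · filter_upwards [hfin] with z hz
      have : Summable fun j => c j * ψ j z := by
        refine Summable.of_norm ?_
        have := ENNReal.summable_toReal hz.ne
        simpa only [toReal_enorm] using this
      exact this.hasSum.tendsto_sum_nat
  · rw [mixedNorm_eq_iterNorm]
    exact (iterNorm_mono (ae_of_all _ fun z => enorm_tsum_le_tsum_enorm)).trans_lt hsum

/-- Uniform boundedness principle in mixed Lebesgue spaces. -/
theorem exists_mixedNorm_bound (hq : 1 ≤ q) (hp : 1 ≤ p) (hptop : p ≠ ⊤) {u : ℕ → ℝ × T3 → ℝ}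
    (hu : ∀ n, MemMixed T q p (u n))
    (hb : ∀ ψ, MemMixed T q.conjExponent p.conjExponent ψ →
      ∃ C, ∀ n, ‖∫ z, u n z * ψ z ∂stMeasure T‖ ≤ C) :
    ∃ C : ℝ≥0, ∀ n, mixedNorm T q p (u n) ≤ C := by
  have hqq := ENNReal.HolderConjugate.conjExponent hq
  have hpp := ENNReal.HolderConjugate.conjExponent hp
  have hq' : 1 ≤ q.conjExponent := by
    have := hqq.symm
    exact ENNReal.HolderConjugate.one_le _ q
  have hp' : 1 ≤ p.conjExponent := by
    have := hpp.symm
    exact ENNReal.HolderConjugate.one_le _ p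
  choose ψ hψ hψ1 hψ2 using fun n => exists_norming_function (q' := q.conjExponent)
    (p' := p.conjExponent) hptop (hu n)
  have hψmem : ∀ j, MemMixed T q.conjExponent p.conjExponent (ψ j) :=
    fun j => ⟨hψ j, (hψ1 j).trans_lt ENNReal.one_lt_top⟩
  set A : ℕ → ℕ → ℝ := fun n j => ∫ z, u n z * ψ j z ∂stMeasure T with hA
  set B : ℕ → ℝ := fun n => (mixedNorm T q p (u n)).toReal with hB
  have hL1 : ∀ n j, ∫ z, ‖u n z * ψ j z‖ ∂stMeasure T ≤ B n := by
    intro n j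
    rw [integral_norm_eq_lintegral_enorm (f := fun z => u n z * ψ j z) ((hu n).1.mul (hψ j))]
    refine ENNReal.toReal_mono (hu n).2.ne ((lintegral_enorm_mul_le (q := q) (p := p)
      (q' := q.conjExponent) (p' := p.conjExponent) (hu n).1 (hψ j)).trans ?_)
    calc _ ≤ mixedNorm T q p (u n) * 1 := by gcongr; exact hψ1 j
      _ = _ := mul_one _
  have hAB : ∀ n j, ‖A n j‖ ≤ B n := fun n j => (norm_integral_le_integral_norm _).trans (hL1 n j)
  have hsummable : ∀ c : lp (fun _ : ℕ => ℝ) 1, Summable fun j => ‖c j‖ := by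
    intro c
    have := (lp.memℓp c).summable (by simp)
    simpa using this
  have hs2 : ∀ n (c : lp (fun _ : ℕ => ℝ) 1), Summable fun j => c j * A n j := by
    intro n c
    refine Summable.of_norm_bounded ((hsummable c).mul_right (B n)) fun j => ?_
    rw [norm_mul]
    gcongr
    exact hAB n j
  have hnorm : ∀ c : lp (fun _ : ℕ => ℝ) 1, ‖c‖ = ∑' j, ‖c j‖ := by
    intro c
    rw [lp.norm_eq_tsum_rpow (by simp)]
    simp
  -- The principle is transported to `ℓ¹`: `g n c` is the pairing of `u n` with `∑ c_j ψ_j`, a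
  -- function of the dual class by `memMixed_tsum`. Pointwise boundedness on `ℓ¹` is then the
  -- hypothesis, and the mixed space itself needs no Banach space structure.
  let g : ℕ → lp (fun _ : ℕ => ℝ) 1 →L[ℝ] ℝ := fun n =>
    LinearMap.mkContinuous
      { toFun := fun c => ∑' j, c j * A n j
        map_add' := fun c d => by
          rw [← (hs2 n c).tsum_add (hs2 n d)]
          congr 1; ext j; simp [add_mul]
        map_smul' := fun r c => by
          simp only [RingHom.id_apply, smul_eq_mul]
          rw [← tsum_mul_left]
          congr 1; ext j; simp [mul_assoc] } (B n) (fun c => by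
        rw [hnorm, ← tsum_mul_left]
        refine tsum_of_norm_bounded ((hsummable c).mul_left (B n)).hasSum fun j => ?_
        rw [norm_mul, mul_comm]
        gcongr
        exact hAB n j)
  have hg : ∀ n c, g n c = ∑' j, c j * A n j := fun n c => rfl
  have hgint : ∀ n (c : lp (fun _ : ℕ => ℝ) 1),
      g n c = ∫ z, u n z * ∑' j, c j * ψ j z ∂stMeasure T := by
    intro n c
    have h1 := hasSum_integral_of_summable_integral_norm (μ := stMeasure T)
      (F := fun j z => c j * (u n z * ψ j z))
      (fun j => ((hu n).integrable_mul (hψmem j)).const_mul _) (by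
        refine Summable.of_nonneg_of_le (fun j => integral_nonneg fun z => norm_nonneg _)
          (fun j => ?_) ((hsummable c).mul_right (B n))
        simp only [norm_mul (c j)]
        rw [integral_const_mul]
        gcongr
        exact hL1 n j)
    simp only [integral_const_mul] at h1
    rw [hg, h1.tsum_eq]
    congr 1; ext z
    rw [← tsum_mul_left]
    congr 1; ext j; ring
  obtain ⟨C, hC⟩ := banach_steinhaus (g := g) (fun c => by
    obtain ⟨C, hC⟩ := hb _ (memMixed_tsum hq' hp' hψ hψ1 (hsummable c))
    exact ⟨C, fun n => by rw [hgint]; exact hC n⟩)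
  refine ⟨2 * C.toNNReal, fun n => (hψ2 n).trans ?_⟩
  -- The `n`-th unit vector returns the pairing of `u n` with its own norming function.
  have h1 : g n (lp.single 1 n 1) = A n n := by
    rw [hg, tsum_eq_single n]
    · simp
    · intro j hj
      simp [hj]
  have h2 : A n n ≤ C := by
    rw [← h1]
    calc _ ≤ ‖g n (lp.single 1 n 1)‖ := le_abs_self _
      _ ≤ ‖g n‖ * ‖lp.single (E := fun _ : ℕ => ℝ) 1 n (1 : ℝ)‖ := (g n).le_opNorm _
      _ = ‖g n‖ := by rw [lp.norm_single (by simp)]; simp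
      _ ≤ C := hC n
  push_cast
  gcongr
  exact ENNReal.ofReal_le_ofReal h2

end WeakProduct

end

noncomputable section

namespace WeakProduct

/-! ### Trigonometric kernels on the circle -/

/-- The function `cos² (π x)` on `ℝ/ℤ`. -/
def cosSq (x : UnitAddCircle) : ℝ := (1 + (fourier 1 x).re) / 2

/-- The function `sin (π x) cos (π x)` on `ℝ/ℤ`. -/
def sinCos (x : UnitAddCircle) : ℝ := (fourier 1 x).im / 2

lemma cosSq_coe (y : ℝ) : cosSq (y : UnitAddCircle) = (1 + Real.cos (2 * Real.pi * y)) / 2 := by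
  have : (2 * Real.pi * Complex.I * y : ℂ) = ((2 * Real.pi * y : ℝ) : ℂ) * Complex.I := by
    push_cast; ring
  simp only [cosSq, fourier_coe_apply, Int.cast_one, mul_one, Complex.ofReal_one, div_one]
  rw [this, Complex.exp_ofReal_mul_I_re]

lemma sinCos_coe (y : ℝ) : sinCos (y : UnitAddCircle) = Real.sin (2 * Real.pi * y) / 2 := by
  have : (2 * Real.pi * Complex.I * y : ℂ) = ((2 * Real.pi * y : ℝ) : ℂ) * Complex.I := by
    push_cast; ring
  simp only [sinCos, fourier_coe_apply, Int.cast_one, mul_one, Complex.ofReal_one, div_one]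
  rw [this, Complex.exp_ofReal_mul_I_im]

@[fun_prop]
lemma continuous_cosSq : Continuous cosSq := by
  unfold cosSq
  exact (continuous_const.add (Complex.continuous_re.comp (fourier 1).continuous)).div_const _

@[fun_prop]
lemma continuous_sinCos : Continuous sinCos := by
  unfold sinCos
  exact (Complex.continuous_im.comp (fourier 1).continuous).div_const _

lemma cosSq_nonneg (x : UnitAddCircle) : 0 ≤ cosSq x := by
  obtain ⟨y, rfl⟩ := QuotientAddGroup.mk_surjective x
  erw [cosSq_coe]
  linarith [Real.neg_one_le_cos (2 * Real.pi * y)]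

lemma cosSq_le_one (x : UnitAddCircle) : cosSq x ≤ 1 := by
  obtain ⟨y, rfl⟩ := QuotientAddGroup.mk_surjective x
  erw [cosSq_coe]
  linarith [Real.cos_le_one (2 * Real.pi * y)]

lemma cosSq_zero : cosSq 0 = 1 := by
  have := cosSq_coe 0
  simpa using this

lemma cosSq_lt_one {x : UnitAddCircle} (hx : x ≠ 0) : cosSq x < 1 := by
  refine lt_of_le_of_ne (cosSq_le_one x) fun h => hx ?_
  obtain ⟨y, rfl⟩ := QuotientAddGroup.mk_surjective x
  erw [cosSq_coe] at h
  have h1 : Real.cos (2 * Real.pi * y) = 1 := by linarith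
  obtain ⟨k, hk⟩ := (Real.cos_eq_one_iff _).1 h1
  have hy : y = k := by
    have : 2 * Real.pi * (y - k) = 0 := by linarith
    rcases mul_eq_zero.1 this with h | h
    · exact absurd h (by positivity)
    · linarith
  change ((y : ℝ) : UnitAddCircle) = 0
  rw [AddCircle.coe_eq_zero_iff]
  exact ⟨k, by simp [hy]⟩

lemma sinCos_sq (x : UnitAddCircle) : sinCos x ^ 2 = cosSq x * (1 - cosSq x) := by
  obtain ⟨y, rfl⟩ := QuotientAddGroup.mk_surjective x
  erw [cosSq_coe, sinCos_coe]
  linear_combination (1 / 4) * Real.sin_sq_add_cos_sq (2 * Real.pi * y)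

lemma hasDerivAt_cosSq (x : UnitAddCircle) (h : ℝ) :
    HasDerivAt (fun h : ℝ => cosSq (x + h)) (-2 * Real.pi * sinCos (x + h)) h := by
  obtain ⟨y, rfl⟩ := QuotientAddGroup.mk_surjective x
  have e : ∀ h : ℝ, (QuotientAddGroup.mk y : UnitAddCircle) + (h : UnitAddCircle)
    = ((y + h : ℝ) : UnitAddCircle) := fun h => rfl
  simp only [e, cosSq_coe, sinCos_coe]
  have h1 : HasDerivAt (fun h : ℝ => 2 * Real.pi * (y + h)) (2 * Real.pi) h := by
    simpa using ((hasDerivAt_id h).const_add y).const_mul (2 * Real.pi)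
  convert! (h1.cos.const_add 1).div_const 2 using 1
  ring

lemma hasDerivAt_sinCos (x : UnitAddCircle) (h : ℝ) :
    HasDerivAt (fun h : ℝ => sinCos (x + h)) (Real.pi * (2 * cosSq (x + h) - 1)) h := by
  obtain ⟨y, rfl⟩ := QuotientAddGroup.mk_surjective x
  have e : ∀ h : ℝ, (QuotientAddGroup.mk y : UnitAddCircle) + (h : UnitAddCircle)
    = ((y + h : ℝ) : UnitAddCircle) := fun h => rfl
  simp only [e, cosSq_coe, sinCos_coe]
  have h1 : HasDerivAt (fun h : ℝ => 2 * Real.pi * (y + h)) (2 * Real.pi) h := by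
    simpa using ((hasDerivAt_id h).const_add y).const_mul (2 * Real.pi)
  convert! h1.sin.div_const 2 using 1
  ring

/-- The normalizing constants of the powers of `cosSq`. -/
def cosConst : ℕ → ℝ
  | 0 => 1
  | n + 1 => cosConst n * ((2 * n + 2) / (2 * n + 1))

lemma cosConst_succ (n : ℕ) : cosConst (n + 1) = cosConst n * ((2 * n + 2) / (2 * n + 1)) := rfl

lemma cosConst_pos (n : ℕ) : 0 < cosConst n := by
  induction n with
  | zero => exact zero_lt_one
  | succ n ih => rw [cosConst_succ]; positivity

lemma cosConst_le_succ (n : ℕ) : cosConst n ≤ cosConst (n + 1) := by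
  rw [cosConst_succ]
  refine le_mul_of_one_le_right (cosConst_pos n).le ?_
  rw [one_le_div (by positivity)]
  linarith

/-- The true order is `cosConst n ~ √(π n)`. The majorant `4n + 1` makes the induction close: the
two sides of `(4n + 1)(2n + 2)² ≤ (4n + 5)(2n + 1)²` differ by exactly `1`. -/
lemma cosConst_sq_le (n : ℕ) : cosConst n ^ 2 ≤ 4 * n + 1 := by
  induction n with
  | zero => simp [cosConst]
  | succ n ih =>
    rw [cosConst_succ, mul_pow, div_pow]
    calc cosConst n ^ 2 * ((2 * n + 2) ^ 2 / (2 * n + 1) ^ 2)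
        ≤ (4 * n + 1) * ((2 * n + 2) ^ 2 / (2 * n + 1) ^ 2) := by gcongr
      _ ≤ _ := by
        rw [← mul_div_assoc, div_le_iff₀ (by positivity)]
        push_cast
        nlinarith

/-- The `L¹`-normalized power `cosSq ^ n`. -/
def circleKernel (n : ℕ) (x : UnitAddCircle) : ℝ := cosConst n * cosSq x ^ n

/-- A primitive of `circleKernel (n + 1) - circleKernel n`. -/
def circlePrimitive (n : ℕ) (x : UnitAddCircle) : ℝ :=
  cosConst n / ((2 * n + 1) * Real.pi) * (cosSq x ^ n * sinCos x)

@[fun_prop]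
lemma continuous_circleKernel (n : ℕ) : Continuous (circleKernel n) := by
  unfold circleKernel; fun_prop

@[fun_prop]
lemma continuous_circlePrimitive (n : ℕ) : Continuous (circlePrimitive n) := by
  unfold circlePrimitive; fun_prop

lemma circleKernel_nonneg (n : ℕ) (x : UnitAddCircle) : 0 ≤ circleKernel n x :=
  mul_nonneg (cosConst_pos n).le (pow_nonneg (cosSq_nonneg x) n)

/-- By `sinCos² = cosSq (1 - cosSq)`, the derivative of `cosSq^n sinCos` is `π ((2n + 2) cosSq^{n+1}
- (2n + 1) cosSq^n)`. The ratio in `cosConst` is the one that turns this into a difference of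
consecutive kernels. -/
lemma hasDerivAt_circlePrimitive (n : ℕ) (x : UnitAddCircle) (h : ℝ) :
    HasDerivAt (fun h : ℝ => circlePrimitive n (x + h))
      (circleKernel (n + 1) (x + h) - circleKernel n (x + h)) h := by
  have h1 := (((hasDerivAt_cosSq x h).pow n).mul (hasDerivAt_sinCos x h)).const_mul
    (cosConst n / ((2 * n + 1) * Real.pi))
  refine h1.congr_deriv ?_
  -- For `n = 0` the exponent `n - 1` is truncated, but the factor `n` removes the term.
  have e1 : (n : ℝ) * cosSq (x + h) ^ (n - 1) * (-2 * Real.pi * sinCos (x + h)) * sinCos (x + h)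
      = -2 * Real.pi * n * cosSq (x + h) ^ n * (1 - cosSq (x + h)) := by
    rcases n with _ | n
    · simp
    · have := sinCos_sq (x + h)
      simp only [Nat.add_sub_cancel]
      calc _ = -2 * Real.pi * (n + 1 : ℕ) * cosSq (x + h) ^ n * sinCos (x + h) ^ 2 := by ring
        _ = _ := by rw [this]; ring
  simp only [Pi.pow_apply]
  rw [e1, circleKernel, circleKernel, cosConst_succ]
  have := Real.pi_pos
  field_simp
  ring

lemma integral_circle_eq (f : UnitAddCircle → ℝ) :
    ∫ x, f x ∂AddCircle.haarAddCircle = ∫ y in (0 : ℝ)..1, f (y : UnitAddCircle) := by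
  rw [AddCircle.integral_haarAddCircle, ← AddCircle.intervalIntegral_preimage 1 0 f]
  simp

lemma integrable_circle {f : UnitAddCircle → ℝ} (hf : Continuous f) :
    Integrable f AddCircle.haarAddCircle :=
  hf.integrable_of_hasCompactSupport (HasCompactSupport.of_compactSpace f)

/-- Consecutive kernels differ by the derivative of a periodic function, so all have the integral of
`circleKernel 0`, which is the constant `1`. -/
lemma integral_circleKernel (n : ℕ) :
    ∫ x, circleKernel n x ∂AddCircle.haarAddCircle = 1 := by
  induction n with
  | zero => simp [circleKernel, cosConst]
  | succ n ih =>
    refine Eq.trans ?_ ih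
    rw [← sub_eq_zero, ← integral_sub (integrable_circle (by fun_prop))
      (integrable_circle (by fun_prop)), integral_circle_eq]
    have h1 : ∀ y ∈ uIcc (0 : ℝ) 1, HasDerivAt (fun y : ℝ => circlePrimitive n (y : UnitAddCircle))
        (circleKernel (n + 1) y - circleKernel n y) y := by
      intro y _
      simpa using hasDerivAt_circlePrimitive n 0 y
    rw [intervalIntegral.integral_eq_sub_of_hasDerivAt h1]
    · have : ((1 : ℝ) : UnitAddCircle) = ((0 : ℝ) : UnitAddCircle) := by
        rw [AddCircle.coe_period]; simp
      simp [this]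
    · refine Continuous.intervalIntegrable ?_ _ _
      have : Continuous fun y : ℝ => (y : UnitAddCircle) := AddCircle.continuous_mk' 1
      fun_prop

lemma integral_cosSq_pow (n : ℕ) :
    ∫ x, cosSq x ^ n ∂AddCircle.haarAddCircle = (cosConst n)⁻¹ := by
  have := integral_circleKernel n
  simp only [circleKernel] at this
  rw [integral_const_mul] at this
  exact (inv_eq_of_mul_eq_one_right this).symm

/-- Bernoulli gives `1 + m(1 - s) ≤ (2 - s)^m`, and `s(2 - s) ≤ 1`. -/
lemma pow_mul_one_sub_le {s : ℝ} (hs0 : 0 ≤ s) (hs1 : s ≤ 1) (m : ℕ) :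
    m * (s ^ m * (1 - s)) ≤ 1 := by
  have hb : 1 + m * (1 - s) ≤ (1 + (1 - s)) ^ m :=
    one_add_mul_le_pow (by linarith) m
  calc m * (s ^ m * (1 - s)) ≤ s ^ m * (1 + m * (1 - s)) := by
        have : 0 ≤ s ^ m := by positivity
        nlinarith
    _ ≤ s ^ m * (1 + (1 - s)) ^ m := by gcongr
    _ = (s * (1 + (1 - s))) ^ m := (mul_pow _ _ _).symm
    _ ≤ 1 := pow_le_one₀ (mul_nonneg hs0 (by linarith)) (by nlinarith [sq_nonneg (1 - s)])

lemma abs_circlePrimitive (n : ℕ) (x : UnitAddCircle) : |circlePrimitive n x| =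
    cosConst n / ((2 * n + 1) * Real.pi) * |cosSq x ^ n * sinCos x| := by
  have := cosConst_pos n
  rw [circlePrimitive, abs_mul, abs_of_pos (by positivity)]

/-- The square of `cosSq^n sinCos` is `cosSq^{2n+1} (1 - cosSq) = O(1/n)`. This cancels `cosConst n
^ 2 = O(n)`, and the factor `1/(2n + 1)` of the prefactor remains. -/
lemma abs_circlePrimitive_le (n : ℕ) (x : UnitAddCircle) :
    |circlePrimitive n x| ≤ 1 / (2 * n + 1) := by
  have hpi := Real.pi_gt_three
  have hc := cosConst_pos n
  have h1 : (cosSq x ^ n * sinCos x) ^ 2 ≤ 1 / (2 * n + 1) := by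
    have := pow_mul_one_sub_le (cosSq_nonneg x) (cosSq_le_one x) (2 * n + 1)
    rw [mul_pow, sinCos_sq, le_div_iff₀ (by positivity)]
    push_cast at this
    calc _ = (2 * n + 1) * (cosSq x ^ (2 * n + 1) * (1 - cosSq x)) := by ring
      _ ≤ 1 := this
  have h2 : (cosConst n * (cosSq x ^ n * sinCos x)) ^ 2 ≤ 2 := by
    rw [mul_pow]
    calc _ ≤ (4 * n + 1 : ℝ) * (1 / (2 * n + 1)) := by gcongr; exact cosConst_sq_le n
      _ ≤ 2 := by
        rw [mul_one_div, div_le_iff₀ (by positivity)]; linarith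
  have h3 : |cosConst n * (cosSq x ^ n * sinCos x)| ≤ 2 :=
    abs_le_of_sq_le_sq (h2.trans (by norm_num)) (by norm_num)
  rw [circlePrimitive, div_mul_eq_mul_div, abs_div, abs_of_pos (a := (2 * n + 1 : ℝ) * Real.pi)
    (by positivity), div_le_div_iff₀ (by positivity) (by positivity)]
  nlinarith [show (0 : ℝ) ≤ 2 * n + 1 by positivity]

/-- The primitive is concentrated on the length scale `n^{-1/2}`, which gains `n^{-1/2}` over the
supremum bound. Cauchy–Schwarz with weight `cosSq^n` makes this precise, since both resulting
integrals are known in closed form. -/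
lemma integral_abs_circlePrimitive_le (n : ℕ) :
    ∫ x, |circlePrimitive n x| ∂AddCircle.haarAddCircle ≤ ((n + 1 : ℝ) ^ (3 / 2 : ℝ))⁻¹ := by
  have hpi := Real.pi_gt_three
  have hc := cosConst_pos n
  have hc1 := cosConst_pos (n + 1)
  set μ : Measure UnitAddCircle := AddCircle.haarAddCircle
  have hI : ∫ x, cosSq x ^ n * sinCos x ^ 2 ∂μ = (cosConst (n + 1))⁻¹ / (2 * n + 4) := by
    have e : ∀ x, cosSq x ^ n * sinCos x ^ 2 = cosSq x ^ (n + 1) - cosSq x ^ (n + 2) := by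
      intro x; rw [sinCos_sq]; ring
    simp only [e]
    rw [integral_sub (integrable_circle (by fun_prop)) (integrable_circle (by fun_prop)),
      integral_cosSq_pow, integral_cosSq_pow, cosConst_succ (n + 1)]
    push_cast
    field_simp
    ring
  have hCS : (∫ x, |cosSq x ^ n * sinCos x| ∂μ) ^ 2
      ≤ (∫ x, cosSq x ^ n ∂μ) * ∫ x, cosSq x ^ n * sinCos x ^ 2 ∂μ := by
    -- Cauchy–Schwarz through the discriminant of `r ↦ ∫ cosSq^n (r - |sinCos|)²`, which is
    -- nonnegative.
    have hquad : ∀ r : ℝ, 0 ≤ (∫ x, cosSq x ^ n ∂μ) * (r * r)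
        + (-2 * ∫ x, |cosSq x ^ n * sinCos x| ∂μ) * r + ∫ x, cosSq x ^ n * sinCos x ^ 2 ∂μ := by
      intro r
      have : 0 ≤ ∫ x, cosSq x ^ n * (r - |sinCos x|) ^ 2 ∂μ :=
        integral_nonneg fun x => mul_nonneg (pow_nonneg (cosSq_nonneg x) n) (sq_nonneg _)
      have e : ∀ x, cosSq x ^ n * (r - |sinCos x|) ^ 2 = cosSq x ^ n * (r * r)
          + -2 * |cosSq x ^ n * sinCos x| * r + cosSq x ^ n * sinCos x ^ 2 := by
        intro x
        rw [abs_mul, abs_of_nonneg (pow_nonneg (cosSq_nonneg x) n), ← sq_abs (sinCos x)]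
        ring
      simp only [e] at this
      rw [integral_add (integrable_circle (by fun_prop)) (integrable_circle (by fun_prop)),
        integral_add (integrable_circle (by fun_prop)) (integrable_circle (by fun_prop)),
        integral_mul_const, integral_mul_const, integral_const_mul] at this
      exact this
    have := discrim_le_zero hquad
    rw [discrim] at this
    nlinarith
  rw [integral_cosSq_pow, hI] at hCS
  simp only [abs_circlePrimitive]
  rw [integral_const_mul]
  set J := ∫ x, |cosSq x ^ n * sinCos x| ∂μ with hJ
  have hJ0 : 0 ≤ J := integral_nonneg fun x => abs_nonneg _
  have h1 : (cosConst n * J) ^ 2 ≤ 1 / (2 * n + 4) := by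
    rw [mul_pow]
    calc _ ≤ cosConst n ^ 2 * ((cosConst n)⁻¹ * ((cosConst (n + 1))⁻¹ / (2 * n + 4))) := by gcongr
      _ = (cosConst n / cosConst (n + 1)) * (1 / (2 * n + 4)) := by field_simp
      _ ≤ 1 * (1 / (2 * n + 4)) := by
        gcongr
        rw [div_le_one hc1]
        exact cosConst_le_succ n
      _ = _ := one_mul _
  have h2 : cosConst n * J ≤ ((n + 1 : ℝ) ^ (1 / 2 : ℝ))⁻¹ := by
    rw [← Real.sqrt_eq_rpow]
    refine le_of_sq_le_sq ?_ (by positivity)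
    rw [inv_pow, Real.sq_sqrt (by positivity)]
    refine h1.trans ?_
    rw [one_div]
    gcongr <;> linarith
  have h3 : (n + 1 : ℝ) ^ (3 / 2 : ℝ) = (n + 1) * (n + 1 : ℝ) ^ (1 / 2 : ℝ) := by
    nth_rw 2 [← Real.rpow_one (n + 1 : ℝ)]
    rw [← Real.rpow_add (by positivity)]
    norm_num
  rw [h3, mul_inv, div_mul_eq_mul_div, div_eq_inv_mul]
  gcongr
  nlinarith [show (0 : ℝ) ≤ n by positivity]

end WeakProduct

end

noncomputable section

namespace WeakProduct

/-! ### Convolution kernels on the torus -/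

instance : torusMeasure.IsAddHaarMeasure := by
  unfold torusMeasure; infer_instance

/-- The approximate identity `∏ cos^{2n} (π x_j)`, normalized. -/
def torusKernel (n : ℕ) (x : T3) : ℝ := ∏ j, circleKernel n (x j)

/-- The factors of `torusPotential`. -/
def potentialFactor (i : Fin 3) (n : ℕ) (j : Fin 3) : UnitAddCircle → ℝ :=
  if j < i then circleKernel (n + 1) else if j = i then circlePrimitive n else circleKernel n

/-- A vector field with divergence `torusKernel (n + 1) - torusKernel n`. -/
def torusPotential (i : Fin 3) (n : ℕ) (x : T3) : ℝ := ∏ j, potentialFactor i n j (x j)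

/-- Convolution on the torus. -/
def conv (f k : T3 → ℝ) (x : T3) : ℝ := ∫ y, f y * k (x - y) ∂torusMeasure

@[fun_prop]
lemma continuous_torusKernel (n : ℕ) : Continuous (torusKernel n) := by
  unfold torusKernel; fun_prop

@[fun_prop]
lemma continuous_potentialFactor (i : Fin 3) (n : ℕ) (j : Fin 3) :
    Continuous (potentialFactor i n j) := by
  unfold potentialFactor; split_ifs <;> fun_prop

@[fun_prop]
lemma continuous_torusPotential (i : Fin 3) (n : ℕ) : Continuous (torusPotential i n) := by
  unfold torusPotential; fun_prop

lemma integrable_torus {f : T3 → ℝ} (hf : Continuous f) : Integrable f torusMeasure :=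
  hf.integrable_of_hasCompactSupport (HasCompactSupport.of_compactSpace f)

lemma exists_bound_torus {f : T3 → ℝ} (hf : Continuous f) : ∃ B : ℝ, ∀ x, ‖f x‖ ≤ B := by
  obtain ⟨B, hB⟩ := isCompact_univ.exists_bound_of_continuousOn hf.continuousOn
  exact ⟨B, fun x => hB x (mem_univ x)⟩

lemma integrable_mul_translate {f k : T3 → ℝ} (hf : Integrable f torusMeasure) (hk : Continuous k)
    (x : T3) : Integrable (fun y => f y * k (x - y)) torusMeasure := by
  obtain ⟨B, hB⟩ := exists_bound_torus hk
  exact hf.mul_bdd (c := B) (by fun_prop) (ae_of_all _ fun y => hB _)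

lemma continuous_conv {f k : T3 → ℝ} (hf : Integrable f torusMeasure) (hk : Continuous k) :
    Continuous (conv f k) := by
  obtain ⟨B, hB⟩ := exists_bound_torus hk
  refine continuous_of_dominated (bound := fun y => ‖f y‖ * B) (fun x => ?_) (fun x => ?_)
    (hf.norm.mul_const B) ?_
  · exact (integrable_mul_translate hf hk x).1
  · refine ae_of_all _ fun y => ?_
    rw [norm_mul]
    gcongr
    exact hB _
  · exact ae_of_all _ fun y => by fun_prop

lemma torusKernel_nonneg (n : ℕ) (x : T3) : 0 ≤ torusKernel n x :=
  Finset.prod_nonneg fun j _ => circleKernel_nonneg n (x j)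

lemma integral_torusKernel (n : ℕ) : ∫ x, torusKernel n x ∂torusMeasure = 1 := by
  unfold torusKernel torusMeasure
  rw [integral_fintype_prod_eq_prod (fun _ => circleKernel n)]
  simp [integral_circleKernel]

lemma abs_circleKernel_le (n : ℕ) (x : UnitAddCircle) : |circleKernel n x| ≤ cosConst n := by
  rw [abs_of_nonneg (circleKernel_nonneg n x), circleKernel]
  exact mul_le_of_le_one_right (cosConst_pos n).le (pow_le_one₀ (cosSq_nonneg x) (cosSq_le_one x))

/-- Two kernel factors of size `O(√n)` meet one primitive of size `O(1/n)`; in dimension three these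
balance, so the bound does not depend on `n`. -/
lemma abs_torusPotential_le (i : Fin 3) (n : ℕ) (x : T3) : |torusPotential i n x| ≤ 5 := by
  have h1 : ∀ x, |circleKernel n x| ≤ cosConst (n + 1) :=
    fun x => (abs_circleKernel_le n x).trans (cosConst_le_succ n)
  have h2 := abs_circleKernel_le (n + 1)
  have h3 := abs_circlePrimitive_le n
  have hc := cosConst_pos (n + 1)
  have h4 : cosConst (n + 1) * cosConst (n + 1) * (1 / (2 * n + 1)) ≤ 5 := by
    have := cosConst_sq_le (n + 1)
    rw [mul_one_div, div_le_iff₀ (by positivity)]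
    push_cast at this
    nlinarith [show (0 : ℝ) ≤ n by positivity]
  have h5 : ∀ {a b c : ℝ}, |a| ≤ cosConst (n + 1) → |b| ≤ cosConst (n + 1) →
      |c| ≤ 1 / (2 * n + 1) → |a| * |b| * |c| ≤ 5 := by
    intro a b c ha hb hcc
    refine le_trans ?_ h4
    gcongr
  rw [torusPotential, Fin.prod_univ_three, abs_mul, abs_mul]
  fin_cases i
  · simp only [potentialFactor]
    simp
    calc _ = |circleKernel n (x 1)| * |circleKernel n (x 2)| * |circlePrimitive n (x 0)| := by ring
      _ ≤ 5 := h5 (h1 _) (h1 _) (h3 _)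
  · simp only [potentialFactor]
    simp
    calc _ = |circleKernel (n + 1) (x 0)| * |circleKernel n (x 2)| * |circlePrimitive n (x 1)| := by
          ring
      _ ≤ 5 := h5 (h2 _) (h1 _) (h3 _)
  · simp only [potentialFactor]
    simp
    exact h5 (h2 _) (h2 _) (h3 _)

/-- The integral factorizes over the coordinates; the kernel factors have mass one and only the
primitive contributes. -/
lemma integral_abs_torusPotential_le (i : Fin 3) (n : ℕ) :
    ∫ x, |torusPotential i n x| ∂torusMeasure ≤ ((n + 1 : ℝ) ^ (3 / 2 : ℝ))⁻¹ := by
  unfold torusPotential torusMeasure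
  simp only [Finset.abs_prod]
  rw [integral_fintype_prod_eq_prod (fun j y => |potentialFactor i n j y|)]
  have h1 : ∀ m, ∫ x, |circleKernel m x| ∂AddCircle.haarAddCircle = 1 := by
    intro m
    simp only [abs_of_nonneg (circleKernel_nonneg m _)]
    exact integral_circleKernel m
  have h2 := integral_abs_circlePrimitive_le n
  rw [Finset.prod_eq_single i]
  · simpa [potentialFactor] using h2
  · intro j _ hj
    simp only [potentialFactor, if_neg hj]
    split_ifs
    · exact h1 _
    · exact h1 _
  · simp

lemma contDiff_cosSq_lift (a : UnitAddCircle) :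
    ContDiff ℝ ∞ fun y : ℝ => cosSq (a - (y : UnitAddCircle)) := by
  obtain ⟨c, rfl⟩ := QuotientAddGroup.mk_surjective a
  have e : ∀ h : ℝ, (QuotientAddGroup.mk c : UnitAddCircle) - (h : UnitAddCircle)
    = ((c - h : ℝ) : UnitAddCircle) := fun h => rfl
  simp only [e, cosSq_coe]
  fun_prop

lemma contDiff_sinCos_lift (a : UnitAddCircle) :
    ContDiff ℝ ∞ fun y : ℝ => sinCos (a - (y : UnitAddCircle)) := by
  obtain ⟨c, rfl⟩ := QuotientAddGroup.mk_surjective a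
  have e : ∀ h : ℝ, (QuotientAddGroup.mk c : UnitAddCircle) - (h : UnitAddCircle)
    = ((c - h : ℝ) : UnitAddCircle) := fun h => rfl
  simp only [e, sinCos_coe]
  fun_prop

lemma contDiff_potentialFactor_lift (i : Fin 3) (n : ℕ) (j : Fin 3) (a : UnitAddCircle) :
    ContDiff ℝ ∞ fun y : ℝ => potentialFactor i n j (a - (y : UnitAddCircle)) := by
  have h1 := contDiff_cosSq_lift a
  have h2 := contDiff_sinCos_lift a
  unfold potentialFactor
  split_ifs
  · unfold circleKernel; fun_prop
  · unfold circlePrimitive; fun_prop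
  · unfold circleKernel; fun_prop

lemma smoothTorus_potential (i : Fin 3) (n : ℕ) (x : T3) :
    SmoothTorus fun y => torusPotential i n (x - y) := by
  unfold SmoothTorus torusPotential
  refine contDiff_prod fun j _ => ?_
  exact (contDiff_potentialFactor_lift i n j (x j)).comp (contDiff_apply ℝ ℝ j)

lemma torusPartial_potential (i : Fin 3) (n : ℕ) (x y : T3) :
    torusPartial i (fun y => torusPotential i n (x - y)) y =
      -((circleKernel (n + 1) (x i - y i) - circleKernel n (x i - y i)) *
        ∏ j ∈ Finset.univ.erase i, potentialFactor i n j (x j - y j)) := by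
  unfold torusPartial torusPotential
  have e : ∀ h : ℝ, ∏ j, potentialFactor i n j
      ((x - (y + (Pi.single i (h : UnitAddCircle) : T3)) : T3) j)
      = circlePrimitive n ((x i - y i) + ((-h : ℝ) : UnitAddCircle)) *
        ∏ j ∈ Finset.univ.erase i, potentialFactor i n j (x j - y j) := by
    intro h
    rw [← Finset.mul_prod_erase _ _ (Finset.mem_univ i)]
    congr 1
    · simp only [potentialFactor, lt_irrefl, if_false, if_true, Pi.sub_apply, Pi.add_apply,
        Pi.single_eq_same]
      congr 1
      rw [AddCircle.coe_neg]
      abel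
    · refine Finset.prod_congr rfl fun j hj => ?_
      rw [Finset.mem_erase] at hj
      simp [Pi.single_eq_of_ne hj.1]
  simp only [e]
  have h1 := hasDerivAt_circlePrimitive n (x i - y i) (-0)
  have h2 := (h1.scomp (0 : ℝ) (hasDerivAt_neg (0 : ℝ))).mul_const
    (∏ j ∈ Finset.univ.erase i, potentialFactor i n j (x j - y j))
  have h3 := h2.deriv
  simp only [Function.comp_def, neg_zero, QuotientAddGroup.mk_zero, add_zero, smul_eq_mul,
    neg_mul, one_mul] at h3
  exact h3

/-- Telescoping over the coordinates: the `i`-th term changes the `i`-th factor from index `n` to `n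
+ 1`, with the earlier coordinates already changed and the later ones not yet. The sign comes from
differentiating in `y` a function of `x - y`. -/
lemma sum_torusPartial_potential (n : ℕ) (x y : T3) :
    ∑ i, torusPartial i (fun y => torusPotential i n (x - y)) y =
      -(torusKernel (n + 1) (x - y) - torusKernel n (x - y)) := by
  simp only [torusPartial_potential, torusKernel, Pi.sub_apply]
  have e : ∀ (i : Fin 3) (f : Fin 3 → ℝ), ∏ j ∈ Finset.univ.erase i, f j
      = if i = 0 then f 1 * f 2 else if i = 1 then f 0 * f 2 else f 0 * f 1 := by
    intro i f
    fin_cases i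
    · rw [show (Finset.univ.erase ((fun i => i) (⟨0, by simp⟩ : Fin 3))) = {1, 2} by decide]
      simp
    · rw [show (Finset.univ.erase ((fun i => i) (⟨1, by simp⟩ : Fin 3))) = {0, 2} by decide]
      simp
    · rw [show (Finset.univ.erase ((fun i => i) (⟨2, by simp⟩ : Fin 3))) = {0, 1} by decide]
      simp
  simp only [e, Fin.sum_univ_three, Fin.prod_univ_three]
  simp [potentialFactor]
  ring

lemma continuous_torusPartial_potential (i : Fin 3) (n : ℕ) (x : T3) :
    Continuous (torusPartial i (fun y => torusPotential i n (x - y))) := by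
  have : torusPartial i (fun y => torusPotential i n (x - y)) = fun y =>
      -((circleKernel (n + 1) (x i - y i) - circleKernel n (x i - y i)) *
        ∏ j ∈ Finset.univ.erase i, potentialFactor i n j (x j - y j)) :=
    funext fun y => torusPartial_potential i n x y
  rw [this]
  fun_prop

/-- `g` is the weak gradient of `f` on the torus. -/
def IsTorusWeakGrad (f : T3 → ℝ) (g : Fin 3 → T3 → ℝ) : Prop :=
  ∀ i : Fin 3, ∀ φ : T3 → ℝ, SmoothTorus φ →
    ∫ x, f x * torusPartial i φ x ∂torusMeasure = -∫ x, g i x * φ x ∂torusMeasure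

/-- The definition of the weak gradient is tested with `y ↦ torusPotential i n (x - y)`. This is the
integration by parts that turns increments of the regularization into convolutions of the gradient.
-/
lemma conv_succ_sub {f : T3 → ℝ} {g : Fin 3 → T3 → ℝ} (hf : Integrable f torusMeasure)
    (hg : IsTorusWeakGrad f g) (n : ℕ) (x : T3) :
    conv f (torusKernel (n + 1)) x - conv f (torusKernel n) x
      = ∑ i, conv (g i) (torusPotential i n) x := by
  have hinteg : ∀ i, Integrable (fun y => f y *
      torusPartial i (fun y => torusPotential i n (x - y)) y) torusMeasure := by
    intro i
    obtain ⟨B, hB⟩ := exists_bound_torus (continuous_torusPartial_potential i n x)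
    exact hf.mul_bdd (c := B) (continuous_torusPartial_potential i n x).aestronglyMeasurable
      (ae_of_all _ hB)
  have h1 : ∀ i, conv (g i) (torusPotential i n) x
      = -∫ y, f y * torusPartial i (fun y => torusPotential i n (x - y)) y ∂torusMeasure := by
    intro i
    rw [hg i _ (smoothTorus_potential i n x), neg_neg]
    rfl
  simp only [h1, Finset.sum_neg_distrib]
  rw [← integral_finsetSum _ fun i _ => hinteg i]
  simp only [← Finset.mul_sum, sum_torusPartial_potential]
  rw [conv, conv, ← integral_sub (integrable_mul_translate hf (by fun_prop) x)
    (integrable_mul_translate hf (by fun_prop) x), ← integral_neg]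
  congr 1; ext y; ring

end WeakProduct

end

noncomputable section

namespace WeakProduct

/-! ### Convolution inequalities -/

instance : torusMeasure.IsNegInvariant :=
  Measure.IsAddHaarMeasure.isNegInvariant_of_regular _

lemma enorm_conv_le (g k : T3 → ℝ) (x : T3) :
    ‖conv g k x‖ₑ ≤ ∫⁻ y, ‖g y‖ₑ * ‖k (x - y)‖ₑ ∂torusMeasure := by
  refine (enorm_integral_le_lintegral_enorm _).trans (le_of_eq ?_)
  simp only [enorm_mul]

lemma lintegral_translate (F : T3 → ℝ≥0∞) (x : T3) :
    ∫⁻ y, F (x - y) ∂torusMeasure = ∫⁻ y, F y ∂torusMeasure :=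
  lintegral_sub_left_eq_self F x

lemma lintegral_conv_swap {g k : T3 → ℝ≥0∞} (hg : AEMeasurable g torusMeasure) (hk : Measurable k) :
    ∫⁻ x, ∫⁻ y, g y * k (x - y) ∂torusMeasure ∂torusMeasure
      = (∫⁻ y, g y ∂torusMeasure) * ∫⁻ y, k y ∂torusMeasure := by
  have hm : AEMeasurable (Function.uncurry fun x y : T3 => g y * k (x - y))
      (torusMeasure.prod torusMeasure) :=
    (hg.comp_snd).mul (hk.comp (measurable_fst.sub measurable_snd)).aemeasurable
  rw [lintegral_lintegral_swap hm]
  have : ∀ y, ∫⁻ x, g y * k (x - y) ∂torusMeasure = g y * ∫⁻ x, k x ∂torusMeasure := by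
    intro y
    rw [lintegral_const_mul _ (by fun_prop), lintegral_sub_right_eq_self k y]
  simp only [this]
  rw [lintegral_mul_const'' _ hg]

/-- Young's convolution inequality, in the form of an interpolation between the `L¹` and the
`L^∞` norm of the kernel. -/
lemma lintegral_conv_rpow_le {p s : ℝ} (hp : 1 ≤ p) (hps : p ≤ s) {g k : T3 → ℝ}
    (hg : AEStronglyMeasurable g torusMeasure) (hk : Continuous k) {A B : ℝ≥0∞}
    (hA : ∫⁻ y, ‖k y‖ₑ ∂torusMeasure ≤ A) (hB : ∀ y, ‖k y‖ₑ ≤ B) :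
    ∫⁻ x, ‖conv g k x‖ₑ ^ s ∂torusMeasure ≤
      (A ^ (p - 1) * (B * ∫⁻ y, ‖g y‖ₑ ^ p ∂torusMeasure)) ^ (s / p - 1) *
        (A ^ (p - 1) * (A * ∫⁻ y, ‖g y‖ₑ ^ p ∂torusMeasure)) := by
  have hp0 : 0 < p := by linarith
  set D : T3 → ℝ≥0∞ := fun x => A ^ (p - 1) * ∫⁻ y, ‖g y‖ₑ ^ p * ‖k (x - y)‖ₑ ∂torusMeasure with hD
  have hkx : ∀ x, Measurable fun y => ‖k (x - y)‖ₑ := fun x => by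
    have : Continuous fun y => k (x - y) := by fun_prop
    exact this.measurable.enorm
  -- Hölder with respect to the weight `|k(x - y)| dy`: the weight is split as `|k|^{1/p} |k|^{1 -
  -- 1/p}`, and the second factor integrates to a power of `A`.
  have h1 : ∀ x, ‖conv g k x‖ₑ ^ p ≤ D x := by
    intro x
    have h2 := ENNReal.lintegral_mul_norm_pow_le (μ := torusMeasure)
      (f := fun y => ‖g y‖ₑ ^ p * ‖k (x - y)‖ₑ) (g := fun y => ‖k (x - y)‖ₑ)
      ((hg.enorm.pow_const p).mul (hkx x).aemeasurable) (hkx x).aemeasurable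
      (p := 1 / p) (q := 1 - 1 / p) (by positivity)
      (by rw [sub_nonneg, div_le_one hp0]; exact hp) (by ring)
    have e : ∀ y, (‖g y‖ₑ ^ p * ‖k (x - y)‖ₑ) ^ (1 / p) * ‖k (x - y)‖ₑ ^ (1 - 1 / p)
        = ‖g y‖ₑ * ‖k (x - y)‖ₑ := by
      intro y
      rw [ENNReal.mul_rpow_of_nonneg _ _ (by positivity), ← ENNReal.rpow_mul,
        mul_one_div_cancel hp0.ne', ENNReal.rpow_one, mul_assoc,
        ← ENNReal.rpow_add_of_nonneg _ _ (by positivity)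
          (by rw [sub_nonneg, div_le_one hp0]; exact hp)]
      simp
    simp only [e] at h2
    have h3 := ENNReal.rpow_le_rpow ((enorm_conv_le g k x).trans h2) hp0.le
    refine h3.trans ?_
    rw [ENNReal.mul_rpow_of_nonneg _ _ hp0.le, ← ENNReal.rpow_mul, ← ENNReal.rpow_mul,
      one_div_mul_cancel hp0.ne', ENNReal.rpow_one, mul_comm]
    have e2 : (1 - 1 / p) * p = p - 1 := by field_simp
    rw [e2, lintegral_translate (fun y => ‖k y‖ₑ)]
    simp only [hD]
    gcongr
  have h2 : ∀ x, D x ≤ A ^ (p - 1) * (B * ∫⁻ y, ‖g y‖ₑ ^ p ∂torusMeasure) := by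
    intro x
    simp only [hD]
    gcongr
    rw [mul_comm, ← lintegral_mul_const'' _ (hg.enorm.pow_const p)]
    gcongr
    exact hB _
  have hDm : AEMeasurable (fun x => ∫⁻ y, ‖g y‖ₑ ^ p * ‖k (x - y)‖ₑ ∂torusMeasure) torusMeasure := by
    refine AEMeasurable.lintegral_prod_right' (f := fun z : T3 × T3 =>
      ‖g z.2‖ₑ ^ p * ‖k (z.1 - z.2)‖ₑ) ?_
    exact ((hg.enorm.pow_const p).comp_snd).mul
      (hk.measurable.enorm.comp (measurable_fst.sub measurable_snd)).aemeasurable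
  have h3 : ∫⁻ x, D x ∂torusMeasure
      ≤ A ^ (p - 1) * (A * ∫⁻ y, ‖g y‖ₑ ^ p ∂torusMeasure) := by
    simp only [hD]
    rw [lintegral_const_mul'' _ hDm, lintegral_conv_swap (k := fun y => ‖k y‖ₑ)
      (hg.enorm.pow_const p) hk.measurable.enorm, mul_comm A]
    gcongr
  -- The power is split as `s = (s - p) + p`. The first part is bounded pointwise through `B`, the
  -- second is integrated and produces `A`.
  calc ∫⁻ x, ‖conv g k x‖ₑ ^ s ∂torusMeasure
      ≤ ∫⁻ x, (A ^ (p - 1) * (B * ∫⁻ y, ‖g y‖ₑ ^ p ∂torusMeasure)) ^ (s / p - 1) * D x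
          ∂torusMeasure := by
        refine lintegral_mono fun x => ?_
        have e : ‖conv g k x‖ₑ ^ s = (‖conv g k x‖ₑ ^ p) ^ (s / p - 1) * ‖conv g k x‖ₑ ^ p := by
          rw [← ENNReal.rpow_mul, ← ENNReal.rpow_add_of_nonneg _ _ _ hp0.le]
          · congr 1; field_simp; ring
          · refine mul_nonneg hp0.le ?_
            rw [sub_nonneg, one_le_div hp0]; exact hps
        rw [e]
        gcongr
        · rw [sub_nonneg, one_le_div hp0]; exact hps
        · exact (h1 x).trans (h2 x)
        · exact h1 x
    _ = (A ^ (p - 1) * (B * ∫⁻ y, ‖g y‖ₑ ^ p ∂torusMeasure)) ^ (s / p - 1) * ∫⁻ x, D x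
          ∂torusMeasure := lintegral_const_mul'' _ (hDm.const_mul _)
    _ ≤ _ := by gcongr

/-- The `s`-th root of the preceding bound. The power of the `L¹` size `A` collects to `(p - 1)/p +
1/s`, and this exponent later decides summability. -/
lemma eLpNorm_conv_le {p s : ℝ≥0∞} (hp : 1 ≤ p) (hps : p ≤ s) (hs : s ≠ ⊤) {g k : T3 → ℝ}
    (hg : AEStronglyMeasurable g torusMeasure) (hk : Continuous k) {A B : ℝ≥0∞}
    (hA : ∫⁻ y, ‖k y‖ₑ ∂torusMeasure ≤ A) (hB : ∀ y, ‖k y‖ₑ ≤ B) :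
    eLpNorm (conv g k) s torusMeasure ≤
      A ^ (1 - 1 / p.toReal + 1 / s.toReal) * B ^ (1 / p.toReal - 1 / s.toReal) *
        eLpNorm g p torusMeasure := by
  have hpt : p ≠ ⊤ := ne_top_of_le_ne_top hs hps
  have hp0 : p ≠ 0 := by positivity
  have hs0 : s ≠ 0 := by have := hp.trans hps; positivity
  have hp1 : 1 ≤ p.toReal := by
    rw [← ENNReal.toReal_one]; exact ENNReal.toReal_mono hpt hp
  have hps' : p.toReal ≤ s.toReal := ENNReal.toReal_mono hs hps
  rw [eLpNorm_eq_lintegral_rpow_enorm_toReal hp0 hpt,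
    eLpNorm_eq_lintegral_rpow_enorm_toReal hs0 hs]
  have h := lintegral_conv_rpow_le hp1 hps' hg hk hA hB
  set P := p.toReal
  set S := s.toReal
  set G := ∫⁻ y, ‖g y‖ₑ ^ P ∂torusMeasure
  have hP : 0 < P := by linarith
  have hS : 0 < S := by linarith
  have hi : 1 / S ≤ 1 / P := one_div_le_one_div_of_le hP hps'
  have hi2 : 1 / P ≤ 1 := by rw [div_le_one hP]; exact hp1
  have hi3 : 0 < 1 / S := by positivity
  refine (ENNReal.rpow_le_rpow h (by positivity : 0 ≤ 1 / S)).trans (le_of_eq ?_)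
  rw [ENNReal.mul_rpow_of_nonneg _ _ hi3.le, ← ENNReal.rpow_mul]
  have e1 : (S / P - 1) * (1 / S) = 1 / P - 1 / S := by field_simp
  have h0 : 0 ≤ 1 / P - 1 / S := by linarith
  rw [e1, ENNReal.mul_rpow_of_nonneg _ _ h0, ENNReal.mul_rpow_of_nonneg _ _ h0,
    ENNReal.mul_rpow_of_nonneg _ _ hi3.le, ENNReal.mul_rpow_of_nonneg _ _ hi3.le,
    ← ENNReal.rpow_mul, ← ENNReal.rpow_mul]
  have eA : A ^ (1 - 1 / P + 1 / S) = A ^ ((P - 1) * (1 / P - 1 / S)) * A ^ ((P - 1) * (1 / S))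
      * A ^ (1 / S) := by
    have hP1 : 0 ≤ P - 1 := by linarith
    rw [← ENNReal.rpow_add_of_nonneg _ _ (by positivity) (by positivity),
      ← ENNReal.rpow_add_of_nonneg _ _ (by positivity) (by positivity)]
    congr 1; field_simp; ring
  have eG : G ^ (1 / P) = G ^ (1 / P - 1 / S) * G ^ (1 / S) := by
    rw [← ENNReal.rpow_add_of_nonneg _ _ h0 hi3.le]
    congr 1; ring
  rw [eA, eG]
  ring

lemma eLpNorm_conv_one_le {f k : T3 → ℝ} (hf : AEStronglyMeasurable f torusMeasure)
    (hk : Continuous k) :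
    eLpNorm (conv f k) 1 torusMeasure
      ≤ eLpNorm f 1 torusMeasure * ∫⁻ y, ‖k y‖ₑ ∂torusMeasure := by
  simp only [eLpNorm_one_eq_lintegral_enorm]
  rw [← lintegral_conv_swap (k := fun y => ‖k y‖ₑ) hf.enorm hk.measurable.enorm]
  exact lintegral_mono fun x => enorm_conv_le f k x

/-! ### The approximate identity -/

lemma lintegral_enorm_torusKernel (n : ℕ) : ∫⁻ y, ‖torusKernel n y‖ₑ ∂torusMeasure = 1 := by
  have h := ofReal_integral_eq_lintegral_ofReal (integrable_torus (continuous_torusKernel n))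
    (ae_of_all _ (torusKernel_nonneg n))
  rw [integral_torusKernel, ENNReal.ofReal_one] at h
  rw [h]
  refine lintegral_congr fun y => ?_
  rw [Real.enorm_eq_ofReal (torusKernel_nonneg n y)]

lemma conv_eq_integral_translate (f k : T3 → ℝ) (x : T3) :
    conv f k x = ∫ y, f (x - y) * k y ∂torusMeasure := by
  rw [conv, ← integral_sub_left_eq_self (fun y => f y * k (x - y)) torusMeasure x]
  simp

/-- The kernel is a normalized power of a function with a unique maximum at the origin, so its mass
concentrates there. -/
lemma tendsto_conv_of_continuous {f : T3 → ℝ} (hf : Continuous f) (x : T3) :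
    Tendsto (fun n => conv f (torusKernel n) x) atTop (𝓝 (f x)) := by
  set c : T3 → ℝ := fun y => ∏ j, cosSq (y j) with hc
  have hcc : Continuous c := by fun_prop
  have hpow : ∀ n, ∫ y, c y ^ n ∂torusMeasure = ((cosConst n) ^ 3)⁻¹ := by
    intro n
    simp only [hc, ← Finset.prod_pow]
    unfold torusMeasure
    rw [integral_fintype_prod_eq_prod (fun _ y => cosSq y ^ n)]
    simp [integral_cosSq_pow]
  have h := tendsto_setIntegral_pow_smul_of_unique_maximum_of_isCompact_of_continuousOn
    (μ := torusMeasure) (s := univ) (x₀ := (0 : T3)) (g := fun y => f (x - y)) isCompact_univ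
    hcc.continuousOn ?_ ?_ ?_ ?_ ?_
  · simp only [Measure.restrict_univ, sub_zero, hpow] at h
    refine h.congr fun n => ?_
    rw [conv_eq_integral_translate, inv_inv, smul_eq_mul, ← integral_const_mul]
    congr 1; ext y
    simp only [torusKernel, circleKernel, hc, smul_eq_mul, Finset.prod_mul_distrib,
      Finset.prod_const, Finset.card_univ, Fintype.card_fin, Finset.prod_pow]
    ring
  · intro y _ hy
    have h0 : c 0 = 1 := by simp [hc, cosSq_zero]
    rw [h0]
    obtain ⟨i, hi⟩ := Function.ne_iff.1 hy
    rw [hc]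
    dsimp only
    rw [← Finset.mul_prod_erase _ _ (Finset.mem_univ i)]
    calc cosSq (y i) * ∏ j ∈ Finset.univ.erase i, cosSq (y j) ≤ cosSq (y i) * 1 := by
          gcongr
          · exact cosSq_nonneg _
          · exact Finset.prod_le_one (fun j _ => cosSq_nonneg _) fun j _ => cosSq_le_one _
      _ < 1 := by rw [mul_one]; exact cosSq_lt_one hi
  · exact fun y _ => Finset.prod_nonneg fun j _ => cosSq_nonneg _
  · simp [hc, cosSq_zero]
  · simp
  · exact (hf.comp (continuous_const.sub continuous_id)).continuousOn

lemma abs_conv_torusKernel_le {f : T3 → ℝ} {M : ℝ} (hM : ∀ x, ‖f x‖ ≤ M) (n : ℕ) (x : T3) :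
    ‖conv f (torusKernel n) x‖ ≤ M := by
  rw [conv_eq_integral_translate]
  have h := norm_integral_le_of_norm_le (f := fun y => f (x - y) * torusKernel n y)
    (g := fun y => M * torusKernel n y) (μ := torusMeasure)
    ((integrable_torus (continuous_torusKernel n)).const_mul M) (ae_of_all _ fun y => by
      rw [norm_mul, Real.norm_of_nonneg (torusKernel_nonneg n y)]
      gcongr
      · exact torusKernel_nonneg n y
      · exact hM _)
  rwa [integral_const_mul, integral_torusKernel, mul_one] at h

lemma tendsto_eLpNorm_conv_sub_of_continuous {f : T3 → ℝ} (hf : Continuous f) :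
    Tendsto (fun n => eLpNorm (fun x => conv f (torusKernel n) x - f x) 1 torusMeasure) atTop
      (𝓝 0) := by
  obtain ⟨M, hM⟩ := exists_bound_torus hf
  simp only [eLpNorm_one_eq_lintegral_enorm]
  have h := tendsto_lintegral_norm_of_dominated_convergence (μ := torusMeasure)
    (F := fun n x => conv f (torusKernel n) x) (f := f) (bound := fun _ => M)
    (fun n => (continuous_conv (integrable_torus hf) (by fun_prop)).aestronglyMeasurable)
    (integrable_const M).2 (fun n => ae_of_all _ fun x => abs_conv_torusKernel_le hM n x)
    (ae_of_all _ fun x => tendsto_conv_of_continuous hf x)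
  simpa only [ofReal_norm] using h

lemma conv_sub {f g k : T3 → ℝ} (hf : Integrable f torusMeasure) (hg : Integrable g torusMeasure)
    (hk : Continuous k) (x : T3) : conv (fun y => f y - g y) k x = conv f k x - conv g k x := by
  rw [conv, conv, conv, ← integral_sub (integrable_mul_translate hf hk x)
    (integrable_mul_translate hg hk x)]
  congr 1; ext y; ring

/-- Continuous functions are dense in `L¹`, and convolution with a nonnegative kernel of mass one is
an `L¹` contraction. The lemma serves only to identify the limit of the telescoping series. -/
lemma tendsto_eLpNorm_conv_sub {f : T3 → ℝ} (hf : Integrable f torusMeasure) :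
    Tendsto (fun n => eLpNorm (fun x => conv f (torusKernel n) x - f x) 1 torusMeasure) atTop
      (𝓝 0) := by
  rw [ENNReal.tendsto_nhds_zero]
  intro ε hε
  have hε3 : ε / 3 ≠ 0 := (ENNReal.div_pos hε.ne' (by simp)).ne'
  obtain ⟨g, hg, hgm⟩ := (memLp_one_iff_integrable.2 hf).exists_boundedContinuous_eLpNorm_sub_le
    ENNReal.one_ne_top hε3
  have hgc : Continuous g := g.continuous
  have hgi : Integrable g torusMeasure := integrable_torus hgc
  filter_upwards [ENNReal.tendsto_nhds_zero.1 (tendsto_eLpNorm_conv_sub_of_continuous hgc) (ε / 3)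
    (pos_iff_ne_zero.2 hε3)] with n hn
  have hcf := (continuous_conv hf (continuous_torusKernel n)).aestronglyMeasurable (μ := torusMeasure)
  have hcg := (continuous_conv hgi (continuous_torusKernel n)).aestronglyMeasurable
    (μ := torusMeasure)
  have hgs := hgc.aestronglyMeasurable (μ := torusMeasure)
  have hd : eLpNorm (conv (fun y => f y - g y) (torusKernel n)) 1 torusMeasure ≤ ε / 3 := by
    refine (eLpNorm_conv_one_le (hf.1.sub hgs) (by fun_prop)).trans ?_
    rw [lintegral_enorm_torusKernel, mul_one]
    exact hg
  have e : (fun x => conv f (torusKernel n) x - f x) =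
      (conv (fun y => f y - g y) (torusKernel n) + fun x => conv g (torusKernel n) x - g x)
        - (f - g) := by
    ext x
    simp only [Pi.add_apply, Pi.sub_apply, conv_sub hf hgi (continuous_torusKernel n)]
    ring
  rw [e]
  have hcd := (continuous_conv (hf.sub hgi) (continuous_torusKernel n)).aestronglyMeasurable
    (μ := torusMeasure)
  calc _ ≤ (eLpNorm (conv (fun y => f y - g y) (torusKernel n)) 1 torusMeasure +
        eLpNorm (fun x => conv g (torusKernel n) x - g x) 1 torusMeasure)
        + eLpNorm (f - ⇑g) 1 torusMeasure :=
        (eLpNorm_sub_le (hcd.add (hcg.sub hgs)) (hf.1.sub hgs) le_rfl).trans (by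
          gcongr
          exact eLpNorm_add_le hcd (hcg.sub hgs) le_rfl)
    _ ≤ (ε / 3 + ε / 3) + ε / 3 := by gcongr
    _ = ε := ENNReal.add_thirds ε

end WeakProduct

end

noncomputable section

namespace WeakProduct

/-! ### Uniform approximation in the subcritical Sobolev embedding -/

/-- The constant in the bound for the convolution with `torusPotential i n`. -/
def potentialConst (p s : ℝ≥0∞) (n : ℕ) : ℝ≥0∞ :=
  ENNReal.ofReal (((n + 1 : ℝ) ^ (3 / 2 : ℝ))⁻¹) ^ (1 - 1 / p.toReal + 1 / s.toReal) *
    5 ^ (1 / p.toReal - 1 / s.toReal)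

lemma eLpNorm_conv_torusPotential_le {p s : ℝ≥0∞} (hp : 1 ≤ p) (hps : p ≤ s) (hs : s ≠ ⊤)
    {g : T3 → ℝ} (hg : AEStronglyMeasurable g torusMeasure) (i : Fin 3) (n : ℕ) :
    eLpNorm (conv g (torusPotential i n)) s torusMeasure
      ≤ potentialConst p s n * eLpNorm g p torusMeasure := by
  refine eLpNorm_conv_le hp hps hs hg (by fun_prop) ?_ fun y => ?_
  · have h := ofReal_integral_norm_eq_lintegral_enorm
      (integrable_torus (continuous_torusPotential i n))
    rw [← h]
    exact ENNReal.ofReal_le_ofReal (integral_abs_torusPotential_le i n)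
  · rw [Real.enorm_eq_ofReal_abs]
    have := ENNReal.ofReal_le_ofReal (abs_torusPotential_le i n y)
    simpa using this

/-- The terms are of order `n^{-3γ/2}` with `γ = 1 - 1/p + 1/s`, and `3γ/2 > 1` means `1/p - 1/s <
1/3`. This is where subcriticality enters. -/
lemma tsum_potentialConst_ne_top {p s : ℝ≥0∞} (hp : 1 ≤ p) (hps : p ≤ s) (hs : s ≠ ⊤)
    (h : 1 / p.toReal - 1 / s.toReal < 1 / 3) : ∑' n, potentialConst p s n ≠ ⊤ := by
  set γ := 1 - 1 / p.toReal + 1 / s.toReal with hγ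
  have hγ1 : 2 / 3 < γ := by rw [hγ]; linarith
  have hpt : p ≠ ⊤ := ne_top_of_le_ne_top hs hps
  have hp1 : 1 ≤ p.toReal := by
    rw [← ENNReal.toReal_one]; exact ENNReal.toReal_mono hpt hp
  have h0 : 0 ≤ 1 / p.toReal - 1 / s.toReal := by
    have := one_div_le_one_div_of_le (by linarith : 0 < p.toReal) (ENNReal.toReal_mono hs hps)
    linarith
  simp only [potentialConst, ← hγ]
  rw [ENNReal.tsum_mul_right]
  refine ENNReal.mul_ne_top ?_ (ENNReal.rpow_ne_top_of_nonneg h0 (by simp))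
  have e : ∀ n : ℕ, ENNReal.ofReal (((n + 1 : ℝ) ^ (3 / 2 : ℝ))⁻¹) ^ γ
      = ENNReal.ofReal (1 / ((n + 1 : ℕ) : ℝ) ^ (3 / 2 * γ)) := by
    intro n
    rw [ENNReal.ofReal_rpow_of_nonneg (by positivity) (by linarith), Real.inv_rpow (by positivity),
      ← Real.rpow_mul (by positivity)]
    push_cast
    rw [one_div]
  simp only [e]
  refine Summable.tsum_ofReal_ne_top ?_
  exact (summable_nat_add_iff 1).2 (Real.summable_one_div_nat_rpow.2 (by linarith))

lemma conv_sub_conv_eq_sum {f : T3 → ℝ} {g : Fin 3 → T3 → ℝ} (hf : Integrable f torusMeasure)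
    (hg : IsTorusWeakGrad f g) (N k : ℕ) (x : T3) :
    conv f (torusKernel (N + k)) x - conv f (torusKernel N) x
      = ∑ n ∈ Finset.range k, ∑ i, conv (g i) (torusPotential i (N + n)) x := by
  induction k with
  | zero => simp
  | succ k ih =>
    rw [Finset.sum_range_succ, ← ih, ← conv_succ_sub hf hg]
    ring_nf

lemma eLpNorm_conv_sub_conv_le {p s : ℝ≥0∞} (hp : 1 ≤ p) (hps : p ≤ s) (hs : s ≠ ⊤)
    {f : T3 → ℝ} {g : Fin 3 → T3 → ℝ} (hf : Integrable f torusMeasure)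
    (hgm : ∀ i, MemLp (g i) p torusMeasure) (hg : IsTorusWeakGrad f g) (N k : ℕ) :
    eLpNorm (fun x => conv f (torusKernel (N + k)) x - conv f (torusKernel N) x) s torusMeasure
      ≤ (∑' n, potentialConst p s (n + N)) * ∑ i, eLpNorm (g i) p torusMeasure := by
  have hs1 : 1 ≤ s := hp.trans hps
  have hgi : ∀ i, Integrable (g i) torusMeasure := fun i => (hgm i).integrable hp
  have hc : ∀ i n, AEStronglyMeasurable (conv (g i) (torusPotential i n)) torusMeasure :=
    fun i n => (continuous_conv (hgi i) (by fun_prop)).aestronglyMeasurable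
  have e : (fun x => conv f (torusKernel (N + k)) x - conv f (torusKernel N) x)
      = ∑ n ∈ Finset.range k, ∑ i, conv (g i) (torusPotential i (N + n)) := by
    ext x
    rw [conv_sub_conv_eq_sum hf hg]
    simp
  rw [e]
  calc _ ≤ ∑ n ∈ Finset.range k, eLpNorm (∑ i, conv (g i) (torusPotential i (N + n))) s
          torusMeasure := eLpNorm_sum_le
            (fun n _ => Finset.aestronglyMeasurable_sum _ fun i _ => hc i _) hs1
    _ ≤ ∑ n ∈ Finset.range k, potentialConst p s (n + N) * ∑ i, eLpNorm (g i) p torusMeasure := by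
        refine Finset.sum_le_sum fun n _ => ?_
        refine (eLpNorm_sum_le (fun i _ => hc i _) hs1).trans ?_
        rw [Finset.mul_sum, add_comm n N]
        exact Finset.sum_le_sum fun i _ =>
          eLpNorm_conv_torusPotential_le hp hps hs (hgm i).1 i (N + n)
    _ = (∑ n ∈ Finset.range k, potentialConst p s (n + N)) * ∑ i, eLpNorm (g i) p torusMeasure :=
        (Finset.sum_mul _ _ _).symm
    _ ≤ _ := by
        gcongr
        exact ENNReal.sum_le_tsum _

/-- Functions with a weak gradient in `L^p` are approximated in `L^s`, `s` subcritical, by their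
convolutions with `torusKernel N`, at a uniform rate. -/
theorem eLpNorm_sub_conv_le {p s : ℝ≥0∞} (hp : 1 ≤ p) (hps : p ≤ s) (hs : s ≠ ⊤)
    {f : T3 → ℝ} {g : Fin 3 → T3 → ℝ} (hf : Integrable f torusMeasure)
    (hgm : ∀ i, MemLp (g i) p torusMeasure) (hg : IsTorusWeakGrad f g) (N : ℕ) :
    eLpNorm (fun x => f x - conv f (torusKernel N) x) s torusMeasure
      ≤ (∑' n, potentialConst p s (n + N)) * ∑ i, eLpNorm (g i) p torusMeasure := by
  have hc : ∀ n, AEStronglyMeasurable (conv f (torusKernel n)) torusMeasure :=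
    fun n => (continuous_conv hf (by fun_prop)).aestronglyMeasurable
  -- Convergence in `L¹` gives almost everywhere convergence along a subsequence. Fatou then passes
  -- the bound on the partial sums to the limit, without assuming in advance that `f` is in `L^s`.
  obtain ⟨ns, hns, hlim⟩ := (tendstoInMeasure_of_tendsto_eLpNorm one_ne_zero
    hc hf.1 (tendsto_eLpNorm_conv_sub hf)).exists_seq_tendsto_ae
  have h1 := Lp.eLpNorm_lim_le_liminf_eLpNorm (p := s) (μ := torusMeasure)
    (f := fun j x => conv f (torusKernel (ns j)) x - conv f (torusKernel N) x)
    (fun j => (hc _).sub (hc _)) (fun x => f x - conv f (torusKernel N) x)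
    (hlim.mono fun x hx => hx.sub_const _)
  refine h1.trans (liminf_le_of_frequently_le' (Eventually.frequently ?_))
  filter_upwards [hns.tendsto_atTop.eventually_ge_atTop N] with j hj
  obtain ⟨k, hk⟩ := Nat.exists_eq_add_of_le hj
  rw [hk]
  exact eLpNorm_conv_sub_conv_le hp hps hs hf hgm hg N k

end WeakProduct

end

noncomputable section

namespace WeakProduct

/-! ### Functions of time with an integrable weak derivative -/

variable {T : ℝ}

/-- The primitive of `w` vanishing at time zero. -/
def timePrimitive (T : ℝ) (w : ℝ → ℂ) (t : ℝ) : ℂ := ∫ s in Iic t, w s ∂timeMeasure T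

/-- The integral of `γ` over the remaining time. -/
def timeTail (T : ℝ) (γ : ℝ → ℂ) (s : ℝ) : ℂ := ∫ t in Ici s, γ t ∂timeMeasure T

/-- Fubini on the triangle `{s ≤ t}`: an integration by parts that needs only integrability of both
factors. -/
lemma integral_mul_timePrimitive {γ w : ℝ → ℂ} (hγ : Integrable γ (timeMeasure T))
    (hw : Integrable w (timeMeasure T)) :
    ∫ t, γ t * timePrimitive T w t ∂timeMeasure T
      = ∫ s, w s * timeTail T γ s ∂timeMeasure T := by
  set S : Set (ℝ × ℝ) := {z | z.2 ≤ z.1}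
  have hS : MeasurableSet S := measurableSet_le measurable_snd measurable_fst
  have hinteg : Integrable (Function.uncurry fun t s => S.indicator (fun z => γ z.1 * w z.2) (t, s))
      ((timeMeasure T).prod (timeMeasure T)) := (hγ.mul_prod hw).indicator hS
  have h1 : ∀ t, γ t * timePrimitive T w t
      = ∫ s, S.indicator (fun z => γ z.1 * w z.2) (t, s) ∂timeMeasure T := by
    intro t
    rw [timePrimitive, ← integral_indicator measurableSet_Iic, ← integral_const_mul]
    congr 1; ext s
    by_cases h : s ≤ t
    · rw [indicator_of_mem (show s ∈ Iic t from h), indicator_of_mem (show (t, s) ∈ S from h)]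
    · rw [indicator_of_notMem (show s ∉ Iic t from h),
        indicator_of_notMem (show (t, s) ∉ S from h), mul_zero]
  have h2 : ∀ s, w s * timeTail T γ s
      = ∫ t, S.indicator (fun z => γ z.1 * w z.2) (t, s) ∂timeMeasure T := by
    intro s
    rw [timeTail, ← integral_indicator measurableSet_Ici, ← integral_const_mul]
    congr 1; ext t
    by_cases h : s ≤ t
    · rw [indicator_of_mem (show t ∈ Ici s from h), indicator_of_mem (show (t, s) ∈ S from h),
        mul_comm]
    · rw [indicator_of_notMem (show t ∉ Ici s from h),
        indicator_of_notMem (show (t, s) ∉ S from h), mul_zero]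
  simp only [h1, h2]
  exact integral_integral_swap hinteg

lemma norm_timePrimitive_le {w : ℝ → ℂ} (hw : Integrable w (timeMeasure T)) (t : ℝ) :
    ‖timePrimitive T w t‖ ≤ ∫ s, ‖w s‖ ∂timeMeasure T :=
  (norm_integral_le_integral_norm _).trans
    (setIntegral_le_integral hw.norm (ae_of_all _ fun _ => norm_nonneg _))

lemma aestronglyMeasurable_timePrimitive {w : ℝ → ℂ} (hw : Integrable w (timeMeasure T)) :
    AEStronglyMeasurable (timePrimitive T w) (timeMeasure T) := by
  set S : Set (ℝ × ℝ) := {z | z.2 ≤ z.1}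
  have hS : MeasurableSet S := measurableSet_le measurable_snd measurable_fst
  have hm : AEStronglyMeasurable (S.indicator fun z : ℝ × ℝ => w z.2)
      ((timeMeasure T).prod (timeMeasure T)) := (hw.1.comp_snd).indicator hS
  refine hm.integral_prod_right'.congr (ae_of_all _ fun t => ?_)
  dsimp only
  rw [timePrimitive, ← integral_indicator measurableSet_Iic]
  congr 1

lemma integrable_timePrimitive {w : ℝ → ℂ} (hw : Integrable w (timeMeasure T)) :
    Integrable (timePrimitive T w) (timeMeasure T) :=
  Integrable.of_bound (aestronglyMeasurable_timePrimitive hw) _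
    (ae_of_all _ fun t => norm_timePrimitive_le hw t)

/-- Smooth functions with compact support in `(0, T)`. -/
def IsTimeTest (T : ℝ) (χ : ℝ → ℝ) : Prop :=
  ContDiff ℝ ∞ χ ∧ HasCompactSupport χ ∧ tsupport χ ⊆ Ioo 0 T

lemma IsTimeTest.eq_zero {χ : ℝ → ℝ} (hχ : IsTimeTest T χ) {t : ℝ} (ht : t ∉ Ioo 0 T) :
    χ t = 0 :=
  image_eq_zero_of_notMem_tsupport fun h => ht (hχ.2.2 h)

lemma timeTail_deriv {χ : ℝ → ℝ} (hχ : IsTimeTest T χ) {s : ℝ} (hs : s ∈ Icc 0 T) :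
    timeTail T (fun t => ((deriv χ t : ℝ) : ℂ)) s = -(χ s : ℂ) := by
  have hd : Continuous (deriv χ) := hχ.1.continuous_deriv (by simp)
  have h1 : timeTail T (fun t => ((deriv χ t : ℝ) : ℂ)) s = ∫ t in s..T, ((deriv χ t : ℝ) : ℂ) := by
    rw [timeTail, timeMeasure, Measure.restrict_restrict measurableSet_Ici,
      intervalIntegral.integral_of_le hs.2, ← integral_Icc_eq_integral_Ioc]
    congr 2
    ext t; simp only [mem_inter_iff, mem_Ici, mem_Icc]
    constructor
    · rintro ⟨h1, h2, h3⟩; exact ⟨h1, h3⟩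
    · rintro ⟨h1, h2⟩; exact ⟨h1, hs.1.trans h1, h2⟩
  rw [h1, intervalIntegral.integral_ofReal, intervalIntegral.integral_deriv_eq_sub
    (fun t _ => (hχ.1.differentiable (by simp)).differentiableAt) (hd.intervalIntegrable _ _),
    hχ.eq_zero (t := T) (by simp)]
  push_cast; ring

lemma integrable_time_of_continuous {f : ℝ → ℂ} (hf : Continuous f) :
    Integrable f (timeMeasure T) :=
  show IntegrableOn f (Icc 0 T) volume from hf.continuousOn.integrableOn_compact isCompact_Icc

lemma ae_mem_Icc (T : ℝ) : ∀ᵐ t ∂timeMeasure T, t ∈ Icc 0 T :=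
  ae_restrict_mem measurableSet_Icc

/-- The primitive of a mean-zero combination of test functions is a test function. -/
lemma exists_timeTest_primitive {χ χ₀ : ℝ → ℝ} (hχ : IsTimeTest T χ) (hχ₀ : IsTimeTest T χ₀)
    (h₀ : ∫ t, χ₀ t = 1) :
    ∃ ζ, IsTimeTest T ζ ∧ ∀ t, deriv ζ t = χ t - (∫ u, χ u) * χ₀ t := by
  set f : ℝ → ℝ := fun t => χ t - (∫ u, χ u) * χ₀ t with hf
  have hfs : ContDiff ℝ ∞ f := hχ.1.sub (contDiff_const.mul hχ₀.1)
  have hfc : Continuous f := hfs.continuous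
  have hKc : IsCompact (tsupport χ ∪ tsupport χ₀) := hχ.2.1.isCompact.union hχ₀.2.1.isCompact
  have hne : (tsupport χ ∪ tsupport χ₀).Nonempty := by
    refine Nonempty.inr ?_
    by_contra h
    rw [not_nonempty_iff_eq_empty, tsupport_eq_empty_iff] at h
    simp [h] at h₀
  have hKs : tsupport χ ∪ tsupport χ₀ ⊆ Ioo 0 T := union_subset hχ.2.2 hχ₀.2.2
  set K := tsupport χ ∪ tsupport χ₀
  have ha := hKs (hKc.sInf_mem hne)
  have hb := hKs (hKc.sSup_mem hne)
  have hfz : ∀ t, t ∉ Icc (sInf K) (sSup K) → f t = 0 := by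
    intro t ht
    have hK : t ∉ K := fun h => ht ⟨csInf_le hKc.bddBelow h, le_csSup hKc.bddAbove h⟩
    simp only [K, mem_union, not_or] at hK
    simp [hf, image_eq_zero_of_notMem_tsupport hK.1, image_eq_zero_of_notMem_tsupport hK.2]
  have hfint : Integrable f := (hχ.1.continuous.integrable_of_hasCompactSupport hχ.2.1).sub
    ((hχ₀.1.continuous.integrable_of_hasCompactSupport hχ₀.2.1).const_mul _)
  have hf0 : ∫ t, f t = 0 := by
    simp only [hf]
    rw [integral_sub (hχ.1.continuous.integrable_of_hasCompactSupport hχ.2.1)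
      ((hχ₀.1.continuous.integrable_of_hasCompactSupport hχ₀.2.1).const_mul _),
      integral_const_mul, h₀]
    ring
  have hderiv : ∀ t, HasDerivAt (fun t => ∫ u in (0 : ℝ)..t, f u) (f t) t := fun t =>
    intervalIntegral.integral_hasDerivAt_right (hfc.intervalIntegrable _ _)
      (hfc.stronglyMeasurableAtFilter _ _) hfc.continuousAt
  have hderiv' : deriv (fun t => ∫ u in (0 : ℝ)..t, f u) = f := funext fun t => (hderiv t).deriv
  -- Before the supports nothing has been integrated; beyond them the primitive equals the full
  -- integral, which vanishes.
  have hz : ∀ t, t ∉ Icc (sInf K) (sSup K) → ∫ u in (0 : ℝ)..t, f u = 0 := by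
    intro t ht
    rw [mem_Icc, not_and_or, not_le, not_le] at ht
    rcases ht with ht | ht
    · rw [intervalIntegral.integral_congr (g := fun _ => (0 : ℝ)), intervalIntegral.integral_zero]
      intro u hu
      refine hfz u fun h => ?_
      have := hu.2
      rcases le_max_iff.1 this with h1 | h1
      · linarith [ha.1, h.1]
      · linarith [h.1]
    · have h1 : ∫ u in (0 : ℝ)..t, f u = ∫ u, f u := by
        rw [intervalIntegral.integral_of_le (by linarith [hb.1]), ← integral_indicator
          measurableSet_Ioc]
        congr 1; ext u
        by_cases hu : u ∈ Ioc 0 t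
        · rw [indicator_of_mem hu]
        · rw [indicator_of_notMem hu, hfz u]
          intro h
          exact hu ⟨lt_of_lt_of_le ha.1 h.1, h.2.trans ht.le⟩
      rw [h1, hf0]
  have hsub : tsupport (fun t => ∫ u in (0 : ℝ)..t, f u) ⊆ Icc (sInf K) (sSup K) := by
    refine closure_minimal (fun t ht => ?_) isClosed_Icc
    by_contra h
    exact ht (hz t h)
  refine ⟨fun t => ∫ u in (0 : ℝ)..t, f u, ⟨?_, ?_, ?_⟩, fun t => (hderiv t).deriv⟩
  · rw [contDiff_infty_iff_deriv, hderiv']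
    exact ⟨fun t => (hderiv t).differentiableAt, hfs⟩
  · exact HasCompactSupport.of_support_subset_isCompact isCompact_Icc
      (subset_closure.trans hsub)
  · exact hsub.trans fun t ht => ⟨lt_of_lt_of_le ha.1 ht.1, lt_of_le_of_lt ht.2 hb.2⟩

lemma exists_timeTest (hT : 0 < T) : ∃ χ, IsTimeTest T χ ∧ ∫ t, χ t = 1 := by
  let B : ContDiffBump (T / 2) := ⟨T / 8, T / 4, by positivity, by linarith⟩
  refine ⟨B.normed volume, ⟨B.contDiff_normed, B.hasCompactSupport_normed, ?_⟩,
    B.integral_normed⟩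
  rw [B.tsupport_normed_eq, Real.closedBall_eq_Icc]
  intro t ht
  have h1 : T / 2 - T / 4 ≤ t := ht.1
  have h2 : t ≤ T / 2 + T / 4 := ht.2
  constructor <;> linarith

/-- A function of time with integrable weak derivative `w` is a constant plus the primitive of
`w`. -/
theorem ae_eq_const_add_timePrimitive (hT : 0 < T) {β w : ℝ → ℂ}
    (hβ : Integrable β (timeMeasure T)) (hw : Integrable w (timeMeasure T))
    (h : ∀ χ, IsTimeTest T χ →
      ∫ t, β t * ((deriv χ t : ℝ) : ℂ) ∂timeMeasure T = -∫ t, w t * (χ t : ℂ) ∂timeMeasure T) :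
    ∃ c : ℂ, ∀ᵐ t ∂timeMeasure T, β t = c + timePrimitive T w t := by
  set k : ℝ → ℂ := fun t => β t - timePrimitive T w t with hk
  have hki : Integrable k (timeMeasure T) := hβ.sub (integrable_timePrimitive hw)
  have hmul : ∀ {f : ℝ → ℂ} {χ : ℝ → ℝ}, Integrable f (timeMeasure T) → Continuous χ →
      Integrable (fun t => f t * (χ t : ℂ)) (timeMeasure T) := by
    intro f χ hf hχ
    obtain ⟨M, hM⟩ := isCompact_Icc.exists_bound_of_continuousOn (s := Icc 0 T) hχ.continuousOn
    refine hf.mul_bdd (c := M) (by fun_prop) ?_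
    filter_upwards [ae_mem_Icc T] with t ht
    simpa using hM t ht
  -- The function `k` has zero weak derivative, because the primitive already carries the derivative
  -- `w`.
  have hk0 : ∀ χ, IsTimeTest T χ → ∫ t, k t * ((deriv χ t : ℝ) : ℂ) ∂timeMeasure T = 0 := by
    intro χ hχ
    have hd : Continuous (deriv χ) := hχ.1.continuous_deriv (by simp)
    simp only [hk, sub_mul]
    rw [integral_sub (hmul hβ hd) (hmul (integrable_timePrimitive hw) hd), h χ hχ]
    have h1 := integral_mul_timePrimitive (T := T) (γ := fun t => ((deriv χ t : ℝ) : ℂ)) (w := w)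
      (integrable_time_of_continuous (by fun_prop)) hw
    simp only [mul_comm (timePrimitive T w _)]
    rw [h1, sub_eq_zero, ← integral_neg]
    refine integral_congr_ae ?_
    filter_upwards [ae_mem_Icc T] with s hs
    rw [timeTail_deriv hχ hs]; ring
  obtain ⟨χ₀, hχ₀, hχ₀1⟩ := exists_timeTest hT
  -- Du Bois-Reymond: since `χ₀` has mean one, subtracting `(∫ χ) χ₀` from `χ` leaves the derivative
  -- of a test function, which `k` does not see. Hence `k` acts on test functions as this constant.
  set c : ℂ := ∫ t, k t * (χ₀ t : ℂ) ∂timeMeasure T with hc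
  have hkey : ∀ χ, IsTimeTest T χ → ∫ t, (k t - c) * (χ t : ℂ) ∂timeMeasure T = 0 := by
    intro χ hχ
    obtain ⟨ζ, hζ, hζd⟩ := exists_timeTest_primitive hχ hχ₀ hχ₀1
    have h1 := hk0 ζ hζ
    have e : ∀ t, k t * ((deriv ζ t : ℝ) : ℂ)
        = k t * (χ t : ℂ) - (∫ u, χ u : ℝ) * (k t * (χ₀ t : ℂ)) := by
      intro t; rw [hζd]; push_cast; ring
    simp only [e] at h1
    rw [integral_sub (hmul hki hχ.1.continuous) ((hmul hki hχ₀.1.continuous).const_mul _),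
      integral_const_mul, ← hc] at h1
    have h2 : ∫ t, (χ t : ℂ) ∂timeMeasure T = (∫ u, χ u : ℝ) := by
      rw [integral_complex_ofReal, timeMeasure, ← integral_indicator measurableSet_Icc]
      congr 2; ext t
      by_cases ht : t ∈ Icc 0 T
      · rw [indicator_of_mem ht]
      · rw [indicator_of_notMem ht, hχ.eq_zero fun h => ht (Ioo_subset_Icc_self h)]
    simp only [sub_mul]
    rw [integral_sub (hmul hki hχ.1.continuous) (hmul (integrable_const c) hχ.1.continuous),
      integral_const_mul, h2, mul_comm c]
    exact h1
  refine ⟨c, ?_⟩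
  have hloc : LocallyIntegrableOn (fun t => k t - c) (Ioo 0 T) volume := by
    have : IntegrableOn (fun t => k t - c) (Icc 0 T) volume := hki.sub (integrable_const c)
    exact (this.mono_set Ioo_subset_Icc_self).locallyIntegrableOn
  have hae := isOpen_Ioo.ae_eq_zero_of_integral_contDiff_smul_eq_zero hloc (fun χ h1 h2 h3 => by
    have hχ : IsTimeTest T χ := ⟨h1, h2, h3⟩
    rw [← hkey χ hχ, timeMeasure, ← integral_indicator measurableSet_Icc]
    congr 1; ext t
    by_cases ht : t ∈ Icc 0 T
    · rw [indicator_of_mem ht, Complex.real_smul, mul_comm]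
    · rw [indicator_of_notMem ht, hχ.eq_zero fun h => ht (Ioo_subset_Icc_self h), zero_smul])
  have hae' : ∀ᵐ t ∂volume.restrict (Ioo 0 T), k t - c = 0 :=
    (ae_restrict_iff' measurableSet_Ioo).2 hae
  rw [timeMeasure, ← restrict_Ioo_eq_restrict_Icc]
  filter_upwards [hae'] with t ht
  simp only [hk] at ht
  linear_combination ht

/-! ### Compensated compactness in time -/

/-- Hölder on the interval between the two times. The Hölder modulus depends only on the `L^r`
bound, and its exponent is positive because `r > 1`; for `r = ∞` the convention `1 / 0 = 0` gives
the Lipschitz exponent `1`. -/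
lemma norm_timeTail_sub_le {r : ℝ≥0∞} (hr : 1 < r) {γ : ℝ → ℂ}
    (hγ : Integrable γ (timeMeasure T)) {C : ℝ≥0} (hC : eLpNorm γ r (timeMeasure T) ≤ C)
    {s s' : ℝ} (hss : s ≤ s') :
    ‖timeTail T γ s - timeTail T γ s'‖ ≤ C * (s' - s) ^ (1 - 1 / r.toReal) := by
  have hexp : 0 ≤ 1 - 1 / r.toReal := by
    rcases eq_or_ne r ⊤ with rfl | hrt
    · simp
    · have h1 : 1 ≤ r.toReal := by
        rw [← ENNReal.toReal_one]; exact ENNReal.toReal_mono hrt hr.le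
      rw [sub_nonneg, div_le_one (by linarith)]; exact h1
  have e : timeTail T γ s - timeTail T γ s' = ∫ t in Ico s s', γ t ∂timeMeasure T := by
    rw [timeTail, timeTail, ← Ico_union_Ici_eq_Ici hss, setIntegral_union _ measurableSet_Ici
      hγ.integrableOn hγ.integrableOn, add_sub_cancel_right]
    exact disjoint_left.2 fun t ht h => absurd ht.2 (not_lt.2 h)
  rw [e, ← toReal_enorm]
  have h0 : 0 ≤ (s' - s) ^ (1 - 1 / r.toReal) := Real.rpow_nonneg (by linarith) _
  refine ENNReal.toReal_le_of_le_ofReal (by positivity) ?_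
  refine (enorm_integral_le_lintegral_enorm _).trans ?_
  rw [← eLpNorm_one_eq_lintegral_enorm]
  refine (eLpNorm_le_eLpNorm_mul_rpow_measure_univ hr.le hγ.1.restrict).trans ?_
  rw [ENNReal.ofReal_mul (by positivity), ENNReal.ofReal_coe_nnreal]
  gcongr
  · exact (eLpNorm_mono_measure _ Measure.restrict_le_self).trans hC
  · rw [← ENNReal.ofReal_rpow_of_nonneg (by linarith) hexp, ENNReal.toReal_one, div_one]
    gcongr
    rw [Measure.restrict_apply_univ, timeMeasure, ← Real.volume_Ico]
    exact Measure.restrict_apply_le _ _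

/-- Pointwise convergence on a finite net of `[0, T]`, together with the common Hölder modulus,
gives uniform convergence. -/
lemma eventually_norm_timeTail_le {r : ℝ≥0∞} (hr : 1 < r) {γ : ℕ → ℝ → ℂ}
    (hγ : ∀ n, Integrable (γ n) (timeMeasure T)) {C : ℝ≥0}
    (hC : ∀ n, eLpNorm (γ n) r (timeMeasure T) ≤ C)
    (hlim : ∀ s, Tendsto (fun n => timeTail T (γ n) s) atTop (𝓝 0)) {η : ℝ} (hη : 0 < η) :
    ∀ᶠ n in atTop, ∀ s ∈ Icc 0 T, ‖timeTail T (γ n) s‖ ≤ η := by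
  have hexp : 0 < 1 - 1 / r.toReal := by
    rcases eq_or_ne r ⊤ with rfl | hrt
    · simp
    · have h1 : 1 < r.toReal := by
        rw [← ENNReal.toReal_one, ENNReal.toReal_lt_toReal ENNReal.one_ne_top hrt]; exact hr
      rw [sub_pos, div_lt_one (by linarith)]; exact h1
  obtain ⟨δ, hδ, hδη⟩ : ∃ δ > 0, ∀ x ∈ Icc 0 δ, (C : ℝ) * x ^ (1 - 1 / r.toReal) ≤ η / 2 := by
    have hcont : ContinuousAt (fun x : ℝ => (C : ℝ) * x ^ (1 - 1 / r.toReal)) 0 :=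
      continuousAt_const.mul (Real.continuousAt_rpow_const _ _ (Or.inr hexp.le))
    have h0 : (C : ℝ) * (0 : ℝ) ^ (1 - 1 / r.toReal) < η / 2 := by
      rw [Real.zero_rpow hexp.ne']; simpa using hη
    obtain ⟨δ, hδ, h⟩ := Metric.eventually_nhds_iff.1 (hcont.eventually_lt_const h0)
    refine ⟨δ / 2, by positivity, fun x hx => (h ?_).le⟩
    rw [Real.dist_eq, sub_zero, abs_of_nonneg hx.1]
    linarith [hx.2]
  obtain ⟨t, -, htf, ht⟩ := finite_cover_balls_of_compact (isCompact_Icc (a := 0) (b := T)) hδ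
  have h1 : ∀ᶠ n in atTop, ∀ x ∈ t, ‖timeTail T (γ n) x‖ ≤ η / 2 := by
    rw [htf.eventually_all]
    intro x _
    have := (hlim x).norm
    rw [norm_zero] at this
    exact this.eventually_le_const (by positivity)
  filter_upwards [h1] with n hn s hs
  obtain ⟨x, hx, hxs⟩ := mem_iUnion₂.1 (ht hs)
  rw [Metric.mem_ball, Real.dist_eq] at hxs
  have hdiff : ‖timeTail T (γ n) s - timeTail T (γ n) x‖ ≤ η / 2 := by
    rcases le_total s x with h | h
    · refine (norm_timeTail_sub_le hr (hγ n) (hC n) h).trans (hδη _ ⟨by linarith, ?_⟩)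
      rw [abs_lt] at hxs; linarith
    · rw [norm_sub_rev]
      refine (norm_timeTail_sub_le hr (hγ n) (hC n) h).trans (hδη _ ⟨by linarith, ?_⟩)
      rw [abs_lt] at hxs; linarith
  calc ‖timeTail T (γ n) s‖ = ‖(timeTail T (γ n) s - timeTail T (γ n) x)
        + timeTail T (γ n) x‖ := by rw [sub_add_cancel]
    _ ≤ η / 2 + η / 2 := (norm_add_le _ _).trans (add_le_add hdiff (hn x hx))
    _ = η := add_halves η

/-- If `γ_n` is bounded in `L^r(0, T)`, `r > 1`, and converges weakly to zero, and `β_n` is bounded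
in `W^{1,1}(0, T)`, then `∫ γ_n β_n → 0`. -/
theorem tendsto_integral_mul_zero (hT : 0 < T) {r : ℝ≥0∞} (hr : 1 < r) {γ β w : ℕ → ℝ → ℂ}
    (hγ : ∀ n, Integrable (γ n) (timeMeasure T)) {C : ℝ≥0}
    (hC : ∀ n, eLpNorm (γ n) r (timeMeasure T) ≤ C)
    (hlim : ∀ s, Tendsto (fun n => timeTail T (γ n) s) atTop (𝓝 0))
    (hβ : ∀ n, Integrable (β n) (timeMeasure T)) (hw : ∀ n, Integrable (w n) (timeMeasure T))
    (hβw : ∀ n χ, IsTimeTest T χ → ∫ t, β n t * ((deriv χ t : ℝ) : ℂ) ∂timeMeasure T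
      = -∫ t, w n t * (χ t : ℂ) ∂timeMeasure T)
    {M : ℝ} (hM : ∀ n, ∫ t, ‖β n t‖ ∂timeMeasure T ≤ M)
    (hM' : ∀ n, ∫ t, ‖w n t‖ ∂timeMeasure T ≤ M) :
    Tendsto (fun n => ∫ t, γ n t * β n t ∂timeMeasure T) atTop (𝓝 0) := by
  choose c hc using fun n => ae_eq_const_add_timePrimitive hT (hβ n) (hw n) (hβw n)
  have hvol : (timeMeasure T).real univ = T := by
    rw [timeMeasure, measureReal_restrict_apply_univ, Real.volume_real_Icc_of_le hT.le, sub_zero]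
  have hM0 : 0 ≤ M := (integral_nonneg fun t => norm_nonneg _).trans (hM 0)
  -- Averaging `c = β - primitive` over `[0, T]` bounds the constant by the `L¹` norms of `β` and
  -- `w`.
  have hcb : ∀ n, ‖c n‖ ≤ M / T + M := by
    intro n
    have h1 : ∫ t, ‖c n‖ ∂timeMeasure T ≤ ∫ t, (‖β n t‖ + M) ∂timeMeasure T := by
      refine integral_mono_ae (integrable_const _) ((hβ n).norm.add (integrable_const _)) ?_
      filter_upwards [hc n] with t ht
      have e : c n = β n t - timePrimitive T (w n) t := by rw [ht]; ring
      rw [e]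
      refine (norm_sub_le _ _).trans ?_
      gcongr
      exact (norm_timePrimitive_le (hw n) t).trans (hM' n)
    rw [integral_add (hβ n).norm (integrable_const _), integral_const, integral_const, hvol,
      smul_eq_mul, smul_eq_mul] at h1
    have h2 : T * ‖c n‖ ≤ T * (M / T + M) := by
      have : T * (M / T + M) = M + T * M := by field_simp
      rw [this]
      linarith [hM n]
    exact le_of_mul_le_mul_left h2 hT
  -- With `β` replaced by a constant plus a primitive, Fubini leaves only tails of `γ`. These go to
  -- zero uniformly, so the `L¹` bound on `w` suffices.
  have hid : ∀ n, ∫ t, γ n t * β n t ∂timeMeasure T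
      = timeTail T (γ n) 0 * c n + ∫ s, w n s * timeTail T (γ n) s ∂timeMeasure T := by
    intro n
    rw [← integral_mul_timePrimitive (hγ n) (hw n)]
    have h0 : timeTail T (γ n) 0 = ∫ t, γ n t ∂timeMeasure T := by
      rw [timeTail, timeMeasure, Measure.restrict_restrict measurableSet_Ici]
      congr 2
      exact inter_eq_right.2 fun t ht => ht.1
    rw [h0, ← integral_mul_const, ← integral_add ((hγ n).mul_const _)]
    · refine integral_congr_ae ?_
      filter_upwards [hc n] with t ht
      rw [ht]; ring
    · exact (hγ n).mul_bdd (aestronglyMeasurable_timePrimitive (hw n))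
        (ae_of_all _ fun t => norm_timePrimitive_le (hw n) t)
  rw [Metric.tendsto_atTop']
  intro ε hε
  have hden : 0 < M / T + M + M + 1 := by positivity
  obtain ⟨N, hN⟩ := eventually_atTop.1
    (eventually_norm_timeTail_le hr hγ hC hlim (η := ε / (M / T + M + M + 1)) (by positivity))
  refine ⟨N, fun n hn => ?_⟩
  have hη := hN n hn.le
  set η := ε / (M / T + M + M + 1) with hηdef
  have hη0 : 0 < η := by positivity
  rw [dist_zero_right, hid]
  have h1 : ‖timeTail T (γ n) 0 * c n‖ ≤ η * (M / T + M) := by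
    rw [norm_mul]
    gcongr
    · exact hη 0 ⟨le_rfl, hT.le⟩
    · exact hcb n
  have h2 : ‖∫ s, w n s * timeTail T (γ n) s ∂timeMeasure T‖ ≤ η * M := by
    have := norm_integral_le_of_norm_le (f := fun s => w n s * timeTail T (γ n) s)
      (g := fun s => η * ‖w n s‖) ((hw n).norm.const_mul η) (by
        filter_upwards [ae_mem_Icc T] with s hs
        rw [norm_mul, mul_comm]
        gcongr
        exact hη s hs)
    refine this.trans ?_
    rw [integral_const_mul]
    gcongr
    exact hM' n
  calc _ ≤ η * (M / T + M) + η * M := (norm_add_le _ _).trans (add_le_add h1 h2)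
    _ < η * (M / T + M + M + 1) := by nlinarith
    _ = ε := by rw [hηdef]; field_simp

end WeakProduct

end

noncomputable section

namespace WeakProduct

/-! ### Fourier modes of the weak time derivative -/

open UnitAddTorus (mFourier mFourierCoeff)

lemma mFourierCoeff_eq (f : T3 → ℂ) (n : Fin 3 → ℤ) :
    mFourierCoeff f n = ∫ x, mFourier (-n) x * f x ∂torusMeasure := rfl

lemma integral_mFourier (n : Fin 3 → ℤ) :
    ∫ x, mFourier n x ∂torusMeasure = if n = 0 then 1 else 0 := by
  have h := (orthonormal_iff_ite.1 (UnitAddTorus.orthonormal_mFourier (d := Fin 3))) 0 n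
  simp only [ContinuousMap.inner_toLp, ← UnitAddTorus.mFourier_neg, ← UnitAddTorus.mFourier_add]
    at h
  simp only [neg_zero, add_zero, eq_comm (a := (0 : Fin 3 → ℤ))] at h
  exact h

lemma integrable_mFourier (n : Fin 3 → ℤ) : Integrable (fun x => mFourier n x) torusMeasure :=
  (mFourier n).continuous.integrable_of_hasCompactSupport (HasCompactSupport.of_compactSpace _)

lemma norm_mFourier_le (n : Fin 3 → ℤ) (x : T3) : ‖mFourier n x‖ ≤ 1 := by
  have := (mFourier n).norm_coe_le_norm x
  rwa [UnitAddTorus.mFourier_norm] at this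

lemma mFourierCoeff_mFourier (k j : Fin 3 → ℤ) :
    ∫ x, mFourier (-(-j)) x * mFourier k x ∂torusMeasure = if j = -k then 1 else 0 := by
  simp only [← UnitAddTorus.mFourier_add, neg_neg]
  rw [integral_mFourier]
  simp only [add_eq_zero_iff_eq_neg]

/-- Orthogonality of the characters leaves two terms. The pairing is bilinear without conjugation,
so `e_k` picks the coefficient at `-k`. Real and imaginary parts of characters have this form. -/
lemma torusPairing_of_eq {c : (Fin 3 → ℤ) → ℂ} {φ : T3 → ℝ} {A B : ℂ} {k : Fin 3 → ℤ}
    (hφ : ∀ x, (φ x : ℂ) = A * mFourier k x + B * mFourier (-k) x) :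
    torusPairing c φ = A * c (-k) + B * c k := by
  have h1 : ∀ j, c j * mFourierCoeff (fun x => (φ x : ℂ)) (-j)
      = (if j = -k then A * c (-k) else 0) + (if j = k then B * c k else 0) := by
    intro j
    rw [mFourierCoeff_eq]
    simp only [hφ, mul_add]
    have hi : ∀ (a : ℂ) l, Integrable (fun x => mFourier (-(-j)) x * (a * mFourier l x))
        torusMeasure := by
      intro a l
      have e : ∀ x, mFourier (-(-j)) x * (a * mFourier l x) = a * mFourier (-(-j) + l) x := by
        intro x; rw [UnitAddTorus.mFourier_add]; ring
      simp only [e]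
      exact (integrable_mFourier _).const_mul a
    rw [integral_add (hi _ _) (hi _ _)]
    simp only [mul_left_comm _ A, mul_left_comm _ B]
    rw [integral_const_mul, integral_const_mul, mFourierCoeff_mFourier, mFourierCoeff_mFourier,
      neg_neg, mul_add]
    congr 1
    · split_ifs with h
      · rw [h]; ring
      · ring
    · split_ifs with h
      · rw [h]; ring
      · ring
  simp only [torusPairing, h1]
  rw [Summable.tsum_add, tsum_ite_eq, tsum_ite_eq]
  · exact (hasSum_ite_eq _ _).summable
  · exact (hasSum_ite_eq _ _).summable

lemma contDiff_mFourier_lift (k : Fin 3 → ℤ) :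
    ContDiff ℝ ∞ fun y : Fin 3 → ℝ => mFourier k fun i => (y i : UnitAddCircle) := by
  have e : (fun y : Fin 3 → ℝ => mFourier k fun i => (y i : UnitAddCircle))
      = fun y => ∏ i, Complex.exp (2 * Real.pi * Complex.I * k i * (y i : ℂ)) := by
    ext y
    simp only [mFourier, ContinuousMap.coe_mk, fourier_coe_apply, Complex.ofReal_one, div_one]
  rw [e]
  refine contDiff_prod fun i _ => ?_
  refine ContDiff.cexp (contDiff_const.mul ?_)
  exact Complex.ofRealCLM.contDiff.comp (contDiff_apply ℝ ℝ i)

lemma isTestFunction_mul {T : ℝ} {χ : ℝ → ℝ} (hχ : IsTimeTest T χ) {φ : T3 → ℝ}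
    (hφ : SmoothTorus φ) : IsTestFunction T fun z => χ z.1 * φ z.2 := by
  have hsub : tsupport (fun z : ℝ × T3 => χ z.1 * φ z.2) ⊆ tsupport χ ×ˢ univ := by
    refine closure_minimal (fun z hz => ⟨subset_closure ?_, mem_univ _⟩)
      ((isClosed_tsupport χ).prod isClosed_univ)
    intro h
    exact hz (by simp [h])
  refine ⟨?_, ?_, ?_⟩
  · exact (hχ.1.comp contDiff_fst).mul (ContDiff.comp
      (g := fun y : Fin 3 → ℝ => φ fun i => (y i : UnitAddCircle)) hφ contDiff_snd)
  · exact HasCompactSupport.of_support_subset_isCompact (hχ.2.1.isCompact.prod isCompact_univ)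
      (subset_closure.trans hsub)
  · exact hsub.trans (prod_mono hχ.2.2 subset_rfl)

/-- The `k`-th Fourier mode of a function, as a function of time. -/
def timeMode (b : ℝ × T3 → ℝ) (k : Fin 3 → ℤ) (t : ℝ) : ℂ :=
  ∫ x, (b (t, x) : ℂ) * mFourier k x ∂torusMeasure

lemma integrable_mul_mFourier {T : ℝ} {b : ℝ × T3 → ℝ} (hb : Integrable b (stMeasure T))
    (k : Fin 3 → ℤ) : Integrable (fun z => (b z : ℂ) * mFourier k z.2) (stMeasure T) :=
  hb.ofReal.mul_bdd (c := 1) (by fun_prop) (ae_of_all _ fun z => norm_mFourier_le k z.2)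

lemma integrable_timeMode {T : ℝ} {b : ℝ × T3 → ℝ} (hb : Integrable b (stMeasure T))
    (k : Fin 3 → ℤ) : Integrable (timeMode b k) (timeMeasure T) :=
  (integrable_mul_mFourier hb k).integral_prod_left

lemma integral_norm_timeMode_le {T : ℝ} {b : ℝ × T3 → ℝ} (hb : Integrable b (stMeasure T))
    (k : Fin 3 → ℤ) : ∫ t, ‖timeMode b k t‖ ∂timeMeasure T ≤ ∫ z, ‖b z‖ ∂stMeasure T := by
  have e : ∫ z, ‖b z‖ ∂stMeasure T = ∫ t, ∫ x, ‖b (t, x)‖ ∂torusMeasure ∂timeMeasure T :=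
    integral_prod _ hb.norm
  rw [e]
  refine integral_mono_ae (integrable_timeMode hb k).norm hb.norm.integral_prod_left ?_
  filter_upwards [hb.prod_right_ae] with t ht
  refine norm_integral_le_of_norm_le ht.norm (ae_of_all _ fun x => ?_)
  rw [norm_mul, Complex.norm_real]
  exact mul_le_of_le_one_right (norm_nonneg _) (norm_mFourier_le k x)

/-- Admissible test functions are real, so `χ Re e_k` and `χ Im e_k` are used separately and
recombined. The mode is an integral against `e_k` itself, that is, the Fourier coefficient at `-k`;
hence the index on the right. -/
lemma integral_timeMode_mul_deriv {T : ℝ} {b : ℝ × T3 → ℝ} (hb : Integrable b (stMeasure T))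
    {w : ℝ → (Fin 3 → ℤ) → ℂ} (hw : ∀ k, Integrable (fun t => w t k) (timeMeasure T))
    (h : IsWeakTimeDeriv T b w) (k : Fin 3 → ℤ) {χ : ℝ → ℝ} (hχ : IsTimeTest T χ) :
    ∫ t, timeMode b k t * ((deriv χ t : ℝ) : ℂ) ∂timeMeasure T
      = -∫ t, w t (-k) * (χ t : ℂ) ∂timeMeasure T := by
  have hd : Continuous (deriv χ) := hχ.1.continuous_deriv (by simp)
  obtain ⟨M, hM⟩ : ∃ M, ∀ t, ‖deriv χ t‖ ≤ M :=
    (hχ.2.1.deriv).exists_bound_of_continuous hd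
  obtain ⟨M', hM'⟩ : ∃ M, ∀ t, ‖χ t‖ ≤ M := hχ.2.1.exists_bound_of_continuous hχ.1.continuous
  have hre : SmoothTorus fun x => (mFourier k x).re :=
    Complex.reCLM.contDiff.comp (contDiff_mFourier_lift k)
  have him : SmoothTorus fun x => (mFourier k x).im :=
    Complex.imCLM.contDiff.comp (contDiff_mFourier_lift k)
  have h1 := h _ (isTestFunction_mul hχ hre)
  have h2 := h _ (isTestFunction_mul hχ him)
  have hpr : ∀ t, torusPairing (w t) (fun x => χ t * (mFourier k x).re)
      = (χ t / 2) * w t (-k) + (χ t / 2) * w t k := by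
    intro t
    refine torusPairing_of_eq fun x => ?_
    rw [UnitAddTorus.mFourier_neg, Complex.ofReal_mul, Complex.re_eq_add_conj]
    ring
  have hpi : ∀ t, torusPairing (w t) (fun x => χ t * (mFourier k x).im)
      = (χ t / (2 * Complex.I)) * w t (-k) + (-(χ t / (2 * Complex.I))) * w t k := by
    intro t
    refine torusPairing_of_eq fun x => ?_
    rw [UnitAddTorus.mFourier_neg, Complex.ofReal_mul, Complex.im_eq_sub_conj]
    ring
  simp only [hpr, deriv_mul_const_field] at h1
  simp only [hpi, deriv_mul_const_field] at h2
  have hbi : ∀ {ψ : T3 → ℝ}, Continuous ψ → (∀ x, ‖ψ x‖ ≤ 1) →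
      Integrable (fun z => b z * (deriv χ z.1 * ψ z.2)) (stMeasure T) := by
    intro ψ hψ hψ1
    refine hb.mul_bdd (c := M * 1) (by fun_prop) (ae_of_all _ fun z => ?_)
    rw [norm_mul]
    gcongr
    · exact (norm_nonneg _).trans (hM 0)
    · exact hM _
    · exact hψ1 _
  have hbr := hbi (ψ := fun x => (mFourier k x).re) (by fun_prop)
    fun x => (Complex.abs_re_le_norm _).trans (norm_mFourier_le k x)
  have hbm := hbi (ψ := fun x => (mFourier k x).im) (by fun_prop)
    fun x => (Complex.abs_im_le_norm _).trans (norm_mFourier_le k x)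
  have hwχ : ∀ l, Integrable (fun t => w t l * (χ t : ℂ)) (timeMeasure T) := by
    intro l
    refine (hw l).mul_bdd (c := M') ?_ (ae_of_all _ fun t => by simpa using hM' t)
    exact (Complex.continuous_ofReal.comp hχ.1.continuous).aestronglyMeasurable
  have hL : ∫ t, timeMode b k t * ((deriv χ t : ℝ) : ℂ) ∂timeMeasure T
      = ((∫ z, b z * (deriv χ z.1 * (mFourier k z.2).re) ∂stMeasure T : ℝ) : ℂ)
        + Complex.I * ((∫ z, b z * (deriv χ z.1 * (mFourier k z.2).im) ∂stMeasure T : ℝ) : ℂ) := by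
    rw [← integral_complex_ofReal, ← integral_complex_ofReal, ← integral_const_mul,
      ← integral_add hbr.ofReal (hbm.ofReal.const_mul _)]
    have e : ∀ z : ℝ × T3, ((b z * (deriv χ z.1 * (mFourier k z.2).re) : ℝ) : ℂ)
        + Complex.I * ((b z * (deriv χ z.1 * (mFourier k z.2).im) : ℝ) : ℂ)
        = (b z : ℂ) * mFourier k z.2 * ((deriv χ z.1 : ℝ) : ℂ) := by
      intro z
      nth_rw 3 [← Complex.re_add_im (mFourier k z.2)]
      push_cast; ring
    simp only [e]
    have hi : Integrable (fun z => (b z : ℂ) * mFourier k z.2 * ((deriv χ z.1 : ℝ) : ℂ))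
        (stMeasure T) :=
      (integrable_mul_mFourier hb k).mul_bdd (c := M) (by fun_prop)
        (ae_of_all _ fun z => by simpa using hM z.1)
    have hprod := integral_prod _ hi
    refine Eq.trans ?_ hprod.symm
    congr 1; ext t
    dsimp only
    rw [integral_mul_const]
    rfl
  rw [hL, h1, h2, ← integral_neg, ← integral_neg, ← integral_const_mul, ← integral_add]
  · rw [← integral_neg]
    congr 1; ext t
    field_simp
    ring
  · have := ((hwχ (-k)).add (hwχ k)).const_mul (-(1 / 2))
    refine this.congr (ae_of_all _ fun t => ?_)
    simp only [Pi.add_apply]; ring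
  · have := ((hwχ (-k)).sub (hwχ k)).const_mul (-(1 / 2))
    refine this.congr (ae_of_all _ fun t => ?_)
    simp only [Pi.sub_apply]; field_simp; ring

/-- A single coefficient is one term of the Sobolev sum. Its weight is a positive constant depending
on `k` and `σ` only, so a Sobolev norm of any order controls each mode. -/
lemma lintegral_mode_le {T : ℝ} {σ : ℤ} {w : ℝ → (Fin 3 → ℤ) → ℂ} {C : ℝ≥0}
    (hC : ∫⁻ t, sobolevNorm σ (w t) ∂timeMeasure T ≤ C) (k : Fin 3 → ℤ) :
    ∫⁻ t, ‖w t k‖ₑ ∂timeMeasure T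
      ≤ (ENNReal.ofReal ((1 + ∑ i, (k i : ℝ) ^ 2) ^ σ) ^ (1 / 2 : ℝ))⁻¹ * C := by
  set a := ENNReal.ofReal ((1 + ∑ i, (k i : ℝ) ^ 2) ^ σ) ^ (1 / 2 : ℝ) with ha
  have hpos : (0 : ℝ) < (1 + ∑ i, (k i : ℝ) ^ 2) ^ σ := by positivity
  have ha0 : a ≠ 0 := by
    rw [ha]
    simp only [ne_eq, ENNReal.rpow_eq_zero_iff, ENNReal.ofReal_eq_zero, not_or, not_and]
    exact ⟨fun h => absurd h (not_le.2 hpos), fun h => absurd h ENNReal.ofReal_ne_top⟩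
  have hat : a ≠ ⊤ := ENNReal.rpow_ne_top_of_nonneg (by norm_num) ENNReal.ofReal_ne_top
  have h1 : ∀ t, ‖w t k‖ₑ ≤ a⁻¹ * sobolevNorm σ (w t) := by
    intro t
    have h2 : a * ‖w t k‖ₑ = (ENNReal.ofReal ((1 + ∑ i, (k i : ℝ) ^ 2) ^ σ) * ‖w t k‖ₑ ^ 2)
        ^ (1 / 2 : ℝ) := by
      rw [ENNReal.mul_rpow_of_nonneg _ _ (by norm_num), ← ENNReal.rpow_natCast,
        ← ENNReal.rpow_mul]
      norm_num [ha]
    calc ‖w t k‖ₑ = a⁻¹ * (a * ‖w t k‖ₑ) := by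
          rw [← mul_assoc, ENNReal.inv_mul_cancel ha0 hat, one_mul]
      _ ≤ _ := by
        rw [h2, sobolevNorm]
        gcongr
        exact ENNReal.le_tsum k
  calc _ ≤ ∫⁻ t, a⁻¹ * sobolevNorm σ (w t) ∂timeMeasure T := lintegral_mono h1
    _ = a⁻¹ * ∫⁻ t, sobolevNorm σ (w t) ∂timeMeasure T :=
        lintegral_const_mul' _ _ (ENNReal.inv_ne_top.2 ha0)
    _ ≤ _ := by gcongr

end WeakProduct

end

noncomputable section

namespace WeakProduct

/-! ### Space regularization of functions of space and time -/

variable {T : ℝ} {q p s : ℝ≥0∞}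

/-- Convolution in space with `torusKernel N`. -/
def spaceConv (N : ℕ) (a : ℝ × T3 → ℝ) (z : ℝ × T3) : ℝ :=
  conv (fun y => a (z.1, y)) (torusKernel N) z.2

lemma aestronglyMeasurable_spaceConv (N : ℕ) {a : ℝ × T3 → ℝ}
    (ha : AEStronglyMeasurable a (stMeasure T)) :
    AEStronglyMeasurable (spaceConv N a) (stMeasure T) := by
  set a' := ha.mk a with ha'
  have hm : StronglyMeasurable a' := ha.stronglyMeasurable_mk
  have h1 : StronglyMeasurable (spaceConv N a') := by
    have : StronglyMeasurable (Function.uncurry fun (z : ℝ × T3) (y : T3) =>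
        a' (z.1, y) * torusKernel N (z.2 - y)) := by
      refine StronglyMeasurable.mul ?_ ?_
      · exact hm.comp_measurable
          ((measurable_fst.comp measurable_fst).prodMk measurable_snd)
      · have : Continuous fun x : (ℝ × T3) × T3 => torusKernel N (x.1.2 - x.2) := by fun_prop
        exact this.stronglyMeasurable
    exact this.integral_prod_right
  refine ⟨_, h1, ?_⟩
  have h2 : ∀ᵐ t ∂timeMeasure T, ∀ x, spaceConv N a (t, x) = spaceConv N a' (t, x) := by
    filter_upwards [Measure.ae_ae_of_ae_prod ha.ae_eq_mk] with t ht x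
    refine integral_congr_ae ?_
    filter_upwards [ht] with y hy
    simp only [ha', hy]
  have h3 := (Measure.quasiMeasurePreserving_fst (μ := timeMeasure T) (ν := torusMeasure)).ae h2
  exact h3.mono fun z hz => hz z.2

lemma aemeasurable_slice_norm {f : ℝ × T3 → ℝ} (hf : AEStronglyMeasurable f (stMeasure T)) :
    AEMeasurable (fun t => eLpNorm (fun x => f (t, x)) p torusMeasure) (timeMeasure T) := by
  have := aemeasurable_eLpNorm_section (τ := timeMeasure T) (μ := torusMeasure) p hf.enorm
  simpa only [eLpNorm_enorm] using this

/-- The tail of the series that controls the regularization error. -/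
def approxRate (p s : ℝ≥0∞) (N : ℕ) : ℝ≥0∞ := ∑' n, potentialConst p s (n + N)

lemma approxRate_ne_top (hp : 1 ≤ p) (hps : p ≤ s) (hs : s ≠ ⊤)
    (h : 1 / p.toReal - 1 / s.toReal < 1 / 3) (N : ℕ) : approxRate p s N ≠ ⊤ := by
  refine ne_top_of_le_ne_top (tsum_potentialConst_ne_top hp hps hs h) ?_
  exact ENNReal.tsum_comp_le_tsum_of_injective (add_left_injective N) _

lemma tendsto_approxRate (hp : 1 ≤ p) (hps : p ≤ s) (hs : s ≠ ⊤)
    (h : 1 / p.toReal - 1 / s.toReal < 1 / 3) : Tendsto (approxRate p s) atTop (𝓝 0) :=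
  ENNReal.tendsto_sum_nat_add _ (tsum_potentialConst_ne_top hp hps hs h)

/-- The spatial estimate holds at almost every time with a rate independent of the time, so the
`L^q` norm in time can be taken afterwards. -/
lemma mixedNorm_sub_spaceConv_le (hq : 1 ≤ q) (hp : 1 ≤ p) (hps : p ≤ s) (hs : s ≠ ⊤)
    {a : ℝ × T3 → ℝ} {g : Fin 3 → ℝ × T3 → ℝ} (ha : MemMixed T q p a)
    (hg : ∀ i, MemMixed T q p (g i)) (hag : IsWeakGrad T a g) (N : ℕ) :
    mixedNorm T q s (fun z => a z - spaceConv N a z)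
      ≤ approxRate p s N * ∑ i, mixedNorm T q p (g i) := by
  have hgm : ∀ i, AEMeasurable (fun t => eLpNorm (fun x => g i (t, x)) p torusMeasure)
      (timeMeasure T) := fun i => aemeasurable_slice_norm (hg i).1
  have hgi : ∀ᵐ t ∂timeMeasure T, ∀ i, MemLp (fun x => g i (t, x)) p torusMeasure :=
    ae_all_iff.2 fun i => (hg i).ae_memLp hq
  have h1 : mixedNorm T q s (fun z => a z - spaceConv N a z)
      ≤ eLpNorm (fun t => (∑ i, eLpNorm (fun x => g i (t, x)) p torusMeasure)
        * approxRate p s N) q (timeMeasure T) := by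
    refine eLpNorm_mono_ennreal ?_
    filter_upwards [hag, ha.ae_memLp hq, hgi] with t h1 h2 h3
    rw [mul_comm]
    exact eLpNorm_sub_conv_le hp hps hs (h2.integrable hp) h3 h1 N
  refine h1.trans ?_
  rw [eLpNorm_mul_const_ennreal (Finset.aemeasurable_fun_sum _ fun i _ => hgm i), mul_comm]
  gcongr
  have h2 := eLpNorm_sum_le (p := q) (μ := timeMeasure T) (s := Finset.univ)
    (f := fun i t => eLpNorm (fun x => g i (t, x)) p torusMeasure)
    (fun i _ => (hgm i).aestronglyMeasurable) hq
  refine le_trans (le_of_eq ?_) h2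
  congr 1

/-- Young's inequality with a kernel of mass one and finite supremum. The constant depends on `N`,
but only membership is needed. -/
lemma memMixed_spaceConv (hp : 1 ≤ p) (hps : p ≤ s) (hs : s ≠ ⊤)
    {a : ℝ × T3 → ℝ} (ha : MemMixed T q p a) (N : ℕ) : MemMixed T q s (spaceConv N a) := by
  refine ⟨aestronglyMeasurable_spaceConv N ha.1, ?_⟩
  obtain ⟨B, hB⟩ := exists_bound_torus (continuous_torusKernel N)
  have hpt : p ≠ ⊤ := ne_top_of_le_ne_top hs hps
  have hp1 : 1 ≤ p.toReal := by
    rw [← ENNReal.toReal_one]; exact ENNReal.toReal_mono hpt hp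
  have h0 : 0 ≤ 1 / p.toReal - 1 / s.toReal := by
    have := one_div_le_one_div_of_le (by linarith : 0 < p.toReal) (ENNReal.toReal_mono hs hps)
    linarith
  have h1 : mixedNorm T q s (spaceConv N a)
      ≤ eLpNorm (fun t => eLpNorm (fun x => a (t, x)) p torusMeasure
        * ENNReal.ofReal B ^ (1 / p.toReal - 1 / s.toReal)) q (timeMeasure T) := by
    refine eLpNorm_mono_ennreal ?_
    filter_upwards [ha.1.prodMk_left] with t ht
    have := eLpNorm_conv_le hp hps hs ht (continuous_torusKernel N)
      (lintegral_enorm_torusKernel N).le (B := ENNReal.ofReal B) (fun y => by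
        rw [← ofReal_norm]; exact ENNReal.ofReal_le_ofReal (hB y))
    rw [ENNReal.one_rpow, one_mul, mul_comm] at this
    exact this
  refine h1.trans_lt ?_
  rw [eLpNorm_mul_const_ennreal (aemeasurable_slice_norm ha.1)]
  exact ENNReal.mul_lt_top ha.2 (ENNReal.rpow_ne_top_of_nonneg h0 ENNReal.ofReal_ne_top).lt_top

lemma memMixed_sub_spaceConv (hq : 1 ≤ q) (hp : 1 ≤ p) (hps : p ≤ s) (hs : s ≠ ⊤)
    (h : 1 / p.toReal - 1 / s.toReal < 1 / 3)
    {a : ℝ × T3 → ℝ} {g : Fin 3 → ℝ × T3 → ℝ} (ha : MemMixed T q p a)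
    (hg : ∀ i, MemMixed T q p (g i)) (hag : IsWeakGrad T a g) (N : ℕ) :
    MemMixed T q s (fun z => a z - spaceConv N a z) := by
  refine ⟨ha.1.sub (aestronglyMeasurable_spaceConv N ha.1),
    (mixedNorm_sub_spaceConv_le hq hp hps hs ha hg hag N).trans_lt ?_⟩
  exact ENNReal.mul_lt_top (approxRate_ne_top hp hps hs h N).lt_top
    (ENNReal.sum_lt_top.2 fun i _ => (hg i).2)

/-- The subcritical Sobolev embedding `L^q_t(W^{1,p}_x) ⊂ L^q_t(L^s_x)`. -/
lemma memMixed_of_weakGrad (hq : 1 ≤ q) (hp : 1 ≤ p) (hps : p ≤ s) (hs : s ≠ ⊤)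
    (h : 1 / p.toReal - 1 / s.toReal < 1 / 3)
    {a : ℝ × T3 → ℝ} {g : Fin 3 → ℝ × T3 → ℝ} (ha : MemMixed T q p a)
    (hg : ∀ i, MemMixed T q p (g i)) (hag : IsWeakGrad T a g) : MemMixed T q s a := by
  have h1 := memMixed_sub_spaceConv hq hp hps hs h ha hg hag 0
  have h2 := memMixed_spaceConv (q := q) hp hps hs ha 0
  refine ⟨ha.1, ?_⟩
  have h3 : mixedNorm T q s a ≤ mixedNorm T q s (fun z => a z - spaceConv 0 a z)
      + mixedNorm T q s (spaceConv 0 a) := by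
    simp only [mixedNorm_eq_iterNorm]
    refine le_trans (iterNorm_mono (ae_of_all _ fun z => ?_))
      (iterNorm_add_le hq (hp.trans hps) h1.1.enorm h2.1.enorm)
    calc ‖a z‖ₑ = ‖(a z - spaceConv 0 a z) + spaceConv 0 a z‖ₑ := by rw [sub_add_cancel]
      _ ≤ _ := enorm_add_le _ _
  exact h3.trans_lt (ENNReal.add_lt_top.2 ⟨h1.2, h2.2⟩)

end WeakProduct

end

noncomputable section

namespace WeakProduct

open UnitAddTorus (mFourier)

/-! ### Density of separated functions -/

/-- The function `(t, y, x) ↦ σ(t, y) e_k(x)`. -/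
def separated {T : ℝ} (σ : C(Icc 0 T × T3, ℂ)) (k : Fin 3 → ℤ) : C(Icc 0 T × T3 × T3, ℂ) where
  toFun z := σ (z.1, z.2.1) * mFourier k z.2.2
  continuous_toFun := by fun_prop

/-- Stone–Weierstrass. Products and conjugates of separated functions are separated, because
characters multiply to characters, so their span is already a star subalgebra. -/
lemma closure_span_separated (T : ℝ) :
    (Submodule.span ℂ (range fun j : C(Icc 0 T × T3, ℂ) × (Fin 3 → ℤ) =>
      separated j.1 j.2)).topologicalClosure = ⊤ := by
  set S : Set C(Icc 0 T × T3 × T3, ℂ) :=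
    range fun j : C(Icc 0 T × T3, ℂ) × (Fin 3 → ℤ) => separated j.1 j.2 with hS
  let A : StarSubalgebra ℂ C(Icc 0 T × T3 × T3, ℂ) :=
    { toSubalgebra := Algebra.adjoin ℂ S
      star_mem' := by
        change Algebra.adjoin ℂ S ≤ star (Algebra.adjoin ℂ S)
        refine Algebra.adjoin_le ?_
        rintro _ ⟨⟨σ, k⟩, rfl⟩
        refine Algebra.subset_adjoin ⟨⟨star σ, -k⟩, ?_⟩
        ext z
        simp [separated, UnitAddTorus.mFourier_neg] }
  have hspan : A.toSubalgebra.toSubmodule = Submodule.span ℂ S := by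
    apply Algebra.adjoin_eq_span_of_subset
    refine .trans (fun x ↦ Submonoid.closure_induction (fun _ ↦ id) ⟨⟨1, 0⟩, ?_⟩ ?_)
      Submodule.subset_span
    · ext z
      simp [separated, UnitAddTorus.mFourier_zero]
    · rintro _ _ _ _ ⟨⟨σ, k⟩, rfl⟩ ⟨⟨σ', k'⟩, rfl⟩
      refine ⟨⟨σ * σ', k + k'⟩, ?_⟩
      ext z
      simp only [separated, ContinuousMap.coe_mk, ContinuousMap.mul_apply,
        UnitAddTorus.mFourier_add]
      ring
  have hsep : A.SeparatesPoints := by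
    rintro ⟨t, y, x⟩ ⟨t', y', x'⟩ hne
    by_cases h1 : (t, y) = (t', y')
    · have h2 : x ≠ x' := by
        rintro rfl
        simp only [Prod.mk.injEq] at h1
        exact hne (by rw [h1.1, h1.2])
      obtain ⟨i, hi⟩ := Function.ne_iff.1 h2
      refine ⟨_, ⟨separated 1 (Pi.single i 1), Algebra.subset_adjoin ⟨⟨1, _⟩, rfl⟩, rfl⟩, ?_⟩
      simp only [separated, ContinuousMap.coe_mk, ContinuousMap.one_apply, one_mul]
      rw [UnitAddTorus.mFourier_single, UnitAddTorus.mFourier_single, fourier_one, fourier_one]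
      exact fun h => hi (AddCircle.injective_toCircle one_ne_zero (Circle.ext h))
    -- Points that differ in `(t, y)` are separated by the distance to one of them; otherwise a
    -- coordinate character separates the `x` components.
    · have hd : dist (t, y) (t', y') ≠ 0 := dist_ne_zero.2 h1
      let σ : C(Icc 0 T × T3, ℂ) := ⟨fun w => ((dist w (t', y') : ℝ) : ℂ), by fun_prop⟩
      refine ⟨_, ⟨separated σ 0, Algebra.subset_adjoin ⟨⟨σ, _⟩, rfl⟩, rfl⟩, ?_⟩
      simp only [separated, ContinuousMap.coe_mk, UnitAddTorus.mFourier_zero,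
        ContinuousMap.one_apply, mul_one, σ, dist_self]
      exact_mod_cast hd
  rw [← hspan]
  exact congr_arg (Subalgebra.toSubmodule <| StarSubalgebra.toSubalgebra ·)
    (ContinuousMap.starSubalgebra_topologicalClosure_eq_top_of_separatesPoints A hsep)

/-! ### The trilinear form -/

/-- The measure of `[0, T] × 𝕋³ × 𝕋³`. -/
def tripleMeasure (T : ℝ) : Measure (ℝ × T3 × T3) :=
  (timeMeasure T).prod (torusMeasure.prod torusMeasure)

variable {T : ℝ} {q p q' p' : ℝ≥0∞}

/-- The tensor product `v(t, y) b(t, x)`. -/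
def tensor (v b : ℝ × T3 → ℝ) (z : ℝ × T3 × T3) : ℝ := v (z.1, z.2.1) * b (z.1, z.2.2)

lemma aestronglyMeasurable_tensor {v b : ℝ × T3 → ℝ} (hv : AEStronglyMeasurable v (stMeasure T))
    (hb : AEStronglyMeasurable b (stMeasure T)) :
    AEStronglyMeasurable (tensor v b) (tripleMeasure T) := by
  have h1 : MeasurePreserving (Prod.map id Prod.fst : ℝ × T3 × T3 → ℝ × T3) (tripleMeasure T)
      (stMeasure T) := (MeasurePreserving.id (timeMeasure T)).prod measurePreserving_fst
  have h2 : MeasurePreserving (Prod.map id Prod.snd : ℝ × T3 × T3 → ℝ × T3) (tripleMeasure T)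
      (stMeasure T) := (MeasurePreserving.id (timeMeasure T)).prod measurePreserving_snd
  exact (hv.comp_measurePreserving h1).mul (hb.comp_measurePreserving h2)

/-- At fixed time the variables `y` and `x` are independent, so the integral is a product of two
`L¹` norms. Hölder is used only in time, and the spatial exponents need not be conjugate. -/
lemma lintegral_tensor_le [q.HolderConjugate q'] (hp : 1 ≤ p) (hp' : 1 ≤ p') {v b : ℝ × T3 → ℝ}
    (hv : AEStronglyMeasurable v (stMeasure T)) (hb : AEStronglyMeasurable b (stMeasure T)) :
    ∫⁻ z, ‖tensor v b z‖ₑ ∂tripleMeasure T ≤ mixedNorm T q p v * mixedNorm T q' p' b := by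
  have h0 : ∫⁻ z, ‖tensor v b z‖ₑ ∂tripleMeasure T
      = ∫⁻ t, ∫⁻ w, ‖tensor v b (t, w)‖ₑ ∂torusMeasure.prod torusMeasure ∂timeMeasure T :=
    lintegral_prod _ (aestronglyMeasurable_tensor hv hb).enorm
  rw [h0]
  refine le_trans (lintegral_mono_ae ?_) (lintegral_mul_le_eLpNorm_mul (p := q) (q := q')
    (aemeasurable_slice_norm (p := p) hv) (aemeasurable_slice_norm (p := p') hb))
  filter_upwards [hv.prodMk_left, hb.prodMk_left] with t h1 h2
  simp only [tensor, enorm_mul]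
  rw [lintegral_prod_mul h1.enorm h2.enorm, ← eLpNorm_one_eq_lintegral_enorm,
    ← eLpNorm_one_eq_lintegral_enorm]
  gcongr
  · exact eLpNorm_le_eLpNorm_of_exponent_le hp h1
  · exact eLpNorm_le_eLpNorm_of_exponent_le hp' h2

/-- The extension of a function on `[0, T] × X` to `ℝ × X`, constant outside of `[0, T]`. -/
def timeExtend {X Y : Type*} (hT : 0 ≤ T) (f : Icc 0 T × X → Y) (z : ℝ × X) : Y :=
  f (projIcc 0 T hT z.1, z.2)

lemma continuous_timeExtend {X Y : Type*} [TopologicalSpace X] [TopologicalSpace Y] (hT : 0 ≤ T)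
    {f : Icc 0 T × X → Y} (hf : Continuous f) : Continuous (timeExtend hT f) := by
  unfold timeExtend
  have : Continuous (projIcc 0 T hT) := continuous_projIcc
  fun_prop

/-- The trilinear form `∫ v(t, y) b(t, x) F(t, y, x)`. -/
def trilinear (hT : 0 ≤ T) (v b : ℝ × T3 → ℝ) (F : C(Icc 0 T × T3 × T3, ℂ)) : ℂ :=
  ∫ z, (tensor v b z : ℂ) * timeExtend hT F z ∂tripleMeasure T

lemma integrable_tensor_mul (hT : 0 ≤ T) {v b : ℝ × T3 → ℝ}
    (h : Integrable (tensor v b) (tripleMeasure T)) (F : C(Icc 0 T × T3 × T3, ℂ)) :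
    Integrable (fun z => (tensor v b z : ℂ) * timeExtend hT F z) (tripleMeasure T) :=
  h.ofReal.mul_bdd (c := ‖F‖) (continuous_timeExtend hT F.continuous).aestronglyMeasurable
    (ae_of_all _ fun _ => F.norm_coe_le_norm _)

lemma norm_trilinear_le (hT : 0 ≤ T) {v b : ℝ × T3 → ℝ}
    (h : Integrable (tensor v b) (tripleMeasure T)) (F : C(Icc 0 T × T3 × T3, ℂ)) :
    ‖trilinear hT v b F‖ ≤ (∫ z, ‖tensor v b z‖ ∂tripleMeasure T) * ‖F‖ := by
  rw [← integral_mul_const]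
  refine norm_integral_le_of_norm_le (h.norm.mul_const _) (ae_of_all _ fun z => ?_)
  rw [norm_mul, Complex.norm_real]
  gcongr
  exact F.norm_coe_le_norm _

lemma trilinear_add (hT : 0 ≤ T) {v b : ℝ × T3 → ℝ}
    (h : Integrable (tensor v b) (tripleMeasure T)) (F G : C(Icc 0 T × T3 × T3, ℂ)) :
    trilinear hT v b (F + G) = trilinear hT v b F + trilinear hT v b G := by
  unfold trilinear
  rw [← integral_add (integrable_tensor_mul hT h F) (integrable_tensor_mul hT h G)]
  congr 1; ext z
  simp [timeExtend, mul_add]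

lemma trilinear_smul (hT : 0 ≤ T) (v b : ℝ × T3 → ℝ) (c : ℂ) (F : C(Icc 0 T × T3 × T3, ℂ)) :
    trilinear hT v b (c • F) = c * trilinear hT v b F := by
  unfold trilinear
  rw [← integral_const_mul]
  congr 1; ext z
  simp only [timeExtend, ContinuousMap.smul_apply, smul_eq_mul]
  ring

/-- The moments of `v` against a continuous function, as functions of time. -/
def timeMoment (hT : 0 ≤ T) (v : ℝ × T3 → ℝ) (σ : C(Icc 0 T × T3, ℂ)) (t : ℝ) : ℂ :=
  ∫ y, (v (t, y) : ℂ) * timeExtend hT σ (t, y) ∂torusMeasure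

/-- At each time the double spatial integral factorizes, which reduces the form to a pairing of two
functions of time. -/
lemma trilinear_separated (hT : 0 ≤ T) {v b : ℝ × T3 → ℝ}
    (h : Integrable (tensor v b) (tripleMeasure T)) (σ : C(Icc 0 T × T3, ℂ)) (k : Fin 3 → ℤ) :
    trilinear hT v b (separated σ k)
      = ∫ t, timeMoment hT v σ t * timeMode b k t ∂timeMeasure T := by
  have h1 : trilinear hT v b (separated σ k) = ∫ t, ∫ w, (tensor v b (t, w) : ℂ) *
      timeExtend hT (separated σ k) (t, w) ∂torusMeasure.prod torusMeasure ∂timeMeasure T :=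
    integral_prod _ (integrable_tensor_mul hT h (separated σ k))
  rw [h1]
  congr 1; ext t
  rw [timeMoment, timeMode, ← integral_prod_mul]
  congr 1; ext w
  simp only [tensor, timeExtend, separated, ContinuousMap.coe_mk]
  push_cast; ring

lemma integrable_mul_timeExtend (hT : 0 ≤ T) {v : ℝ × T3 → ℝ} (hv : Integrable v (stMeasure T))
    (σ : C(Icc 0 T × T3, ℂ)) :
    Integrable (fun z => (v z : ℂ) * timeExtend hT σ z) (stMeasure T) :=
  hv.ofReal.mul_bdd (c := ‖σ‖) (continuous_timeExtend hT σ.continuous).aestronglyMeasurable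
    (ae_of_all _ fun _ => σ.norm_coe_le_norm _)

lemma integrable_timeMoment (hT : 0 ≤ T) {v : ℝ × T3 → ℝ} (hv : Integrable v (stMeasure T))
    (σ : C(Icc 0 T × T3, ℂ)) : Integrable (timeMoment hT v σ) (timeMeasure T) :=
  (integrable_mul_timeExtend hT hv σ).integral_prod_left

lemma eLpNorm_timeMoment_le (hT : 0 ≤ T) {r : ℝ≥0∞} (hp : 1 ≤ p) {v : ℝ × T3 → ℝ}
    (hv : AEStronglyMeasurable v (stMeasure T)) (σ : C(Icc 0 T × T3, ℂ)) :
    eLpNorm (timeMoment hT v σ) r (timeMeasure T) ≤ mixedNorm T r p v * ‖σ‖ₑ := by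
  rw [mixedNorm, ← eLpNorm_mul_const_ennreal (aemeasurable_slice_norm hv)]
  refine eLpNorm_mono_enorm_ae ?_
  filter_upwards [hv.prodMk_left] with t ht
  rw [enorm_eq_self]
  refine (enorm_integral_le_lintegral_enorm _).trans ?_
  calc _ ≤ ∫⁻ y, ‖v (t, y)‖ₑ * ‖σ‖ₑ ∂torusMeasure := by
        refine lintegral_mono fun y => ?_
        rw [enorm_mul]
        gcongr
        · rw [enorm_le_iff_norm_le, Complex.norm_real]
        · rw [enorm_le_iff_norm_le]
          exact σ.norm_coe_le_norm _
    _ = eLpNorm (fun y => v (t, y)) 1 torusMeasure * ‖σ‖ₑ := by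
        rw [lintegral_mul_const'' _ ht.enorm, eLpNorm_one_eq_lintegral_enorm]
    _ ≤ _ := by
        gcongr
        exact eLpNorm_le_eLpNorm_of_exponent_le hp ht

/-- A tail of a moment is a pairing of `v` with the bounded function `1_{t ≥ s} σ`. Weak
convergence, available for bounded measurable test functions, therefore yields pointwise convergence
of the tails. -/
lemma timeTail_timeMoment (hT : 0 ≤ T) {v : ℝ × T3 → ℝ} (hv : Integrable v (stMeasure T))
    (σ : C(Icc 0 T × T3, ℂ)) (s : ℝ) :
    timeTail T (timeMoment hT v σ) s
      = ((∫ z, v z * (Ici s ×ˢ univ).indicator (fun z => (timeExtend hT σ z).re) z ∂stMeasure T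
          : ℝ) : ℂ)
        + ((∫ z, v z * (Ici s ×ˢ univ).indicator (fun z => (timeExtend hT σ z).im) z ∂stMeasure T
          : ℝ) : ℂ) * Complex.I := by
  have hS : MeasurableSet (Ici s ×ˢ (univ : Set T3)) := measurableSet_Ici.prod MeasurableSet.univ
  have hi := integrable_mul_timeExtend hT hv σ
  have h1 : timeTail T (timeMoment hT v σ) s = ∫ z, (Ici s ×ˢ univ).indicator
      (fun z => (v z : ℂ) * timeExtend hT σ z) z ∂stMeasure T := by
    rw [timeTail, ← integral_indicator measurableSet_Ici]
    refine Eq.trans ?_ (integral_prod _ (hi.indicator hS)).symm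
    congr 1; ext t
    by_cases ht : t ∈ Ici s
    · rw [indicator_of_mem ht, timeMoment]
      congr 1; ext y
      rw [indicator_of_mem (show (t, y) ∈ Ici s ×ˢ (univ : Set T3) from ⟨ht, mem_univ _⟩)]
    · rw [indicator_of_notMem ht]
      have : ∀ y : T3, (t, y) ∉ Ici s ×ˢ (univ : Set T3) := fun y h => ht h.1
      simp [indicator_of_notMem (this _)]
  have hσ := continuous_timeExtend hT σ.continuous
  have hre : Integrable (fun z => v z * (Ici s ×ˢ univ).indicator
      (fun z => (timeExtend hT σ z).re) z) (stMeasure T) := by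
    refine hv.mul_bdd (c := ‖σ‖) ?_ (ae_of_all _ fun z => ?_)
    · exact ((Complex.continuous_re.comp hσ).aestronglyMeasurable).indicator hS
    · refine (norm_indicator_le_norm_self _ _).trans ?_
      exact (Complex.abs_re_le_norm _).trans (σ.norm_coe_le_norm _)
  have him : Integrable (fun z => v z * (Ici s ×ˢ univ).indicator
      (fun z => (timeExtend hT σ z).im) z) (stMeasure T) := by
    refine hv.mul_bdd (c := ‖σ‖) ?_ (ae_of_all _ fun z => ?_)
    · exact ((Complex.continuous_im.comp hσ).aestronglyMeasurable).indicator hS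
    · refine (norm_indicator_le_norm_self _ _).trans ?_
      exact (Complex.abs_im_le_norm _).trans (σ.norm_coe_le_norm _)
  rw [h1, ← integral_complex_ofReal, ← integral_complex_ofReal, ← integral_mul_const,
    ← integral_add hre.ofReal (him.ofReal.mul_const _)]
  congr 1; ext z
  by_cases hz : z ∈ Ici s ×ˢ (univ : Set T3)
  · simp only [indicator_of_mem hz]
    nth_rw 1 [← Complex.re_add_im (timeExtend hT σ z)]
    push_cast; ring
  · simp [indicator_of_notMem hz]

/-- Compensated compactness for the trilinear form: `v_n` converges weakly to zero with some
integrability in time, and the time derivatives of the Fourier modes of `b_n` are bounded. -/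
theorem tendsto_trilinear (hT : 0 < T) [q.HolderConjugate q'] {r : ℝ≥0∞} (hr : 1 < r)
    (hp : 1 ≤ p) (hp' : 1 ≤ p') {v b : ℕ → ℝ × T3 → ℝ}
    (hvi : ∀ n, Integrable (v n) (stMeasure T)) {C : ℝ≥0}
    (hvr : ∀ n, mixedNorm T r p (v n) ≤ C) (hvq : ∀ n, mixedNorm T q p (v n) ≤ C)
    (hv0 : ∀ ψ : ℝ × T3 → ℝ, AEStronglyMeasurable ψ (stMeasure T) →
      ∀ M, (∀ z, ‖ψ z‖ ≤ M) → Tendsto (fun n => ∫ z, v n z * ψ z ∂stMeasure T) atTop (𝓝 0))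
    (hbi : ∀ n, Integrable (b n) (stMeasure T)) (hbq : ∀ n, mixedNorm T q' p' (b n) ≤ C)
    (hb1 : ∀ n, ∫ z, ‖b n z‖ ∂stMeasure T ≤ C)
    (hbt : ∀ k, ∃ M : ℝ, ∀ n, ∃ w : ℝ → ℂ, Integrable w (timeMeasure T) ∧
      ∫ t, ‖w t‖ ∂timeMeasure T ≤ M ∧ ∀ χ, IsTimeTest T χ →
        ∫ t, timeMode (b n) k t * ((deriv χ t : ℝ) : ℂ) ∂timeMeasure T
          = -∫ t, w t * (χ t : ℂ) ∂timeMeasure T)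
    (F : C(Icc 0 T × T3 × T3, ℂ)) :
    Tendsto (fun n => trilinear hT.le (v n) (b n) F) atTop (𝓝 0) := by
  have hle : ∀ n, ∫⁻ z, ‖tensor (v n) (b n) z‖ₑ ∂tripleMeasure T ≤ C * C := fun n =>
    (lintegral_tensor_le (q := q) (q' := q') hp hp' (hvi n).1 (hbi n).1).trans
      (mul_le_mul' (hvq n) (hbq n))
  have hinteg : ∀ n, Integrable (tensor (v n) (b n)) (tripleMeasure T) := fun n =>
    ⟨aestronglyMeasurable_tensor (hvi n).1 (hbi n).1, (hle n).trans_lt (by finiteness)⟩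
  have hnorm : ∀ n, ∫ z, ‖tensor (v n) (b n) z‖ ∂tripleMeasure T ≤ C * C := by
    intro n
    rw [integral_norm_eq_lintegral_enorm (hinteg n).1]
    exact ENNReal.toReal_le_of_le_ofReal (by positivity) (by
      rw [ENNReal.ofReal_mul (by positivity), ENNReal.ofReal_coe_nnreal]; exact hle n)
  have hsep : ∀ σ k, Tendsto (fun n => trilinear hT.le (v n) (b n) (separated σ k)) atTop
      (𝓝 0) := by
    intro σ k
    simp only [trilinear_separated hT.le (hinteg _)]
    obtain ⟨M, hM⟩ := hbt k
    choose w hw1 hw2 hw3 using hM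
    refine tendsto_integral_mul_zero hT hr (w := w) (C := C * ‖σ‖₊) (M := max C M)
      (fun n => integrable_timeMoment hT.le (hvi n) σ) (fun n => ?_) (fun s => ?_)
      (fun n => integrable_timeMode (hbi n) k) hw1 hw3
      (fun n => ((integral_norm_timeMode_le (hbi n) k).trans (hb1 n)).trans (le_max_left _ _))
      (fun n => (hw2 n).trans (le_max_right _ _))
    · refine (eLpNorm_timeMoment_le hT.le hp (hvi n).1 σ).trans ?_
      push_cast
      rw [enorm_eq_nnnorm]
      gcongr
      exact hvr n
    · simp only [timeTail_timeMoment hT.le (hvi _)]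
      have hS : MeasurableSet (Ici s ×ˢ (univ : Set T3)) :=
        measurableSet_Ici.prod MeasurableSet.univ
      have hσ := continuous_timeExtend hT.le σ.continuous
      have h1 := hv0 ((Ici s ×ˢ univ).indicator fun z => (timeExtend hT.le σ z).re)
        (((Complex.continuous_re.comp hσ).aestronglyMeasurable).indicator hS) ‖σ‖ (fun z =>
          (norm_indicator_le_norm_self _ _).trans
            ((Complex.abs_re_le_norm _).trans (σ.norm_coe_le_norm _)))
      have h2 := hv0 ((Ici s ×ˢ univ).indicator fun z => (timeExtend hT.le σ z).im)
        (((Complex.continuous_im.comp hσ).aestronglyMeasurable).indicator hS) ‖σ‖ (fun z =>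
          (norm_indicator_le_norm_self _ _).trans
            ((Complex.abs_im_le_norm _).trans (σ.norm_coe_le_norm _)))
      have h3 := ((Complex.continuous_ofReal.tendsto _).comp h1).add
        (((Complex.continuous_ofReal.tendsto _).comp h2).mul_const Complex.I)
      simpa using h3
  have hspan : ∀ G ∈ Submodule.span ℂ (range fun j : C(Icc 0 T × T3, ℂ) × (Fin 3 → ℤ) =>
      separated j.1 j.2), Tendsto (fun n => trilinear hT.le (v n) (b n) G) atTop (𝓝 0) := by
    intro G hG
    induction hG using Submodule.span_induction with
    | mem G hG =>
      obtain ⟨j, rfl⟩ := hG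
      exact hsep _ _
    | zero => simp [trilinear, timeExtend]
    | add G H _ _ hG hH =>
      simp only [trilinear_add hT.le (hinteg _)]
      simpa using hG.add hH
    | smul c G _ hG =>
      simp only [trilinear_smul]
      simpa using hG.const_mul c
  -- Density of the span suffices because the forms are bounded by `C²` in the supremum norm,
  -- uniformly in `n`.
  have hF : F ∈ closure (Submodule.span ℂ (range fun j : C(Icc 0 T × T3, ℂ) × (Fin 3 → ℤ) =>
      separated j.1 j.2) : Set C(Icc 0 T × T3 × T3, ℂ)) := by
    rw [← Submodule.topologicalClosure_coe, closure_span_separated]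
    trivial
  rw [Metric.tendsto_atTop]
  intro ε hε
  have hK : 0 < (C : ℝ) * C + 1 := by positivity
  obtain ⟨G, hG, hFG⟩ := Metric.mem_closure_iff.1 hF (ε / 2 / (C * C + 1)) (by positivity)
  obtain ⟨N, hN⟩ := Metric.tendsto_atTop.1 (hspan G hG) (ε / 2) (by positivity)
  refine ⟨N, fun n hn => ?_⟩
  have h1 := hN n hn
  rw [dist_zero_right] at h1 ⊢
  have e : trilinear hT.le (v n) (b n) F
      = trilinear hT.le (v n) (b n) (F - G) + trilinear hT.le (v n) (b n) G := by
    rw [← trilinear_add hT.le (hinteg n), sub_add_cancel]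
  have h2 : ‖trilinear hT.le (v n) (b n) (F - G)‖ ≤ ε / 2 := by
    refine (norm_trilinear_le hT.le (hinteg n) _).trans ?_
    rw [dist_eq_norm] at hFG
    calc _ ≤ (C * C + 1 : ℝ) * (ε / 2 / (C * C + 1)) := by
          gcongr
          linarith [hnorm n]
      _ = ε / 2 := by field_simp
  rw [e]
  calc _ ≤ _ := norm_add_le _ _
    _ < ε / 2 + ε / 2 := add_lt_add_of_le_of_lt h2 h1
    _ = ε := add_halves ε

end WeakProduct

end

noncomputable section

namespace WeakProduct

/-! ### Exponents -/

lemma conjExponent_conjExponent {p : ℝ≥0∞} (hp : 1 ≤ p) : p.conjExponent.conjExponent = p := by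
  have := (ENNReal.HolderConjugate.conjExponent hp).symm
  exact ENNReal.HolderConjugate.conjExponent_eq

lemma one_le_conjExponent (p : ℝ≥0∞) : 1 ≤ p.conjExponent := by
  rw [ENNReal.conjExponent]; exact le_self_add

lemma conjExponent_anti {p s : ℝ≥0∞} (h : p ≤ s) : s.conjExponent ≤ p.conjExponent := by
  rw [ENNReal.conjExponent, ENNReal.conjExponent]
  gcongr

lemma conjExponent_ne_top {p : ℝ≥0∞} (h : 1 < p) : p.conjExponent ≠ ⊤ := by
  rw [ENNReal.conjExponent]
  have : p - 1 ≠ 0 := (tsub_pos_of_lt h).ne'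
  exact ENNReal.add_ne_top.2 ⟨ENNReal.one_ne_top, ENNReal.inv_ne_top.2 this⟩

/-- A subcritical exponent may be increased so as to exceed `p` and one. -/
lemma exists_subcritical_exponent {p s : ℝ≥0∞} (hp1 : 1 ≤ p) (hp : p < 3)
    (hs : s < 3 * p / (3 - p)) :
    ∃ s' : ℝ≥0∞, s ≤ s' ∧ p ≤ s' ∧ 1 < s' ∧ s' ≠ ⊤ ∧ 1 / p.toReal - 1 / s'.toReal < 1 / 3 := by
  have hpt : p ≠ ⊤ := hp.ne_top
  have hst : s ≠ ⊤ := hs.ne_top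
  have hP1 : 1 ≤ p.toReal := by
    rw [← ENNReal.toReal_one]; exact ENNReal.toReal_mono hpt hp1
  have hP3 : p.toReal < 3 := by
    have := (ENNReal.toReal_lt_toReal hpt (by simp)).2 hp
    simpa using this
  have hcrit : 3 * p / (3 - p) = ENNReal.ofReal (3 * p.toReal / (3 - p.toReal)) := by
    rw [ENNReal.ofReal_div_of_pos (by linarith), ENNReal.ofReal_mul (by norm_num),
      ENNReal.ofReal_sub _ ENNReal.toReal_nonneg, ENNReal.ofReal_toReal hpt]
    simp
  have hS : s.toReal < 3 * p.toReal / (3 - p.toReal) := by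
    rw [hcrit] at hs
    exact (ENNReal.lt_ofReal_iff_toReal_lt hst).1 hs
  have hPS : p.toReal < 3 * p.toReal / (3 - p.toReal) := by
    rw [lt_div_iff₀ (by linarith)]
    nlinarith
  -- Any value strictly between `max(s, p)` and the critical exponent will do. It also exceeds `1`,
  -- which makes its conjugate exponent finite.
  obtain ⟨S, hS1, hS2⟩ := exists_between (max_lt hS hPS)
  have hSs := (le_max_left s.toReal p.toReal).trans hS1.le
  have hSp : p.toReal < S := (le_max_right s.toReal p.toReal).trans_lt hS1
  refine ⟨ENNReal.ofReal S, ?_, ?_, ?_, ENNReal.ofReal_ne_top, ?_⟩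
  · exact (ENNReal.le_ofReal_iff_toReal_le hst (by linarith)).2 hSs
  · exact (ENNReal.le_ofReal_iff_toReal_le hpt (by linarith)).2 hSp.le
  · rw [← ENNReal.ofReal_one]
    exact (ENNReal.ofReal_lt_ofReal_iff (by linarith)).2 (by linarith)
  · rw [ENNReal.toReal_ofReal (by linarith)]
    rw [lt_div_iff₀ (by linarith)] at hS2
    have hS0 : 0 < S := by linarith
    have hP0 : 0 < p.toReal := by linarith
    rw [div_sub_div _ _ hP0.ne' hS0.ne', div_lt_div_iff₀ (by positivity) (by norm_num)]
    linarith

/-! ### Weak-* convergent families -/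

variable {T : ℝ} {q p s : ℝ≥0∞} {u : ℝ → ℝ × T3 → ℝ} {u₀ : ℝ × T3 → ℝ}

/-- On a probability space, raising `s` lowers the conjugate exponent: the functions stay in the
larger space, and fewer test functions remain. -/
lemma TendstoWeakStarMixed.mono_exponent (hp : 1 ≤ p) (hps : p ≤ s)
    (h : TendstoWeakStarMixed T q p.conjExponent u u₀) :
    TendstoWeakStarMixed T q s.conjExponent u u₀ := by
  refine ⟨fun ε hε => (h.1 ε hε).mono_exponent (conjExponent_anti hps),
    h.2.1.mono_exponent (conjExponent_anti hps), fun ψ hψ => h.2.2 ψ ?_⟩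
  rw [conjExponent_conjExponent (hp.trans hps)] at hψ
  rw [conjExponent_conjExponent hp]
  exact hψ.mono_exponent hps

/-- Each pairing converges along the sequence and is therefore bounded; the uniform boundedness
principle does the rest. -/
lemma TendstoWeakStarMixed.exists_bound (hq : 1 ≤ q) (hp : 1 ≤ p) (hptop : p ≠ ⊤)
    (h : TendstoWeakStarMixed T q p u u₀) {e : ℕ → ℝ} (he : Tendsto e atTop (𝓝[>] 0))
    (hpos : ∀ n, 0 < e n) : ∃ C : ℝ≥0, ∀ n, mixedNorm T q p (u (e n)) ≤ C := by
  refine exists_mixedNorm_bound hq hp hptop (fun n => h.1 _ (hpos n)) fun ψ hψ => ?_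
  obtain ⟨C, hC⟩ := ((h.2.2 ψ hψ).comp he).norm.bddAbove_range
  exact ⟨C, fun n => hC ⟨n, rfl⟩⟩

/-! ### Pairings with a continuous weight -/

lemma norm_integral_mul_mul_le {q' p' : ℝ≥0∞} [q.HolderConjugate q'] [p.HolderConjugate p']
    {f g θ : ℝ × T3 → ℝ} (hf : MemMixed T q p f) (hg : MemMixed T q' p' g) {M : ℝ}
    (hθ : ∀ z, ‖θ z‖ ≤ M) :
    ‖∫ z, f z * g z * θ z ∂stMeasure T‖ ≤ (mixedNorm T q p f * mixedNorm T q' p' g).toReal * M := by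
  have hi := hf.integrable_mul hg
  have h1 := norm_integral_le_of_norm_le (f := fun z => f z * g z * θ z)
    (g := fun z => ‖f z * g z‖ * M) (hi.norm.mul_const M) (ae_of_all _ fun z => by
      rw [norm_mul]
      gcongr
      exact hθ z)
  refine h1.trans ?_
  rw [integral_mul_const]
  have hM : 0 ≤ M := (norm_nonneg _).trans (hθ (0, 0))
  gcongr
  rw [integral_norm_eq_lintegral_enorm hi.1]
  exact ENNReal.toReal_mono (ENNReal.mul_lt_top hf.2 hg.2).ne (lintegral_enorm_mul_le hf.1 hg.1)

/-- The kernel of the pairing with the space regularization. -/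
def regKernel (N : ℕ) (θ : C(Icc 0 T × T3, ℝ)) : C(Icc 0 T × T3 × T3, ℂ) where
  toFun z := ((torusKernel N (z.2.2 - z.2.1) * θ (z.1, z.2.2) : ℝ) : ℂ)
  continuous_toFun := by fun_prop

/-- Integrating in `y` first produces the spatial convolution, so the regularized product is the
trilinear form with a continuous weight. -/
lemma trilinear_regKernel (hT : 0 ≤ T) {v b : ℝ × T3 → ℝ} (N : ℕ) (θ : C(Icc 0 T × T3, ℝ))
    (h : Integrable (tensor v b) (tripleMeasure T))
    (hi : Integrable (fun z => spaceConv N v z * b z * timeExtend hT θ z) (stMeasure T)) :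
    trilinear hT v b (regKernel N θ)
      = ((∫ z, spaceConv N v z * b z * timeExtend hT θ z ∂stMeasure T : ℝ) : ℂ) := by
  have hti := integrable_tensor_mul hT h (regKernel N θ)
  have h1 : trilinear hT v b (regKernel N θ) = ∫ t, ∫ w, (tensor v b (t, w) : ℂ) *
      timeExtend hT (regKernel N θ) (t, w) ∂torusMeasure.prod torusMeasure ∂timeMeasure T :=
    integral_prod _ hti
  have h2 : ∫ z, spaceConv N v z * b z * timeExtend hT θ z ∂stMeasure T
      = ∫ t, ∫ x, spaceConv N v (t, x) * b (t, x) * timeExtend hT θ (t, x) ∂torusMeasure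
        ∂timeMeasure T := integral_prod _ hi
  rw [h1, h2, ← integral_complex_ofReal]
  refine integral_congr_ae ?_
  filter_upwards [hti.prod_right_ae] with t ht
  rw [integral_prod_symm _ ht, ← integral_complex_ofReal]
  congr 1; ext x
  have e : ∀ y, (tensor v b (t, (y, x)) : ℂ) * timeExtend hT (regKernel N θ) (t, (y, x))
      = ((v (t, y) * torusKernel N (x - y) * (b (t, x) * timeExtend hT θ (t, x)) : ℝ) : ℂ) := by
    intro y
    simp only [tensor, timeExtend, regKernel, ContinuousMap.coe_mk]
    push_cast; ring
  simp only [e]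
  rw [integral_complex_ofReal, integral_mul_const, mul_assoc]
  rfl

lemma MemMixed.mul_bounded {f θ : ℝ × T3 → ℝ} (hf : MemMixed T q p f) (hθ : Continuous θ) {M : ℝ}
    (hM : ∀ z, ‖θ z‖ ≤ M) : MemMixed T q p fun z => f z * θ z := by
  refine ⟨hf.1.mul hθ.aestronglyMeasurable, ?_⟩
  have hfm : AEMeasurable (fun t => eLpNorm (fun x => f (t, x)) p torusMeasure)
    (timeMeasure T) := aemeasurable_slice_norm hf.1
  have h1 : mixedNorm T q p (fun z => f z * θ z) ≤ eLpNorm (fun t =>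
      eLpNorm (fun x => f (t, x)) p torusMeasure * ENNReal.ofReal M) q (timeMeasure T) := by
    refine eLpNorm_mono_ennreal ?_
    filter_upwards [hf.1.prodMk_left] with t ht
    have h2 := eLpNorm_mul_const_ennreal (p := p) ht.enorm (ENNReal.ofReal M)
    rw [eLpNorm_enorm] at h2
    rw [← h2]
    refine eLpNorm_mono_enorm_ae (ae_of_all _ fun x => ?_)
    rw [enorm_mul, enorm_eq_self]
    gcongr
    rw [← ofReal_norm]
    exact ENNReal.ofReal_le_ofReal (hM _)
  refine h1.trans_lt ?_
  rw [eLpNorm_mul_const_ennreal hfm]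
  exact ENNReal.mul_lt_top hf.2 ENNReal.ofReal_lt_top

lemma exists_continuous_extension (hT : 0 ≤ T) {θ : ℝ × T3 → ℝ}
    (hθ : ContinuousOn θ (Icc 0 T ×ˢ univ)) :
    ∃ θ' : C(Icc 0 T × T3, ℝ), ∀ᵐ z ∂stMeasure T, θ z = timeExtend hT θ' z := by
  refine ⟨⟨fun z => θ (z.1, z.2), ?_⟩, ?_⟩
  · refine hθ.comp_continuous (by fun_prop) fun z => ⟨z.1.2, mem_univ _⟩
  · have h := (Measure.quasiMeasurePreserving_fst (μ := timeMeasure T)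
      (ν := torusMeasure)).ae (ae_mem_Icc T)
    filter_upwards [h] with z hz
    simp only [timeExtend, ContinuousMap.coe_mk, projIcc_of_mem hT hz]

lemma spaceConv_sub {N : ℕ} {a a' : ℝ × T3 → ℝ} (ha : Integrable a (stMeasure T))
    (ha' : Integrable a' (stMeasure T)) :
    ∀ᵐ z ∂stMeasure T, spaceConv N (fun z => a z - a' z) z
      = spaceConv N a z - spaceConv N a' z := by
  have h1 : ∀ᵐ t ∂timeMeasure T, ∀ x, spaceConv N (fun z => a z - a' z) (t, x)
      = spaceConv N a (t, x) - spaceConv N a' (t, x) := by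
    filter_upwards [ha.prod_right_ae, ha'.prod_right_ae] with t h1 h2 x
    exact conv_sub h1 h2 (continuous_torusKernel N) x
  have h := (Measure.quasiMeasurePreserving_fst (μ := timeMeasure T) (ν := torusMeasure)).ae h1
  exact h.mono fun z hz => hz z.2

lemma MemMixed.integrable (hq : 1 ≤ q) (hp : 1 ≤ p) {f : ℝ × T3 → ℝ} (hf : MemMixed T q p f) :
    Integrable f (stMeasure T) := by
  have := ENNReal.HolderConjugate.conjExponent hq
  have := ENNReal.HolderConjugate.conjExponent hp
  have h1 : MemMixed T q.conjExponent p.conjExponent fun _ => 1 :=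
    memMixed_of_bounded aestronglyMeasurable_const 1 (ae_of_all _ fun _ => by simp)
  simpa using hf.integrable_mul h1

/-- The modes of a function with time derivative bounded in `L¹_t(H^{-m}_x)` have bounded
derivatives. -/
lemma TimeDerivBounded.mode_bound {m : ℤ} {b : ℝ → ℝ × T3 → ℝ} (h : TimeDerivBounded T m b)
    (hb : ∀ ε, 0 < ε → Integrable (b ε) (stMeasure T)) (k : Fin 3 → ℤ) :
    ∃ M : ℝ, ∀ ε, 0 < ε → ∃ w : ℝ → ℂ, Integrable w (timeMeasure T) ∧
      ∫ t, ‖w t‖ ∂timeMeasure T ≤ M ∧ ∀ χ, IsTimeTest T χ →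
        ∫ t, timeMode (b ε) k t * ((deriv χ t : ℝ) : ℂ) ∂timeMeasure T
          = -∫ t, w t * (χ t : ℂ) ∂timeMeasure T := by
  obtain ⟨C, hC⟩ := h
  set W : (Fin 3 → ℤ) → ℝ≥0∞ := fun l =>
    (ENNReal.ofReal ((1 + ∑ i, (l i : ℝ) ^ 2) ^ (-m)) ^ (1 / 2 : ℝ))⁻¹ * C with hW
  have hWt : ∀ l, W l ≠ ⊤ := by
    intro l
    refine ENNReal.mul_ne_top (ENNReal.inv_ne_top.2 ?_) ENNReal.coe_ne_top
    have hpos : (0 : ℝ) < (1 + ∑ i, (l i : ℝ) ^ 2) ^ (-m) := by positivity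
    exact (ENNReal.rpow_pos (ENNReal.ofReal_pos.2 hpos) ENNReal.ofReal_ne_top).ne'
  refine ⟨(W (-k)).toReal, fun ε hε => ?_⟩
  obtain ⟨w, hw1, hw2, hw3⟩ := hC ε hε
  have hle := lintegral_mode_le hw2
  have hwi : ∀ l, Integrable (fun t => w t l) (timeMeasure T) := fun l =>
    ⟨hw1 l, (hle l).trans_lt (hWt l).lt_top⟩
  refine ⟨fun t => w t (-k), hwi _, ?_, fun χ hχ =>
    integral_timeMode_mul_deriv (hb ε hε) hwi hw3 k hχ⟩
  rw [integral_norm_eq_lintegral_enorm (hw1 _)]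
  exact ENNReal.toReal_mono (hWt _) (hle _)

end WeakProduct

end

noncomputable section

namespace WeakProduct

/-! ### Convergence of the product -/

variable {T : ℝ} {q p s r : ℝ≥0∞} {a b : ℝ → ℝ × T3 → ℝ} {a₀ b₀ : ℝ × T3 → ℝ}

/-- The regularized products converge weakly. -/
lemma tendsto_integral_spaceConv_sub (hT : 0 < T) (hq : 1 ≤ q) (hp : 1 ≤ p) (hps : p ≤ s)
    (hs1 : 1 < s) (hs : s ≠ ⊤) (hr : 1 < r) {m : ℤ}
    (ha : TendstoWeakStarMixed T q p a a₀) (har : TendstoWeakStarMixed T r p a a₀)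
    (hb : TendstoWeakStarMixed T q.conjExponent s.conjExponent b b₀)
    (hbt : TimeDerivBounded T m b) {e : ℕ → ℝ} (he : Tendsto e atTop (𝓝[>] 0))
    (hpos : ∀ n, 0 < e n) (θ : C(Icc 0 T × T3, ℝ)) (N : ℕ) :
    Tendsto (fun n => ∫ z, spaceConv N (fun z => a (e n) z - a₀ z) z * b (e n) z *
      timeExtend hT.le θ z ∂stMeasure T) atTop (𝓝 0) := by
  have hqq := ENNReal.HolderConjugate.conjExponent hq
  have hss := ENNReal.HolderConjugate.conjExponent hs1.le
  have hpp := ENNReal.HolderConjugate.conjExponent hp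
  have hpt : p ≠ ⊤ := ne_top_of_le_ne_top hs hps
  have hbi : ∀ n, Integrable (b (e n)) (stMeasure T) := fun n =>
    (hb.1 _ (hpos n)).integrable (one_le_conjExponent _) (one_le_conjExponent _)
  obtain ⟨C₁, hC₁⟩ := ha.exists_bound hq hp hpt he hpos
  obtain ⟨C₂, hC₂⟩ := har.exists_bound hr.le hp hpt he hpos
  obtain ⟨C₃, hC₃⟩ := hb.exists_bound (one_le_conjExponent _) (one_le_conjExponent _)
    (conjExponent_ne_top hs1) he hpos
  have hone : MemMixed T q s fun _ => 1 :=
    memMixed_of_bounded aestronglyMeasurable_const 1 (ae_of_all _ fun _ => by simp)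
  set L : ℝ≥0∞ := mixedNorm T q s fun _ => 1
  have hLt : L ≠ ⊤ := hone.2.ne
  -- One constant above all bounds required by `tendsto_trilinear`; the term `L * C₃` bounds the
  -- `L¹` norm of `b` by Hölder against `1`.
  set K : ℝ≥0∞ := C₁ + mixedNorm T q p a₀ + (C₂ + mixedNorm T r p a₀) + C₃ + L * C₃ with hK
  have hKt : K ≠ ⊤ := by
    have h1 := ha.2.1.2.ne
    have h2 := har.2.1.2.ne
    simp only [hK]
    finiteness
  have hKC : ((K.toNNReal : ℝ≥0) : ℝ≥0∞) = K := ENNReal.coe_toNNReal hKt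
  have hvmem : ∀ n, MemMixed T q p fun z => a (e n) z - a₀ z := fun n =>
    (ha.1 _ (hpos n)).sub hq hp ha.2.1
  have hvr : ∀ n, mixedNorm T r p (fun z => a (e n) z - a₀ z) ≤ K.toNNReal := by
    intro n
    rw [hKC]
    refine (mixedNorm_sub_le hr.le hp (ha.1 _ (hpos n)).1 ha.2.1.1).trans ?_
    calc _ ≤ C₂ + mixedNorm T r p a₀ := by gcongr; exact hC₂ n
      _ ≤ K := by rw [hK]; exact le_add_right (le_add_right le_add_self)
  have hvq : ∀ n, mixedNorm T q p (fun z => a (e n) z - a₀ z) ≤ K.toNNReal := by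
    intro n
    rw [hKC]
    refine (mixedNorm_sub_le hq hp (ha.1 _ (hpos n)).1 ha.2.1.1).trans ?_
    calc _ ≤ C₁ + mixedNorm T q p a₀ := by gcongr; exact hC₁ n
      _ ≤ K := by rw [hK]; exact le_add_right (le_add_right le_self_add)
  have hbq : ∀ n, mixedNorm T q.conjExponent s.conjExponent (b (e n)) ≤ K.toNNReal := by
    intro n
    rw [hKC]
    refine (hC₃ n).trans ?_
    rw [hK]; exact le_add_right le_add_self
  have hb1 : ∀ n, ∫ z, ‖b (e n) z‖ ∂stMeasure T ≤ K.toNNReal := by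
    intro n
    rw [integral_norm_eq_lintegral_enorm (hbi n).1]
    refine ENNReal.toReal_mono hKt ?_
    have h1 := lintegral_enorm_mul_le (q := q) (p := s) (q' := q.conjExponent)
      (p' := s.conjExponent) hone.1 (hbi n).1
    simp only [one_mul] at h1
    refine h1.trans ?_
    calc _ ≤ L * C₃ := by gcongr; exact hC₃ n
      _ ≤ K := by rw [hK]; exact le_add_self
  have hv0 : ∀ ψ : ℝ × T3 → ℝ, AEStronglyMeasurable ψ (stMeasure T) → ∀ M, (∀ z, ‖ψ z‖ ≤ M) →
      Tendsto (fun n => ∫ z, (a (e n) z - a₀ z) * ψ z ∂stMeasure T) atTop (𝓝 0) := by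
    intro ψ hψ M hM
    have hψm : MemMixed T q.conjExponent p.conjExponent ψ :=
      memMixed_of_bounded hψ M (ae_of_all _ hM)
    have h1 := ((ha.2.2 ψ hψm).comp he).sub_const (∫ z, a₀ z * ψ z ∂stMeasure T)
    rw [sub_self] at h1
    refine h1.congr fun n => ?_
    simp only [Function.comp_apply, sub_mul]
    rw [integral_sub ((ha.1 _ (hpos n)).integrable_mul hψm) (ha.2.1.integrable_mul hψm)]
  have htri := tendsto_trilinear hT (q := q) (q' := q.conjExponent) hr hp
    (one_le_conjExponent s) (v := fun n z => a (e n) z - a₀ z) (b := fun n => b (e n))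
    (fun n => (hvmem n).integrable hq hp) hvr hvq hv0 hbi hbq hb1 (fun k => by
      obtain ⟨M, hM⟩ := hbt.mode_bound (fun ε hε => (hb.1 ε hε).integrable
        (one_le_conjExponent _) (one_le_conjExponent _)) k
      exact ⟨M, fun n => hM _ (hpos n)⟩) (regKernel N θ)
  have htensor : ∀ n, Integrable (tensor (fun z => a (e n) z - a₀ z) (b (e n)))
      (tripleMeasure T) := fun n =>
    ⟨aestronglyMeasurable_tensor (hvmem n).1 (hbi n).1,
      (lintegral_tensor_le (q := q) (q' := q.conjExponent) hp (one_le_conjExponent s)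
        (hvmem n).1 (hbi n).1).trans_lt (ENNReal.mul_lt_top (hvmem n).2 (hb.1 _ (hpos n)).2)⟩
  have hprod : ∀ n, Integrable (fun z => spaceConv N (fun z => a (e n) z - a₀ z) z * b (e n) z *
      timeExtend hT.le θ z) (stMeasure T) := fun n =>
    ((memMixed_spaceConv hp hps hs (hvmem n) N).integrable_mul (hb.1 _ (hpos n))).mul_bdd
      (c := ‖θ‖) (continuous_timeExtend hT.le θ.continuous).aestronglyMeasurable
      (ae_of_all _ fun _ => θ.norm_coe_le_norm _)
  have h2 := (Complex.continuous_re.tendsto _).comp htri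
  rw [Complex.zero_re] at h2
  refine h2.congr fun n => ?_
  simp only [Function.comp_apply]
  rw [trilinear_regKernel hT.le N θ (htensor n) (hprod n), Complex.ofReal_re]

/-- The products converge weakly, for families with a subcritical exponent `s ≥ p`. -/
theorem tendsto_integral_product (hT : 0 < T) (hq : 1 ≤ q) (hp : 1 ≤ p) (hps : p ≤ s)
    (hs1 : 1 < s) (hs : s ≠ ⊤) (hcrit : 1 / p.toReal - 1 / s.toReal < 1 / 3) (hr : 1 < r) {m : ℤ}
    (ha : TendstoWeakStarSobolev T q p a a₀) (har : TendstoWeakStarMixed T r p a a₀)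
    (hb : TendstoWeakStarMixed T q.conjExponent s.conjExponent b b₀)
    (hbt : TimeDerivBounded T m b) {e : ℕ → ℝ} (he : Tendsto e atTop (𝓝[>] 0))
    (hpos : ∀ n, 0 < e n) (θ : C(Icc 0 T × T3, ℝ)) :
    Tendsto (fun n => ∫ z, a (e n) z * b (e n) z * timeExtend hT.le θ z ∂stMeasure T) atTop
      (𝓝 (∫ z, a₀ z * b₀ z * timeExtend hT.le θ z ∂stMeasure T)) := by
  have hqq := ENNReal.HolderConjugate.conjExponent hq
  have hss := ENNReal.HolderConjugate.conjExponent hs1.le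
  have hpt : p ≠ ⊤ := ne_top_of_le_ne_top hs hps
  obtain ⟨ha1, G, g, hG, hg, hGg⟩ := ha
  set Θ := timeExtend hT.le θ with hΘ
  have hΘc : Continuous Θ := continuous_timeExtend hT.le θ.continuous
  have hΘb : ∀ z, ‖Θ z‖ ≤ ‖θ‖ := fun z => θ.norm_coe_le_norm _
  have hgm : ∀ i, MemMixed T q p (g i) := fun i => (hGg i).2.1
  have hGm : ∀ n i, MemMixed T q p (G (e n) i) := fun n i => (hGg i).1 _ (hpos n)
  have ham : ∀ n, MemMixed T q s (a (e n)) := fun n =>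
    memMixed_of_weakGrad hq hp hps hs hcrit (ha1.1 _ (hpos n)) (hGm n) (hG _ (hpos n))
  have ha0m : MemMixed T q s a₀ := memMixed_of_weakGrad hq hp hps hs hcrit ha1.2.1 hgm hg
  have hbm : ∀ n, MemMixed T q.conjExponent s.conjExponent (b (e n)) := fun n => hb.1 _ (hpos n)
  obtain ⟨Cb, hCb⟩ := hb.exists_bound (one_le_conjExponent _) (one_le_conjExponent _)
    (conjExponent_ne_top hs1) he hpos
  choose CG hCG using fun i => (hGg i).exists_bound hq hp hpt he hpos
  -- A common bound for the gradient norms along the sequence and for the gradient of the limit.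
  set D : ℝ≥0∞ := ∑ i, (CG i : ℝ≥0∞) + ∑ i, mixedNorm T q p (g i) with hD
  have hDt : D ≠ ⊤ := by
    rw [hD]
    refine ENNReal.add_ne_top.2 ⟨ENNReal.sum_ne_top.2 fun i _ => ENNReal.coe_ne_top,
      ENNReal.sum_ne_top.2 fun i _ => (hgm i).2.ne⟩
  have hR := tendsto_approxRate hp hps hs hcrit
  have hRt := approxRate_ne_top hp hps hs hcrit
  -- regularization errors
  have herr : ∀ N n (f : ℝ × T3 → ℝ), MemMixed T q s (fun z => f z - spaceConv N f z) →
      mixedNorm T q s (fun z => f z - spaceConv N f z) ≤ approxRate p s N * D →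
      ‖∫ z, (f z - spaceConv N f z) * b (e n) z * Θ z ∂stMeasure T‖
        ≤ (approxRate p s N * D * Cb).toReal * ‖θ‖ := by
    intro N n f hf hle
    refine (norm_integral_mul_mul_le hf (hbm n) hΘb).trans ?_
    gcongr
    · exact ENNReal.mul_ne_top (ENNReal.mul_ne_top (hRt N) hDt) ENNReal.coe_ne_top
    · exact hCb n
  have herr1 : ∀ N n, ‖∫ z, (a (e n) z - spaceConv N (a (e n)) z) * b (e n) z * Θ z ∂stMeasure T‖
      ≤ (approxRate p s N * D * Cb).toReal * ‖θ‖ := by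
    intro N n
    refine herr N n _ (memMixed_sub_spaceConv hq hp hps hs hcrit (ha1.1 _ (hpos n)) (hGm n)
      (hG _ (hpos n)) N) ?_
    refine (mixedNorm_sub_spaceConv_le hq hp hps hs (ha1.1 _ (hpos n)) (hGm n)
      (hG _ (hpos n)) N).trans ?_
    gcongr
    rw [hD]
    exact le_add_right (Finset.sum_le_sum fun i _ => hCG i n)
  have herr2 : ∀ N n, ‖∫ z, (a₀ z - spaceConv N a₀ z) * b (e n) z * Θ z ∂stMeasure T‖
      ≤ (approxRate p s N * D * Cb).toReal * ‖θ‖ := by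
    intro N n
    refine herr N n _ (memMixed_sub_spaceConv hq hp hps hs hcrit ha1.2.1 hgm hg N) ?_
    refine (mixedNorm_sub_spaceConv_le hq hp hps hs ha1.2.1 hgm hg N).trans ?_
    gcongr
    rw [hD]
    exact le_add_self
  have herr0 : Tendsto (fun N => (approxRate p s N * D * Cb).toReal * ‖θ‖) atTop (𝓝 0) := by
    have h1 := ENNReal.Tendsto.mul_const (ENNReal.Tendsto.mul_const hR (Or.inr hDt))
      (Or.inr (ENNReal.coe_ne_top (r := Cb)))
    rw [zero_mul, zero_mul] at h1
    have h2 := ((ENNReal.tendsto_toReal ENNReal.zero_ne_top).comp h1).mul_const ‖θ‖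
    simpa using h2
  -- the term with the fixed factor
  have hfix : Tendsto (fun n => ∫ z, a₀ z * b (e n) z * Θ z ∂stMeasure T) atTop
      (𝓝 (∫ z, a₀ z * b₀ z * Θ z ∂stMeasure T)) := by
    have h1 := (hb.2.2 (fun z => a₀ z * Θ z) (by
      rw [conjExponent_conjExponent hq, conjExponent_conjExponent hs1.le]
      exact ha0m.mul_bounded hΘc hΘb)).comp he
    simpa only [Function.comp_def, mul_comm, mul_left_comm, mul_assoc] using h1
  -- splitting
  have hinteg : ∀ {f : ℝ × T3 → ℝ} n, MemMixed T q s f →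
      Integrable (fun z => f z * b (e n) z * Θ z) (stMeasure T) := fun n hf =>
    (hf.integrable_mul (hbm n)).mul_bdd (c := ‖θ‖) hΘc.aestronglyMeasurable (ae_of_all _ hΘb)
  have hsplit : ∀ N n, ∫ z, a (e n) z * b (e n) z * Θ z ∂stMeasure T
      - ∫ z, a₀ z * b (e n) z * Θ z ∂stMeasure T
      = (∫ z, (a (e n) z - spaceConv N (a (e n)) z) * b (e n) z * Θ z ∂stMeasure T)
        - (∫ z, (a₀ z - spaceConv N a₀ z) * b (e n) z * Θ z ∂stMeasure T)
        + ∫ z, spaceConv N (fun z => a (e n) z - a₀ z) z * b (e n) z * Θ z ∂stMeasure T := by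
    intro N n
    have hva := ha1.1 _ (hpos n)
    have m1 := hinteg n (memMixed_sub_spaceConv hq hp hps hs hcrit hva (hGm n) (hG _ (hpos n)) N)
    have m2 := hinteg n (memMixed_sub_spaceConv hq hp hps hs hcrit ha1.2.1 hgm hg N)
    have m3 := hinteg n (memMixed_spaceConv hp hps hs (hva.sub hq hp ha1.2.1) N)
    have m12 : Integrable (fun z => (a (e n) z - spaceConv N (a (e n)) z) * b (e n) z * Θ z
        - (a₀ z - spaceConv N a₀ z) * b (e n) z * Θ z) (stMeasure T) := m1.sub m2
    rw [← integral_sub (hinteg n (ham n)) (hinteg n ha0m), ← integral_sub m1 m2,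
      ← integral_add m12 m3]
    refine integral_congr_ae ?_
    filter_upwards [spaceConv_sub (N := N) (hva.integrable hq hp)
      (ha1.2.1.integrable hq hp)] with z hz
    simp only [hz]
    ring
  have hmain : Tendsto (fun n => ∫ z, a (e n) z * b (e n) z * Θ z ∂stMeasure T
      - ∫ z, a₀ z * b (e n) z * Θ z ∂stMeasure T) atTop (𝓝 0) := by
    rw [Metric.tendsto_atTop]
    intro ε hε
    -- The regularization parameter is chosen first, uniformly in `n`; the convergence at fixed `N`
    -- is used only afterwards.
    obtain ⟨N, hN⟩ := (herr0.eventually_lt_const (by positivity : 0 < ε / 3)).exists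
    obtain ⟨n₀, hn₀⟩ := Metric.tendsto_atTop.1 (tendsto_integral_spaceConv_sub hT hq hp hps hs1 hs
      hr ha1 har hb hbt he hpos θ N) (ε / 3) (by positivity)
    refine ⟨n₀, fun n hn => ?_⟩
    have h3 := hn₀ n hn
    rw [dist_zero_right] at h3 ⊢
    rw [hsplit N n]
    have h1 := (herr1 N n).trans_lt hN
    have h2 := (herr2 N n).trans_lt hN
    calc _ ≤ _ := (norm_add_le _ _).trans (add_le_add_left (norm_sub_le _ _) _)
      _ < ε / 3 + ε / 3 + ε / 3 := add_lt_add (add_lt_add h1 h2) h3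
      _ = ε := by ring
  have := hmain.add hfix
  simpa using this

end WeakProduct
end

/-! ### The weak continuity of the product -/

theorem proposition4p2 (T : ℝ) (hT : 0 < T) (q p s r : ℝ≥0∞)
    (hq1 : 1 ≤ q) (hq : q < ⊤) (hp1 : 1 ≤ p) (hp : p < 3)
    (hs1 : 1 ≤ s) (hs : s < 3 * p / (3 - p)) (hr : q < r) (m : ℤ)
    (a b : ℝ → ℝ × WeakProduct.T3 → ℝ) (a₀ b₀ : ℝ × WeakProduct.T3 → ℝ)
    (ha : WeakProduct.TendstoWeakStarSobolev T q p a a₀)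
    (hb : WeakProduct.TendstoWeakStarMixed T q.conjExponent s.conjExponent b b₀)
    (har : WeakProduct.TendstoWeakStarMixed T r p a a₀)
    (hbt : WeakProduct.TimeDerivBounded T m b) :
    (∀ ε : ℝ, 0 < ε → Integrable (fun z => a ε z * b ε z) (WeakProduct.stMeasure T)) ∧
    Integrable (fun z => a₀ z * b₀ z) (WeakProduct.stMeasure T) ∧
    ∀ e : ℕ → ℝ, Tendsto e atTop (𝓝[>] 0) →
      ∃ φ : ℕ → ℕ, StrictMono φ ∧
        ∀ θ : ℝ × WeakProduct.T3 → ℝ, ContinuousOn θ (Icc 0 T ×ˢ univ) →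
          Tendsto (fun n => ∫ z, a (e (φ n)) z * b (e (φ n)) z * θ z ∂(WeakProduct.stMeasure T))
            atTop (𝓝 (∫ z, a₀ z * b₀ z * θ z ∂(WeakProduct.stMeasure T))) := by
  -- From here on `s` is replaced by `s'`, for which both the Sobolev embedding and the bound on `b`
  -- are available.
  obtain ⟨s', hss', hps, hs'1, hs't, hcrit⟩ :=
    WeakProduct.exists_subcritical_exponent hp1 hp hs
  have hb' := hb.mono_exponent hs1 hss'
  have hqq := ENNReal.HolderConjugate.conjExponent hq1
  have hss := ENNReal.HolderConjugate.conjExponent hs'1.le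
  have ⟨ha1, G, g, hG, hg, hGg⟩ := ha
  refine ⟨fun ε hε => ?_, ?_, fun e he => ?_⟩
  · exact (WeakProduct.memMixed_of_weakGrad hq1 hp1 hps hs't hcrit (ha1.1 ε hε)
      (fun i => (hGg i).1 ε hε) (hG ε hε)).integrable_mul (hb'.1 ε hε)
  · exact (WeakProduct.memMixed_of_weakGrad hq1 hp1 hps hs't hcrit ha1.2.1
      (fun i => (hGg i).2.1) hg).integrable_mul hb'.2.1
  -- No extraction is needed: the limit is identified, so the whole sequence converges.
  · refine ⟨id, strictMono_id, fun θ hθ => ?_⟩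
    obtain ⟨θ', hθ'⟩ := WeakProduct.exists_continuous_extension hT.le hθ
    have hcongr : ∀ f : ℝ × WeakProduct.T3 → ℝ, ∫ z, f z * θ z ∂WeakProduct.stMeasure T
        = ∫ z, f z * WeakProduct.timeExtend hT.le θ' z ∂WeakProduct.stMeasure T := fun f =>
      integral_congr_ae (hθ'.mono fun z hz => by simp only [hz])
    simp only [hcongr, id_eq]
    -- The terms `e n` are positive only eventually, hence the shift of the index.
    obtain ⟨N, hN⟩ := eventually_atTop.1 (he.eventually self_mem_nhdsWithin)
    rw [← tendsto_add_atTop_iff_nat N]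
    exact WeakProduct.tendsto_integral_product hT hq1 hp1 hps hs'1 hs't hcrit (hq1.trans_lt hr)
      ha har hb' hbt (e := fun n => e (n + N)) (he.comp (tendsto_add_atTop_nat N))
      (fun n => hN _ (Nat.le_add_left N n)) θ'
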